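/- Let $n$ be an odd positive integer (for $n=1$ the assertion below is empty, so assume $n\ge3$ in the definitions), let $\mathfrak g=\mathfrak{sl}_{n+1}$ with simple roots $\alpha_1,\dots,\alpha_n$, Cartan matrix $(a_{kl})$ of type $A_n$, and symmetric bilinear form $(\alpha_k,\alpha_l)=a_{kl}$ on the root lattice. Let $U_v(\mathfrak g)$ be the quantized enveloping algebra over $\mathbb Q(v)$ with generators $E_k,F_k,K_k^{\pm1}$ (relations $K_kE_lK_k^{-1}=v^{a_{kl}}E_l$, $K_kF_lK_k^{-1}=v^{-a_{kl}}F_l$, $E_kF_l-F_lE_k=\delta_{kl}\frac{K_k-K_k^{-1}}{v-v^{-1}}$, the $K$'s commute, and the quantum Serre relations), and let $U_v(\mathfrak n)$ be the subalgebra generated by the $E_k$. Let $T_k=T'_{k,-1}$ be Lusztig's automorphisms ($T_k(E_k)=-K_k^{-1}F_k$, $T_k(F_k)=-E_kK_k$, $T_k(E_l)=E_lE_k-v^{-1}E_kE_l$ and $T_k(F_l)=F_kF_l-vF_lF_k$ if $|k-l|=1$, $T_k(E_l)=E_l$ and $T_k(F_l)=F_l$ if $|k-l|\ge2$, $T_k(K_l)=K_lK_k^{-a_{kl}}$).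 For the word $$w=s_1s_3\cdots s_n\,s_2s_4\cdots s_{n-1}\,s_1s_3\cdots s_n\,s_2s_4\cdots s_{n-1}=s_{j_1}\cdots s_{j_{2n}}$$ put $\beta_k=s_{j_1}\cdots s_{j_{k-1}}(\alpha_{j_k})$, $E(\beta_k)=T_{j_1}\cdots T_{j_{k-1}}(E_{j_k})\in U_v(\mathfrak n)$, and, for $\mathbf a\in\mathbb N^{2n}$, $E[\mathbf a]=\prod_{k=1}^{2n}\frac{1}{[a_k]!}E(\beta_k)^{a_k}$ (in increasing order of $k$), where $[m]=\frac{v^m-v^{-m}}{v-v^{-1}}$ and $[m]!=[m][m-1]\cdots[1]$. Kashiwara's form on $U_v(\mathfrak n)$ is the symmetric bilinear form with $(1,1)=1$ and $(E_kx,y)=(x,E_k'y)$, where $E_k'(E_l)=\delta_{kl}$ and $E_k'(xy)=E_k'(x)y+v^{(\alpha_k,|x|)}xE_k'(y)$ for homogeneous $x$. Let $E[\mathbf a]^*$ be the scalar multiple of $E[\mathbf a]$ with $(E[\mathbf a],E[\mathbf a]^*)=1$, and let $E^*(\beta_k)$ be the scalar multiple of $E(\beta_k)$ with $(E(\beta_k),E^*(\beta_k))=1$.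 For odd $i$ let $y_i$ and $z_i$ be the elements $E^*(\beta_k)$ belonging to the first and to the second occurrence of $s_i$ in $w$, respectively; for even $i$ let $z_i$ and $y_i$ be those belonging to the first and to the second occurrence, respectively. Write $|y_i|,|z_i|$ for their degrees (the corresponding roots $\beta_k$), and put $z_0=z_{n+1}=1$. Put $p_i=y_iz_i-v^{-1}z_{i-1}z_{i+1}$ for $i$ odd and $p_i=z_iy_i-v^{-1}z_{i-1}z_{i+1}$ for $i$ even, and $$o_{i,j}=\sum_{i\le s\le j,\ s\text{ odd}}|y_s|,\qquad e_{i,j}=\sum_{i\le s\le j,\ s\text{ even}}|y_s|.$$ Let $\sigma$ be the $\mathbb Q$-linear antiautomorphism of $U_v(\mathfrak n)$ with $\sigma(v)=v^{-1}$, $\sigma(E_k)=E_k$. For $\gamma=\sum d_k\alpha_k$ put $N(\gamma)=\frac12(\gamma,\gamma)-\sum_kd_k$. Let $\mathbf v_i\in\mathbb Z^{2n}$ be the exponent vector of $y_iz_i$ minus that of $z_{i-1}z_{i+1}$ (the factors $z_0,z_{n+1}$ being omitted), and write $\mathbf a\lhd\mathbf b$ if $\mathbf a-\mathbf b\in\sum_i\mathbb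 N\mathbf v_i$. The dual canonical basis element $B[\mathbf a]^*$ is the element with (1) $B[\mathbf a]^*-E[\mathbf a]^*\in\bigoplus_{\mathbf a\lhd\mathbf b,\ \mathbf b\ne\mathbf a}v^{-1}\mathbb Z[v^{-1}]E[\mathbf b]^*$, and (2) $\sigma(B[\mathbf a]^*)=v^{N(\sum_ka_k\beta_k)}B[\mathbf a]^*$. For $1\le i\le j\le n$ let $\Delta^v_{i,j}$ be the dual canonical basis element whose leading term $E[\mathbf a]^*$ is $\prod_{i\le r\le j,\ r\text{ odd}}y_r\prod_{i\le r\le j,\ r\text{ even}}y_r$. Then, for all $1\le i\le j\le n-1$, the elements $\Delta^v_{i,j}$ and $p_{j+1}$ are $v$-commutative. More precisely: if $j$ is even, then $$\Delta^v_{i,j}\,p_{j+1}=v^{(|y_{j+1}|,e_{i,j})+(|z_{j+1}|,e_{i,j})-(|z_{j+1}|,o_{i,j-1})}\,p_{j+1}\,\Delta^v_{i,j},$$ and if $j$ is odd, then $$\Delta^v_{i,j}\,p_{j+1}=v^{-(|y_{j+1}|,o_{i,j})+(|z_{j+1}|,e_{i,j})-(|z_{j+1}|,o_{i,j})}\,p_{j+1}\,\Delta^v_{i,j}.$$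 -/

import Mathlib

open Polynomial

noncomputable section

namespace QuantumTypeA

/-! ### Type `A_n`: Cartan matrix, root lattice, simple reflections -/

/-- The set `{1, …, n}` of vertices of the Dynkin diagram `A_n`. -/
abbrev Node (n : ℕ) : Type := ↥(Finset.Icc 1 n)

/-- The vertices `1, …, n` in increasing order. -/
def nodes (n : ℕ) : List (Node n) :=
  (List.finRange n).map fun k =>
    ⟨k.val + 1, Finset.mem_Icc.2 ⟨Nat.succ_le_succ (Nat.zero_le _), k.isLt⟩⟩

/-- The entries `a_{ij}` of the Cartan matrix of type `A_n`. -/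
def cartan {n : ℕ} (i j : Node n) : ℤ :=
  if i.1 = j.1 then 2 else if i.1 + 1 = j.1 ∨ j.1 + 1 = i.1 then -1 else 0

/-- The root lattice, the free abelian group on the simple roots. -/
abbrev RootLattice (n : ℕ) : Type := Node n → ℤ

/-- The simple root `α_i`. -/
def simpleRoot {n : ℕ} (i : Node n) : RootLattice n := Pi.single i 1

/-- The symmetric bilinear form on the root lattice with `(α_i, α_j) = a_{ij}`. -/
def rootForm {n : ℕ} (x y : RootLattice n) : ℤ := ∑ i, ∑ j, x i * cartan i j * y j

/-- The simple reflection `s_i`, with `s_i(α_j) = α_j - a_{ij} α_i`. -/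
def simpleReflection {n : ℕ} (i : Node n) (x : RootLattice n) : RootLattice n :=
  x - rootForm (simpleRoot i) x • simpleRoot i

/-! ### The ground field `ℚ(v)` -/

/-- The field `ℚ(v)`. -/
abbrev Kv : Type := RatFunc ℚ

/-- The indeterminate `v`. -/
def v : Kv := RatFunc.X

theorem v_ne_zero : v ≠ 0 := RatFunc.X_ne_zero

theorem aeval_inv_injective (k : Type) [Field k] :
    Function.Injective (Polynomial.aeval ((RatFunc.X : RatFunc k)⁻¹) : k[X] →ₐ[k] RatFunc k) := by
  rw [← transcendental_iff_injective]
  intro h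
  have h2 := h.inv
  rw [inv_inv] at h2
  exact RatFunc.transcendental_X h2

/-- For a field `k`, the `k`-linear field endomorphism of `k(v)` with `v ↦ v⁻¹`. -/
def invHom (k : Type) [Field k] : RatFunc k →+* RatFunc k :=
  (RatFunc.liftAlgHom (Polynomial.aeval ((RatFunc.X : RatFunc k)⁻¹) : k[X] →ₐ[k] RatFunc k)
    (nonZeroDivisors_le_comap_nonZeroDivisors_of_injective _ (aeval_inv_injective k))).toRingHom

theorem invHom_X (k : Type) [Field k] : invHom k RatFunc.X = RatFunc.X⁻¹ := by
  have h : invHom k (algebraMap k[X] (RatFunc k) Polynomial.X) = RatFunc.X⁻¹ := by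
    change RatFunc.liftAlgHom _ _ _ = _
    rw [RatFunc.liftAlgHom_apply]
    simp
  rwa [RatFunc.algebraMap_X] at h

/-- The field endomorphism of `ℚ(v)` with `v ↦ v⁻¹`. -/
def bar : Kv →+* Kv := invHom ℚ

theorem bar_v : bar v = v⁻¹ := invHom_X ℚ

/-- The quantum integer `[k]`. -/
def qInt (k : ℕ) : Kv := (v ^ k - (v⁻¹) ^ k) / (v - v⁻¹)

/-- The quantum factorial `[k]!`. -/
def qFactorial (k : ℕ) : Kv := ∏ l ∈ Finset.Icc 1 k, qInt l

/-! ### The quantized enveloping algebra `U_v(𝔤)`, `𝔤 = 𝔰𝔩_{n+1}` -/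

/-- The generators `E_i, F_i, K_i, K_i⁻¹`. -/
inductive Gen (n : ℕ) : Type
  | E (i : Node n) : Gen n
  | F (i : Node n) : Gen n
  | K (i : Node n) : Gen n
  | Kinv (i : Node n) : Gen n

/-- The free `ℚ(v)`-algebra on the generators of `U_v(𝔤)`. -/
abbrev Free (n : ℕ) : Type := FreeAlgebra Kv (Gen n)

def fE {n : ℕ} (i : Node n) : Free n := FreeAlgebra.ι Kv (Gen.E i)
def fF {n : ℕ} (i : Node n) : Free n := FreeAlgebra.ι Kv (Gen.F i)
def fK {n : ℕ} (i : Node n) : Free n := FreeAlgebra.ι Kv (Gen.K i)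
def fKinv {n : ℕ} (i : Node n) : Free n := FreeAlgebra.ι Kv (Gen.Kinv i)

/-- The defining relations of `U_v(𝔤)`. -/
inductive Rel (n : ℕ) : Free n → Free n → Prop
  | KK (i j : Node n) : Rel n (fK i * fK j) (fK j * fK i)
  | K_Kinv (i : Node n) : Rel n (fK i * fKinv i) 1
  | Kinv_K (i : Node n) : Rel n (fKinv i * fK i) 1
  | KE (i j : Node n) : Rel n (fK i * fE j * fKinv i) (v ^ cartan i j • fE j)
  | KF (i j : Node n) : Rel n (fK i * fF j * fKinv i) (v ^ (-cartan i j) • fF j)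
  | EF (i j : Node n) : Rel n (fE i * fF j - fF j * fE i)
      (if i = j then (v - v⁻¹)⁻¹ • (fK i - fKinv i) else 0)
  | serreE (i j : Node n) (h : cartan i j = -1) : Rel n
      (fE i ^ 2 * fE j - (v + v⁻¹) • (fE i * fE j * fE i) + fE j * fE i ^ 2) 0
  | serreF (i j : Node n) (h : cartan i j = -1) : Rel n
      (fF i ^ 2 * fF j - (v + v⁻¹) • (fF i * fF j * fF i) + fF j * fF i ^ 2) 0
  | commE (i j : Node n) (h : cartan i j = 0) : Rel n (fE i * fE j) (fE j * fE i)
  | commF (i j : Node n) (h : cartan i j = 0) : Rel n (fF i * fF j) (fF j * fF i)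

/-- The quantized enveloping algebra `U_v(𝔰𝔩_{n+1})`. -/
def Uq (n : ℕ) : Type := RingQuot (Rel n)

instance (n : ℕ) : Ring (Uq n) := inferInstanceAs (Ring (RingQuot (Rel n)))

instance (n : ℕ) : Algebra Kv (Uq n) := inferInstanceAs (Algebra Kv (RingQuot (Rel n)))

/-- The quotient map from the free algebra to `U_v(𝔤)`. -/
def proj (n : ℕ) : Free n →ₐ[Kv] Uq n := RingQuot.mkAlgHom Kv (Rel n)

theorem proj_rel {n : ℕ} {a b : Free n} (h : Rel n a b) : proj n a = proj n b :=
  RingQuot.mkAlgHom_rel Kv h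

/-! ### The anti-involution `σ` -/

/-- The semilinear antihomomorphism from the free algebra (as a monoid algebra) to `U_v(𝔤)` which
fixes the generators and sends `v` to `v⁻¹`. -/
def sigmaMon (n : ℕ) : MonoidAlgebra Kv (FreeMonoid (Gen n)) →+* (Uq n)ᵐᵒᵖ :=
  MonoidAlgebra.liftNCRingHom ((algebraMap Kv (Uq n)ᵐᵒᵖ).comp bar)
    (FreeMonoid.lift fun x : Gen n => MulOpposite.op (proj n (FreeAlgebra.ι Kv x)))
    (fun c _ => Algebra.commutes (bar c) _)

/-- The semilinear antihomomorphism from the free algebra to `U_v(𝔤)` which fixes the generators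
and sends `v` to `v⁻¹`. -/
def sigmaFree (n : ℕ) : Free n →+* (Uq n)ᵐᵒᵖ :=
  (sigmaMon n).comp (FreeAlgebra.equivMonoidAlgebraFreeMonoid (R := Kv) (X := Gen n)).toRingHom

theorem sigmaFree_ι {n : ℕ} (x : Gen n) :
    sigmaFree n (FreeAlgebra.ι Kv x) = MulOpposite.op (proj n (FreeAlgebra.ι Kv x)) := by
  have : (FreeAlgebra.equivMonoidAlgebraFreeMonoid (R := Kv) (X := Gen n)) (FreeAlgebra.ι Kv x)
      = MonoidAlgebra.single (FreeMonoid.of x) 1 := by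
    simp [FreeAlgebra.equivMonoidAlgebraFreeMonoid, MonoidAlgebra.of]
  refine (congrArg (sigmaMon n) this).trans ((MonoidAlgebra.liftNCRingHom_single _ _ _ _ _).trans ?_)
  simp

theorem sigmaFree_smul {n : ℕ} (c : Kv) (x : Free n) :
    sigmaFree n (c • x) = bar c • sigmaFree n x := by
  have h : sigmaFree n (algebraMap Kv (Free n) c) = algebraMap Kv (Uq n)ᵐᵒᵖ (bar c) := by
    have : (FreeAlgebra.equivMonoidAlgebraFreeMonoid (R := Kv) (X := Gen n))
        (algebraMap Kv (Free n) c) = MonoidAlgebra.single 1 c := by simp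
    refine (congrArg (sigmaMon n) this).trans ((MonoidAlgebra.liftNCRingHom_single _ _ _ _ _).trans ?_)
    simp
  rw [Algebra.smul_def, map_mul, h, Algebra.smul_def]

theorem sigmaFree_rel {n : ℕ} ⦃a b : Free n⦄ (h : Rel n a b) :
    sigmaFree n a = sigmaFree n b := by
  have sE : ∀ i, sigmaFree n (fE i) = MulOpposite.op (proj n (fE i)) := fun i => sigmaFree_ι _
  have sF : ∀ i, sigmaFree n (fF i) = MulOpposite.op (proj n (fF i)) := fun i => sigmaFree_ι _
  have sK : ∀ i, sigmaFree n (fK i) = MulOpposite.op (proj n (fK i)) := fun i => sigmaFree_ι _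
  have sL : ∀ i, sigmaFree n (fKinv i) = MulOpposite.op (proj n (fKinv i)) :=
    fun i => sigmaFree_ι _
  have KL : ∀ i, proj n (fK i) * proj n (fKinv i) = 1 := fun i => by
    simpa using proj_rel (Rel.K_Kinv i)
  have LK : ∀ i, proj n (fKinv i) * proj n (fK i) = 1 := fun i => by
    simpa using proj_rel (Rel.Kinv_K i)
  have conj : ∀ (i : Node n) (c : Kv) (x : Uq n), c ≠ 0 →
      proj n (fK i) * x * proj n (fKinv i) = c • x →
      proj n (fKinv i) * (x * proj n (fK i)) = c⁻¹ • x := by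
    intro i c x hc hx
    rw [eq_inv_smul_iff₀ hc, ← mul_smul_comm, ← smul_mul_assoc, ← hx, mul_assoc (_ * x), LK,
      mul_one, ← mul_assoc, LK, one_mul]
  apply MulOpposite.unop_injective
  cases h with
  | KK i j =>
    have := proj_rel (Rel.KK j i)
    simpa [sK] using this
  | K_Kinv i => simpa [sK, sL] using LK i
  | Kinv_K i => simpa [sK, sL] using KL i
  | KE i j =>
    have := proj_rel (Rel.KE i j)
    simp only [map_mul, map_smul] at this
    have := conj i _ _ (zpow_ne_zero _ v_ne_zero) this
    simpa [sK, sL, sE, sigmaFree_smul, bar_v] using this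
  | KF i j =>
    have := proj_rel (Rel.KF i j)
    simp only [map_mul, map_smul] at this
    have := conj i _ _ (zpow_ne_zero _ v_ne_zero) this
    simpa [sK, sL, sF, sigmaFree_smul, bar_v] using this
  | EF i j =>
    have := congrArg Neg.neg (proj_rel (Rel.EF i j))
    have hb : (v⁻¹ - v)⁻¹ = -(v - v⁻¹)⁻¹ := by rw [← neg_sub, inv_neg]
    split_ifs at this ⊢ with hij
    · simp only [map_mul, map_sub, map_smul, neg_sub] at this
      simp [sE, sF, sK, sL, sigmaFree_smul, bar_v, this, hb, neg_smul]
    · simp only [map_mul, map_sub, map_zero, neg_sub, neg_zero] at this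
      simp [sE, sF, this]
  | serreE i j h =>
    have := proj_rel (Rel.serreE i j h)
    simp only [map_mul, map_sub, map_add, map_smul, map_pow, map_zero] at this
    rw [← sub_eq_zero, ← this]
    simp [sE, sigmaFree_smul, bar_v, mul_assoc]
    abel_nf
  | serreF i j h =>
    have := proj_rel (Rel.serreF i j h)
    simp only [map_mul, map_sub, map_add, map_smul, map_pow, map_zero] at this
    rw [← sub_eq_zero, ← this]
    simp [sF, sigmaFree_smul, bar_v, mul_assoc]
    abel_nf
  | commE i j h =>
    have := proj_rel (Rel.commE i j h)
    simpa [sE] using this.symm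
  | commF i j h =>
    have := proj_rel (Rel.commF i j h)
    simpa [sF] using this.symm

/-- The `ℚ`-linear antihomomorphism `σ` of `U_v(𝔤)` with `σ(v) = v⁻¹` which fixes all generators.
On the subalgebra `U_v(𝔫)` it is the anti-involution with `σ(E_i) = E_i`. -/
def sigma (n : ℕ) (x : Uq n) : Uq n :=
  MulOpposite.unop (RingQuot.lift ⟨sigmaFree n, sigmaFree_rel⟩ x)

/-! ### Lusztig's automorphisms, the Weyl group element and the root vectors -/

/-- `K_i ^ m` for an integer `m`. -/
def fKpow {n : ℕ} (i : Node n) (m : ℤ) : Free n :=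
  if 0 ≤ m then fK i ^ m.toNat else fKinv i ^ (-m).toNat

/-- Lusztig's automorphism `T_i = T'_{i,-1}` of `U_v(𝔤)`, given on the generators. It is written
as a map of free algebras; `T_i` is the map which it induces on the quotient `U_v(𝔤)`. -/
def lusztigT {n : ℕ} (i : Node n) : Free n →ₐ[Kv] Free n :=
  FreeAlgebra.lift Kv fun g => match g with
    | Gen.E j =>
        if i = j then -(fKinv i * fF i)
        else if cartan i j = -1 then fE j * fE i - v⁻¹ • (fE i * fE j)
        else fE j
    | Gen.F j =>
        if i = j then -(fE i * fK i)
        else if cartan i j = -1 then fF i * fF j - v • (fF j * fF i)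
        else fF j
    | Gen.K j => fK j * fKpow i (-cartan i j)
    | Gen.Kinv j => fKpow i (cartan i j) * fKinv j

/-- The word `1, 3, 5, …, n, 2, 4, …, n - 1` (for odd `n`). -/
def halfWord (n : ℕ) : List (Node n) :=
  (nodes n).filter (fun i => i.1 % 2 = 1) ++ (nodes n).filter (fun i => i.1 % 2 = 0)

/-- Indices for the `2n` letters of the word
`w = s_1 s_3 ⋯ s_n s_2 s_4 ⋯ s_{n-1} s_1 s_3 ⋯ s_n s_2 s_4 ⋯ s_{n-1}`: the pair `(false, i)`
is the first occurrence of `s_i` and `(true, i)` is the second one. -/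
abbrev Idx (n : ℕ) : Type := Bool × Node n

/-- All indices, in the order of the letters of `w`. -/
def order (n : ℕ) : List (Idx n) :=
  (halfWord n).map (fun i => (false, i)) ++ (halfWord n).map (fun i => (true, i))

/-- The letters `j_1, …, j_{k-1}` of `w` that precede the letter with index `k`. -/
def prefixWord {n : ℕ} (k : Idx n) : List (Node n) :=
  ((order n).takeWhile (fun l => l ≠ k)).map Prod.snd

/-- The root `β_k = s_{j_1} ⋯ s_{j_{k-1}}(α_{j_k})`. -/
def beta {n : ℕ} (k : Idx n) : RootLattice n :=
  (prefixWord k).foldr simpleReflection (simpleRoot k.2)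

/-- The root vector `E(β_k) = T_{j_1} ⋯ T_{j_{k-1}}(E_{j_k})`; it has degree `β_k`. -/
def rootVector {n : ℕ} (k : Idx n) : Uq n :=
  proj n ((prefixWord k).foldr (fun i x => lusztigT i x) (fE k.2))

/-- The Poincaré–Birkhoff–Witt element
`E[a] = E^{(a_1)}(β_1) ⋯ E^{(a_{2n})}(β_{2n})`, a product of divided powers. -/
def pbw {n : ℕ} (a : Idx n → ℕ) : Uq n :=
  ((order n).map fun k => (qFactorial (a k))⁻¹ • rootVector k ^ a k).prod

/-! ### Kashiwara's bilinear form on `U_v(𝔫)` -/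

/-- The free algebra on `E_1, …, E_n`. -/
abbrev FreeN (n : ℕ) : Type := FreeAlgebra Kv (Node n)

/-- The map from the free algebra on `E_1, …, E_n` to `U_v(𝔤)`; its image is `U_v(𝔫)`. -/
def projN (n : ℕ) : FreeN n →ₐ[Kv] Uq n := FreeAlgebra.lift Kv fun i => proj n (fE i)

/-- Auxiliary map: `x ↦ !![θ_i(x), E_i'(x); 0, x]`, where `θ_i(x) = v^{(α_i, |x|)} x` for
homogeneous `x`. Multiplicativity is the Leibniz rule
`E_i'(xy) = E_i'(x) y + v^{(α_i, |x|)} x E_i'(y)`. -/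
def kashiwaraAux {n : ℕ} (i : Node n) : FreeN n →ₐ[Kv] Matrix (Fin 2) (Fin 2) (FreeN n) :=
  FreeAlgebra.lift Kv fun j =>
    !![v ^ cartan i j • FreeAlgebra.ι Kv j, if i = j then 1 else 0; 0, FreeAlgebra.ι Kv j]

/-- Kashiwara's operator `E_i'`, on the free algebra. -/
def kashiwaraOp {n : ℕ} (i : Node n) : Module.End Kv (FreeN n) where
  toFun x := kashiwaraAux i x 0 1
  map_add' x y := by rw [map_add, Matrix.add_apply]
  map_smul' c x := by rw [map_smul, Matrix.smul_apply, RingHom.id_apply]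

theorem kashiwaraAux_lower {n : ℕ} (i : Node n) (x : FreeN n) :
    kashiwaraAux i x 1 0 = 0 ∧ kashiwaraAux i x 1 1 = x := by
  induction x using FreeAlgebra.induction with
  | grade0 r => simp [Matrix.algebraMap_matrix_apply]
  | grade1 j => simp [kashiwaraAux]
  | mul a b ha hb => simp [Matrix.mul_apply, Fin.sum_univ_two, ha, hb]
  | add a b ha hb => simp [ha, hb]

/-- The values of Kashiwara's operators on generators. -/
theorem kashiwaraOp_ι {n : ℕ} (i j : Node n) :
    kashiwaraOp i (FreeAlgebra.ι Kv j) = if i = j then 1 else 0 := by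
  simp [kashiwaraOp, kashiwaraAux]

/-- The Leibniz rule for Kashiwara's operators. -/
theorem kashiwaraOp_mul {n : ℕ} (i : Node n) (x y : FreeN n) :
    kashiwaraOp i (x * y) = kashiwaraOp i x * y + kashiwaraAux i x 0 0 * kashiwaraOp i y := by
  simp [kashiwaraOp, Matrix.mul_apply, Fin.sum_univ_two, (kashiwaraAux_lower i y).2, add_comm]

/-- Kashiwara's form on the free algebra: the bilinear form with `(1, y)` the constant term of `y`
and `(E_i x, y) = (x, E_i'(y))`. -/
def freeForm {n : ℕ} (x y : FreeN n) : Kv :=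
  FreeAlgebra.algebraMapInv (MulOpposite.unop
    (FreeAlgebra.lift Kv (fun i : Node n => MulOpposite.op (kashiwaraOp i)) x) y)

theorem freeForm_one {n : ℕ} : freeForm (1 : FreeN n) 1 = 1 := by
  simp [freeForm]

/-- The endomorphism `E_i'` is adjoint to the left multiplication with `E_i`. -/
theorem freeForm_adjoint {n : ℕ} (i : Node n) (x y : FreeN n) :
    freeForm (FreeAlgebra.ι Kv i * x) y = freeForm x (kashiwaraOp i y) := by
  simp [freeForm]

/-- Kashiwara's bilinear form on `U_v(𝔫)`, computed on preimages in the free algebra on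
`E_1, …, E_n`. The value does not depend on the preimages, since the quantum Serre relations, which
are the defining relations of `U_v(𝔫)`, lie in the radical of the form on the free algebra. -/
def kashiwaraForm {n : ℕ} (x y : Uq n) : Kv :=
  freeForm (Function.invFun (projN n) x) (Function.invFun (projN n) y)

/-! ### The dual Poincaré–Birkhoff–Witt basis and the dual canonical basis -/

/-- The dual PBW element `E[a]^*`: the scalar multiple of `E[a]` with `(E[a], E[a]^*) = 1`. -/
def dualPBW {n : ℕ} (a : Idx n → ℕ) : Uq n := (kashiwaraForm (pbw a) (pbw a))⁻¹ • pbw a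

/-- The dual root vector `E^*(β_k)`: the scalar multiple of `E(β_k)` with
`(E(β_k), E^*(β_k)) = 1`. -/
def dualRootVector {n : ℕ} (k : Idx n) : Uq n :=
  (kashiwaraForm (rootVector k) (rootVector k))⁻¹ • rootVector k

/-- The index of `y_i`: the first occurrence of `s_i` if `i` is odd, the second one if `i` is
even. -/
def yIdx {n : ℕ} (i : Node n) : Idx n := (decide (Even i.1), i)

/-- The index of `z_i`: the second occurrence of `s_i` if `i` is odd, the first one if `i` is
even. -/
def zIdx {n : ℕ} (i : Node n) : Idx n := (decide (Odd i.1), i)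

/-- The generators `y_i` for `1 ≤ i ≤ n` (and `1` for all other indices). -/
def yElt (n i : ℕ) : Uq n := if h : i ∈ Finset.Icc 1 n then dualRootVector (yIdx ⟨i, h⟩) else 1

/-- The generators `z_i` for `1 ≤ i ≤ n`, with the convention `z_0 = z_{n+1} = 1`. -/
def zElt (n i : ℕ) : Uq n := if h : i ∈ Finset.Icc 1 n then dualRootVector (zIdx ⟨i, h⟩) else 1

/-- The degree `|y_i|` for `1 ≤ i ≤ n`. -/
def degY (n i : ℕ) : RootLattice n := if h : i ∈ Finset.Icc 1 n then beta (yIdx ⟨i, h⟩) else 0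

/-- The degree `|z_i|` for `1 ≤ i ≤ n`, and `|z_0| = |z_{n+1}| = 0`. -/
def degZ (n i : ℕ) : RootLattice n := if h : i ∈ Finset.Icc 1 n then beta (zIdx ⟨i, h⟩) else 0

/-- The elements `p_i` for `1 ≤ i ≤ n`. -/
def pElt (n i : ℕ) : Uq n :=
  if Odd i then yElt n i * zElt n i - v⁻¹ • (zElt n (i - 1) * zElt n (i + 1))
  else zElt n i * yElt n i - v⁻¹ • (zElt n (i - 1) * zElt n (i + 1))

/-- The degree `∑ a_k β_k` of `E[a]^*`. -/
def degree {n : ℕ} (a : Idx n → ℕ) : RootLattice n := ∑ k, (a k : ℤ) • beta k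

/-- The norm `N(γ) = (γ, γ) / 2 - ∑ d_i` of `γ = ∑ d_i α_i`; here `(γ, γ)` is always even. -/
def rootNorm {n : ℕ} (γ : RootLattice n) : ℤ := rootForm γ γ / 2 - ∑ i, γ i

/-- The exponent vector of `y_i z_i` minus the exponent vector of `z_{i-1} z_{i+1}`. -/
def straighteningVector {n : ℕ} (i : Node n) (k : Idx n) : ℤ :=
  (if k = yIdx i then 1 else 0) + (if k = zIdx i then 1 else 0)
    - (if k = zIdx k.2 ∧ (k.2.1 + 1 = i.1 ∨ k.2.1 = i.1 + 1) then 1 else 0)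

/-- The partial order on exponent vectors: `a ⊲ b` if `b` arises from `a` by subtracting a
combination of the vectors `straighteningVector i` with coefficients in `ℕ`. -/
def Below {n : ℕ} (a b : Idx n → ℕ) : Prop :=
  ∃ m : Node n → ℕ, ∀ k, (b k : ℤ) = a k - ∑ i, (m i : ℤ) * straighteningVector i k

/-- The element `B` is the dual canonical basis element `B[a]^*`, i.e. the element determined by
(1) `B - E[a]^*` is a `v⁻¹ ℤ[v⁻¹]`-linear combination of the `E[b]^*` with `a ⊲ b`, `b ≠ a`;
(2) `σ(B) = v^{N(a)} B`. -/
structure IsDualCanonical {n : ℕ} (a : Idx n → ℕ) (B : Uq n) : Prop where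
  triangular : ∃ c : (Idx n → ℕ) →₀ ℤ[X], (∀ b ∈ c.support, Below a b ∧ a ≠ b) ∧
    B - dualPBW a = c.sum fun b q => (v⁻¹ * Polynomial.eval₂ (Int.castRingHom Kv) v⁻¹ q) • dualPBW b
  sigma_eq : sigma n B = v ^ rootNorm (degree a) • B

/-- The exponent vector of `∏_{i ≤ r ≤ j, r odd} y_r ∏_{i ≤ r ≤ j, r even} y_r`. -/
def leadingExponent (n i j : ℕ) (k : Idx n) : ℕ :=
  if k = yIdx k.2 ∧ i ≤ k.2.1 ∧ k.2.1 ≤ j then 1 else 0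

/-- The element `D` is `Δ^v_{i,j}`, the dual canonical basis element with leading term
`∏_{i ≤ r ≤ j, r odd} y_r ∏_{i ≤ r ≤ j, r even} y_r`. -/
def IsDelta (n i j : ℕ) (D : Uq n) : Prop := IsDualCanonical (leadingExponent n i j) D

/-- `o_{i,j}`, the sum of the `|y_s|` over the odd `s` with `i ≤ s ≤ j`. -/
def oSum (n i j : ℕ) : RootLattice n := ∑ s ∈ (Finset.Icc i j).filter Odd, degY n s

/-- `e_{i,j}`, the sum of the `|y_s|` over the even `s` with `i ≤ s ≤ j`. -/
def eSum (n i j : ℕ) : RootLattice n := ∑ s ∈ (Finset.Icc i j).filter Even, degY n s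

end QuantumTypeA

end

open QuantumTypeA

noncomputable section

namespace QuantumTypeA

/-! Everything rests on one fact: each `p_k` commutes up to a power of `v` with every dual root
vector `E^*(β_x)`, with an exponent `lam k x` (`vcomm_pElt`). Consequently `p_k` also `v`-commutes
with every dual PBW element `E[a]^*`, and the exponent `∑ a_x lam k x` is linear in `a`
(`vcomm_dualPBW`). This linear functional vanishes on the straightening vectors (`lam_mesh`), a
consequence of the mesh relations `|y_i| + |z_i| = |z_{i-1}| + |z_{i+1}|` (`beta_add_beta`). Since
`a ⊲ b` means that `a - b` is a combination of straightening vectors, all terms in the expansion of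
`Δ_{i,j}` carry the exponent of the leading term. So `Δ_{i,j}` and `p_{j+1}` `v`-commute, and the
exponent is the sum of `lam (j+1)` over the `y_r` with `i ≤ r ≤ j`, which is then sorted by parity.

The word consists of four blocks of pairwise orthogonal reflections, and a letter sees only the
complete blocks before it. If `i` belongs to a block `l`, then `E_i = T_l(-F_i K_i)`, so commuting
`E_i` past `T_l(X)` amounts to commuting `F_i K_i` past `X`. If `F_i` commutes with `X`, only a
power of `v` arises, dictated by the degree (`eU_mul_TL`). Correction terms occur only between the
two root vectors of one node (`dualRootVector_mul_same`) and between `y_a` and `y_k` for neighbours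
`a`, `k` (`dualRootVector_mul_neighbour`); in each case the correction is `v - v⁻¹` times a product
of two `z`'s. The element `p_k` is built so that these corrections cancel (`vcomm_self_first`,
`vcomm_self_second`, `vcomm_neighbour_odd`, `vcomm_neighbour_even`).

Two foundations are needed. First, the `T_i` must be defined on `U_v(𝔤)`, which is a check of all
relations (`freeT_rel`). Second, the coefficient `v - v⁻¹` depends on the normalisation of the dual
root vectors, hence on Kashiwara's form. The form on the free algebra descends to `U_v(𝔫)` because
`U_v(𝔤)` acts on the free algebra modulo the radical as on a lowest weight module (`act`,
`kashiwaraForm_projN`). All root vectors are iterated `v`-commutators of distinct generators, and so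
have norm `(1 - v⁻²)^(h-1)`, where `h` is the number of generators (`Chain.freeForm`). -/

/-! ### Nonvanishing of the denominators in `ℚ(v)`. -/

theorem v_sub_ne_zero : v - v⁻¹ ≠ 0 := by
  have h2 : RatFunc.intDegree v = 1 := RatFunc.intDegree_X
  intro h
  have h1 : v * v = 1 := by
    have := congrArg (· * v) (sub_eq_zero.1 h)
    simpa [v_ne_zero] using this
  have h3 := RatFunc.intDegree_mul v_ne_zero v_ne_zero
  rw [h1, h2, RatFunc.intDegree_one] at h3
  omega

theorem v_sq_add_one_ne_zero : v ^ 2 + 1 ≠ 0 := by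
  intro h
  have h0 : (v ^ 2 : Kv) = algebraMap ℚ[X] Kv (X ^ 2) := by simp [v]
  rw [h0, ← map_one (algebraMap ℚ[X] Kv), ← map_add] at h
  have h1 := (map_eq_zero_iff _ (RatFunc.algebraMap_injective ℚ)).1 h
  have := congrArg (Polynomial.eval 0) h1
  simp at this

theorem v_add_ne_zero : v + v⁻¹ ≠ 0 := by
  intro h
  apply v_sq_add_one_ne_zero
  have := congrArg (· * v) h
  simp only [add_mul, zero_mul, inv_mul_cancel₀ v_ne_zero] at this
  rw [sq, this]

/-! ### `v`-commutators and Serre expressions in an algebra -/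

section Abstract

variable {F A : Type*} [Field F] [Ring A] [Algebra F A] {q : F}

/-- The `q`-commutator `xy - q⁻¹ yx`. -/
def br (q : F) (x y : A) : A := x * y - q⁻¹ • (y * x)

/-- The quantum Serre expression. -/
def serre (q : F) (x y : A) : A := x ^ 2 * y - (q + q⁻¹) • (x * y * x) + y * x ^ 2

theorem map_br {B : Type*} [Ring B] [Algebra F B] (φ : A →ₐ[F] B) (x y : A) :
    φ (br q x y) = br q (φ x) (φ y) := by simp [br]

theorem br_smul (c d : F) (x y : A) : br q (c • x) (d • y) = (c * d) • br q x y := by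
  simp only [br, smul_mul_assoc, mul_smul_comm]
  module

theorem serre_smul (c d : F) (x y : A) : serre q (c • x) (d • y) = (c ^ 2 * d) • serre q x y := by
  simp only [serre, smul_mul_assoc, mul_smul_comm, pow_two]
  module

theorem commute_br {x y z : A} (h₁ : Commute x y) (h₂ : Commute x z) :
    Commute x (br q y z) :=
  (h₁.mul_right h₂).sub_right ((h₂.mul_right h₁).smul_right _)

/-- `q`-commutators with commuting elements can be interchanged. -/
theorem br_br_right_comm {x y z : A} (h : Commute y z) : br q (br q x y) z = br q (br q x z) y := by
  have h' : y * z = z * y := h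
  have h'' : ∀ t, y * (z * t) = z * (y * t) := fun t => by rw [← mul_assoc, h', mul_assoc]
  simp only [br, mul_sub, sub_mul, smul_mul_assoc, mul_smul_comm, mul_assoc, h', h'', smul_sub]
  module

/-- `q`-commutators with commuting elements can be interchanged. -/
theorem br_br_left_comm {x y z : A} (h : Commute y z) : br q y (br q z x) = br q z (br q y x) := by
  have h' : y * z = z * y := h
  have h'' : ∀ t, y * (z * t) = z * (y * t) := fun t => by rw [← mul_assoc, h', mul_assoc]
  simp only [br, mul_sub, sub_mul, smul_mul_assoc, mul_smul_comm, mul_assoc, h', h'', smul_sub]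
  module

/-- The Serre expression is an iterated commutator: with `y = br q b a`, the difference `b y - q y
b` is exactly `serre q b a`. In the next lemma `y a - q a y` is likewise `serre q a b`. -/
theorem br_mul_left_of_serre (hq : q ≠ 0) {a b : A} (h : serre q b a = 0) : b * br q b a = q • (br q b a * b) := by
  rw [← sub_eq_zero, ← h]
  simp only [br, serre, mul_sub, sub_mul, smul_mul_assoc, mul_smul_comm, mul_assoc, smul_sub,
    pow_two]
  match_scalars <;> field_simp [hq] <;> ring

theorem br_mul_right_of_serre (hq : q ≠ 0) {a b : A} (h : serre q a b = 0) : br q b a * a = q • (a * br q b a) := by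
  rw [← sub_eq_zero, ← h]
  simp only [br, serre, mul_sub, sub_mul, smul_mul_assoc, mul_smul_comm, mul_assoc, smul_sub,
    pow_two]
  match_scalars <;> field_simp [hq] <;> ring

/-- Converse direction: a Serre relation can be verified by exhibiting the inner commutator and its
`q`-commutation with one of the two factors. This suits `T_i(E_i)`, whose commutator with `T_i(E_j)`
is simply `E_j`. -/
theorem serre_of_br (hq : q ≠ 0) {f x b : A} (h : br q f x = b) (hb : f * b = q • (b * f)) : serre q f x = 0 := by
  have h1 : f * x = b + q⁻¹ • (x * f) := by rw [← h]; simp [br]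
  have h2 : f * (f * x) = q • (b * f) + q⁻¹ • (b * f + q⁻¹ • (x * f * f)) := by
    rw [h1, mul_add, hb, mul_smul_comm, ← mul_assoc, h1, add_mul, smul_mul_assoc]
  simp only [serre, pow_two, mul_assoc] at *
  rw [h2, ← mul_assoc f x f, h1]
  simp only [smul_mul_assoc, add_mul, mul_assoc]
  match_scalars <;> field_simp [hq] <;> ring

theorem serre_of_br' (hq : q ≠ 0) {f x b : A} (h : br q f x = b) (hb : b * x = q • (x * b)) : serre q x f = 0 := by
  have h1 : f * x = b + q⁻¹ • (x * f) := by rw [← h]; simp [br]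
  have h2 : f * (x * x) = q • (x * b) + q⁻¹ • (x * b + q⁻¹ • (x * (x * f))) := by
    rw [← mul_assoc, h1, add_mul, hb, smul_mul_assoc, mul_assoc, h1, mul_add, mul_smul_comm]
  simp only [serre, pow_two, mul_assoc] at *
  rw [h2, h1]
  simp only [mul_smul_comm, mul_add]
  match_scalars <;> field_simp [hq] <;> ring

/-- The Serre expression is linear in its second argument, and `a` can be moved out of it to either
side because it commutes with `b`. -/
theorem serre_br_right {a b c : A} (h : Commute a b) (hs : serre q b c = 0) :
    serre q b (br q c a) = 0 := by
  have h' : a * b = b * a := h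
  have h'' : ∀ t, a * (b * t) = b * (a * t) := fun t => by rw [← mul_assoc, h', mul_assoc]
  have : serre q b (br q c a) = serre q b c * a - q⁻¹ • (a * serre q b c) := by
    simp only [br, serre, mul_sub, sub_mul, mul_add, add_mul, smul_mul_assoc, mul_smul_comm,
      mul_assoc, smul_sub, smul_add, pow_two, h', h'']
    module
  rw [this, hs]; simp

/-- Bracket the relation `serre q b c = 0` with `a` twice, with weights `q⁻²` and `1`. As `y = br q
b a` satisfies `y a = q a y`, bracketing a factor `b` once more after it has become `y` gives
nothing, so what survives has both factors `b` replaced by `y`, counted with multiplicity `q + q⁻¹`;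
this is why that scalar must be invertible. -/
theorem serre_br_left (hq : q ≠ 0) (hq2 : q + q⁻¹ ≠ 0) {a b c : A} (h : Commute a c) (hbc : serre q b c = 0)
    (hab : serre q a b = 0) : serre q (br q b a) c = 0 := by
  have r1 := br_mul_right_of_serre hq hab
  have r2 : b * a = br q b a + q⁻¹ • (a * b) := by simp [br]
  generalize br q b a = y at *
  have r1' : ∀ t, y * (a * t) = q • (a * (y * t)) := fun t => by
    rw [← mul_assoc, r1, smul_mul_assoc, mul_assoc]
  have r2' : ∀ t, b * (a * t) = y * t + q⁻¹ • (a * (b * t)) := fun t => by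
    rw [← mul_assoc, r2, add_mul, smul_mul_assoc, mul_assoc]
  have r3 : c * a = a * c := h.symm
  have r3' : ∀ t, c * (a * t) = a * (c * t) := fun t => by rw [← mul_assoc, r3, mul_assoc]
  have key : (q + q⁻¹) • serre q y c = (serre q b c * a - (q⁻¹) ^ 2 • (a * serre q b c)) * a
      - a * (serre q b c * a - (q⁻¹) ^ 2 • (a * serre q b c)) := by
    simp only [serre, mul_sub, sub_mul, mul_add, add_mul, smul_mul_assoc, mul_smul_comm,
      mul_assoc, smul_sub, smul_add, pow_two, r1, r1', r2, r2', r3, r3']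
    match_scalars <;> field_simp [hq] <;> ring
  rw [hbc] at key
  simpa [hq2] using key

/-- The same double bracketing with `a`, now applied to `b c - c b = 0`: both factors are converted,
again with multiplicity `q + q⁻¹`. -/
theorem commute_br_br (hq : q ≠ 0) (hq2 : q + q⁻¹ ≠ 0) {a b c : A} (h : Commute b c) (hab : serre q a b = 0) (hac : serre q a c = 0) :
    Commute (br q b a) (br q c a) := by
  have r1 := br_mul_right_of_serre hq hab
  have r2 : b * a = br q b a + q⁻¹ • (a * b) := by simp [br]
  have s1 := br_mul_right_of_serre hq hac
  have s2 : c * a = br q c a + q⁻¹ • (a * c) := by simp [br]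
  generalize br q b a = y at *
  generalize br q c a = z at *
  have r1' : ∀ t, y * (a * t) = q • (a * (y * t)) := fun t => by
    rw [← mul_assoc, r1, smul_mul_assoc, mul_assoc]
  have r2' : ∀ t, b * (a * t) = y * t + q⁻¹ • (a * (b * t)) := fun t => by
    rw [← mul_assoc, r2, add_mul, smul_mul_assoc, mul_assoc]
  have s1' : ∀ t, z * (a * t) = q • (a * (z * t)) := fun t => by
    rw [← mul_assoc, s1, smul_mul_assoc, mul_assoc]
  have s2' : ∀ t, c * (a * t) = z * t + q⁻¹ • (a * (c * t)) := fun t => by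
    rw [← mul_assoc, s2, add_mul, smul_mul_assoc, mul_assoc]
  have h0 : b * c - c * b = 0 := sub_eq_zero.2 h
  have key : (q + q⁻¹) • (y * z - z * y) =
      ((b * c - c * b) * a - (q⁻¹) ^ 2 • (a * (b * c - c * b))) * a
      - a * ((b * c - c * b) * a - (q⁻¹) ^ 2 • (a * (b * c - c * b))) := by
    simp only [mul_sub, sub_mul, mul_add, add_mul, smul_mul_assoc, mul_smul_comm,
      mul_assoc, smul_sub, smul_add, r1, r1', r2, r2', s1, s1', s2, s2']
    match_scalars <;> field_simp [hq] <;> ring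
  rw [h0] at key
  simp only [zero_mul, mul_zero, smul_zero, sub_zero, smul_eq_zero, hq2, false_or] at key
  exact sub_eq_zero.1 key

theorem units_zpow_mul {u : Aˣ} {x : A} {c : F} (hc : c ≠ 0) (h : u * x = c • (x * u)) (m : ℤ) :
    (↑(u ^ m) : A) * x = c ^ m • (x * ↑(u ^ m)) := by
  have hinv : (↑u⁻¹ : A) * x = c⁻¹ • (x * ↑u⁻¹) := by
    rw [Units.inv_mul_eq_iff_eq_mul, mul_smul_comm, ← mul_assoc, h, smul_mul_assoc, mul_assoc,
      Units.mul_inv, mul_one, smul_smul, inv_mul_cancel₀ hc, one_smul]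
  induction m with
  | zero => simp
  | succ m ih =>
    rw [zpow_add_one, zpow_add_one₀ hc, Units.val_mul, mul_assoc, h, mul_smul_comm, ← mul_assoc, ih,
      smul_mul_assoc, mul_assoc, smul_smul, mul_comm c]
  | pred m ih =>
    rw [zpow_sub_one, zpow_sub_one₀ hc, Units.val_mul, mul_assoc, hinv, mul_smul_comm, ← mul_assoc,
      ih, smul_mul_assoc, mul_assoc, smul_smul, mul_comm c⁻¹]

end Abstract

/-! ### Cartan matrix -/

variable {n : ℕ}

theorem cartan_self (i : Node n) : cartan i i = 2 := by simp [cartan]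

theorem cartan_comm (i j : Node n) : cartan i j = cartan j i := by
  simp only [cartan, eq_comm (a := j.1) (b := i.1), or_comm]

theorem cartan_cases (i j : Node n) : i = j ∨ (i ≠ j ∧ cartan i j = -1) ∨ (i ≠ j ∧ cartan i j = 0) := by
  by_cases h : i = j
  · exact Or.inl h
  · have : i.1 ≠ j.1 := fun h' => h (Subtype.ext h')
    simp only [cartan, this, if_false]
    split_ifs <;> simp [h]

theorem ne_of_cartan {i j : Node n} {c : ℤ} (h : cartan i j = c) (hc : c ≠ 2) : i ≠ j := by
  rintro rfl
  exact hc (h.symm.trans (cartan_self i))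

/-! ### Relations in `U_v(𝔤)` -/

def eU (i : Node n) : Uq n := proj n (fE i)
def fU (i : Node n) : Uq n := proj n (fF i)

/-- The unit `K_i` of `U_v(𝔤)`. -/
def kU (i : Node n) : (Uq n)ˣ where
  val := proj n (fK i)
  inv := proj n (fKinv i)
  val_inv := by simpa using proj_rel (Rel.K_Kinv i)
  inv_val := by simpa using proj_rel (Rel.Kinv_K i)

theorem kU_comm (i j : Node n) : Commute (kU i) (kU j) :=
  Units.ext (by
    have := proj_rel (Rel.KK i j)
    rw [map_mul, map_mul] at this
    exact this)

theorem proj_fKpow (i : Node n) (m : ℤ) : proj n (fKpow i m) = ↑(kU i ^ m) := by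
  unfold fKpow
  split_ifs with h
  · rw [map_pow]
    conv_rhs => rw [← Int.toNat_of_nonneg h]
    rw [zpow_natCast, Units.val_pow_eq_pow_val]; rfl
  · rw [map_pow]
    have : m = -((-m).toNat : ℤ) := by omega
    conv_rhs => rw [this]
    rw [zpow_neg, zpow_natCast, ← inv_pow, Units.val_pow_eq_pow_val]; rfl

/-- `x` has weight `w`: conjugation with `K_i` multiplies it with `v ^ w i`. -/
def HasWt (x : Uq n) (w : Node n → ℤ) : Prop :=
  ∀ i, (kU i : Uq n) * x = v ^ w i • (x * kU i)

theorem HasWt.congr {x : Uq n} {w w' : Node n → ℤ} (h : HasWt x w) (hw : ∀ i, w i = w' i) :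
    HasWt x w' := fun i => hw i ▸ h i

theorem HasWt.zpow {x : Uq n} {w : Node n → ℤ} (h : HasWt x w) (i : Node n) (m : ℤ) :
    (↑(kU i ^ m) : Uq n) * x = v ^ (m * w i) • (x * ↑(kU i ^ m)) := by
  rw [units_zpow_mul (zpow_ne_zero _ v_ne_zero) (h i), ← zpow_mul, mul_comm]

theorem HasWt.inv {x : Uq n} {w : Node n → ℤ} (h : HasWt x w) (i : Node n) :
    (↑(kU i)⁻¹ : Uq n) * x = v ^ (-w i) • (x * ↑(kU i)⁻¹) := by
  simpa using h.zpow i (-1)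

theorem HasWt.mul {x y : Uq n} {w w' : Node n → ℤ} (hx : HasWt x w) (hy : HasWt y w') :
    HasWt (x * y) (w + w') := fun i => by
  rw [← mul_assoc, hx i, smul_mul_assoc, mul_assoc, hy i, mul_smul_comm, smul_smul, mul_assoc,
    Pi.add_apply, zpow_add₀ v_ne_zero]

theorem HasWt.smul {x : Uq n} {w : Node n → ℤ} (hx : HasWt x w) (c : Kv) :
    HasWt (c • x) w := fun i => by
  rw [mul_smul_comm, hx i, smul_mul_assoc, smul_comm]

theorem HasWt.neg {x : Uq n} {w : Node n → ℤ} (hx : HasWt x w) : HasWt (-x) w := fun i => by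
  rw [mul_neg, hx i, neg_mul, smul_neg]

theorem HasWt.sub {x y : Uq n} {w : Node n → ℤ} (hx : HasWt x w) (hy : HasWt y w) :
    HasWt (x - y) w := fun i => by
  rw [mul_sub, hx i, hy i, sub_mul, smul_sub]

theorem HasWt.br {x y : Uq n} {w w' : Node n → ℤ} (hx : HasWt x w) (hy : HasWt y w') :
    HasWt (br v x y) (w + w') :=
  (hx.mul hy).sub (((hy.mul hx).congr fun _ => add_comm _ _).smul _)

theorem hasWt_kU (j : Node n) : HasWt (↑(kU j) : Uq n) 0 := fun i => by
  have := congrArg (Units.val) (kU_comm i j).eq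
  simpa using this

theorem hasWt_kU_inv (j : Node n) : HasWt (↑(kU j)⁻¹ : Uq n) 0 := fun i => by
  have := congrArg (Units.val) ((kU_comm i j).inv_right).eq
  simpa using this

theorem hasWt_eU (j : Node n) : HasWt (eU j) (fun i => cartan i j) := fun i => by
  have := proj_rel (Rel.KE i j)
  simp only [map_mul, map_smul] at this
  change (↑(kU i) : Uq n) * eU j * ↑(kU i)⁻¹ = v ^ cartan i j • eU j at this
  rw [Units.mul_inv_eq_iff_eq_mul] at this
  rw [this, smul_mul_assoc]

theorem hasWt_fU (j : Node n) : HasWt (fU j) (fun i => -cartan i j) := fun i => by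
  have := proj_rel (Rel.KF i j)
  simp only [map_mul, map_smul] at this
  change (↑(kU i) : Uq n) * fU j * ↑(kU i)⁻¹ = v ^ (-cartan i j) • fU j at this
  rw [Units.mul_inv_eq_iff_eq_mul] at this
  rw [this, smul_mul_assoc]

theorem eU_fU_self (i : Node n) : eU i * fU i = fU i * eU i +
    (v - v⁻¹)⁻¹ • ((↑(kU i) : Uq n) - ↑(kU i)⁻¹) := by
  have := proj_rel (Rel.EF i i)
  simp only [map_mul, map_smul, map_sub, if_true] at this
  rw [add_comm, ← sub_eq_iff_eq_add]
  exact this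

theorem commute_eU_fU {i j : Node n} (h : i ≠ j) : Commute (eU i) (fU j) := by
  have := proj_rel (Rel.EF i j)
  simp only [map_mul, map_sub, if_neg h, map_zero] at this
  exact sub_eq_zero.1 this

theorem commute_eU {i j : Node n} (h : cartan i j = 0) : Commute (eU i) (eU j) := by
  have := proj_rel (Rel.commE i j h)
  rw [map_mul, map_mul] at this
  exact this

theorem commute_fU {i j : Node n} (h : cartan i j = 0) : Commute (fU i) (fU j) := by
  have := proj_rel (Rel.commF i j h)
  rw [map_mul, map_mul] at this
  exact this

theorem serre_eU {i j : Node n} (h : cartan i j = -1) : serre v (eU i) (eU j) = 0 := by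
  have := proj_rel (Rel.serreE i j h)
  simp only [map_mul, map_sub, map_add, map_smul, map_pow, map_zero] at this
  exact this

theorem serre_fU {i j : Node n} (h : cartan i j = -1) : serre v (fU i) (fU j) = 0 := by
  have := proj_rel (Rel.serreF i j h)
  simp only [map_mul, map_sub, map_add, map_smul, map_pow, map_zero] at this
  exact this

/-! ### Moving `F_i` and `E_i` past `q`-commutators. -/

section Abstract

variable {F A : Type*} [Field F] [Ring A] [Algebra F A] {q h : F}

theorem sq_sub_one_ne_zero (hq : q ≠ 0) (hh : h * (q - q⁻¹) = 1) : q ^ 2 - 1 ≠ 0 := fun h0 => by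
  have : q - q⁻¹ = 0 := by field_simp; simpa using h0
  simp [this] at hh

/-- Only `a` fails to commute with `f`. The resulting error is `h` times the `q`-commutator of `b`
with `k - k'`; the weight of `b` makes the `k'` part vanish and gives the `k` part the factor `q -
q⁻¹`, which `h` cancels. -/
theorem br_mul_lowering (hq : q ≠ 0) (hh : h * (q - q⁻¹) = 1) {a b f k k' : A}
    (haf : a * f = f * a + h • (k - k')) (hbf : Commute b f) (hk : k * b = q⁻¹ • (b * k))
    (hk' : k' * b = q • (b * k')) : br q b a * f = f * br q b a + k * b := by
  have hbf' : b * f = f * b := hbf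
  have e : br q b a * f = b * (a * f) - q⁻¹ • (a * (b * f)) := by
    simp only [br, sub_mul, smul_mul_assoc, mul_assoc]
  rw [e, hbf', haf, ← mul_assoc a f b, haf, mul_add, ← mul_assoc b f a, hbf']
  simp only [br, mul_sub, add_mul, sub_mul, mul_smul_comm, smul_mul_assoc, mul_assoc, smul_sub,
    smul_add, hk, hk']
  have hne := sq_sub_one_ne_zero hq hh
  rw [eq_inv_of_mul_eq_one_left hh]
  match_scalars <;> field_simp <;> ring

/-- Mirror case, with the outer factor `b` failing to commute: here the `l` part vanishes and the
`l'` part survives. -/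
theorem br_mul_lowering_left (hq : q ≠ 0) (hh : h * (q - q⁻¹) = 1) {a b g l l' : A}
    (hbg : b * g = g * b + h • (l - l')) (hag : Commute a g) (hl : l * a = q⁻¹ • (a * l))
    (hl' : l' * a = q • (a * l')) : br q b a * g = g * br q b a - a * l' := by
  have hag' : a * g = g * a := hag
  have e : br q b a * g = b * (a * g) - q⁻¹ • (a * (b * g)) := by
    simp only [br, sub_mul, smul_mul_assoc, mul_assoc]
  rw [e, hag', hbg, ← mul_assoc b g a, hbg, mul_add, ← mul_assoc a g b, hag']
  simp only [br, mul_sub, add_mul, sub_mul, mul_smul_comm, smul_mul_assoc, mul_assoc, smul_sub,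
    smul_add, hl, hl']
  have hne := sq_sub_one_ne_zero hq hh
  rw [eq_inv_of_mul_eq_one_left hh]
  match_scalars <;> field_simp <;> ring

theorem raising_mul_br (hq : q ≠ 0) (hh : h * (q - q⁻¹) = 1) {a f y k k' : A}
    (hef : a * f = f * a + h • (k - k')) (hey : Commute a y) (hk : k * y = q • (y * k))
    (hk' : k' * y = q⁻¹ • (y * k')) : a * br q y f = br q y f * a - q⁻¹ • (y * k') := by
  have hey' : a * y = y * a := hey
  have e : a * br q y f = (a * y) * f - q⁻¹ • ((a * f) * y) := by
    simp only [br, mul_sub, mul_smul_comm, mul_assoc]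
  rw [e, hey', hef, mul_assoc y a f, hef, add_mul, mul_assoc f a y, hey', mul_add]
  simp only [br, mul_sub, sub_mul, mul_smul_comm, smul_mul_assoc, mul_assoc, smul_sub, smul_add, hk,
    hk']
  have hne := sq_sub_one_ne_zero hq hh
  rw [eq_inv_of_mul_eq_one_left hh]
  match_scalars <;> field_simp <;> ring

/-- If `u` commutes with `F_i` and has weight `-1` with respect to `K_i`, then
`-K_i⁻¹ F_i` and the `q`-commutator of `u` and `E_i` have the `q`-commutator `u`. -/
theorem br_lowering_br (hq : q ≠ 0) (hh : h * (q - q⁻¹) = 1) {a u f : A} {k : Aˣ}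
    (haf : a * f = f * a + h • (↑k - ↑k⁻¹)) (huf : Commute u f) (hk : ↑k * u = q⁻¹ • (u * ↑k))
    (hk' : ↑k⁻¹ * u = q • (u * ↑k⁻¹)) (hka' : ↑k⁻¹ * a = (q⁻¹) ^ 2 • (a * ↑k⁻¹)) :
    br q (-(↑k⁻¹ * f)) (br q u a) = u := by
  have h1 := br_mul_lowering hq hh haf huf hk hk'
  have h2 : (↑k⁻¹ : A) * br q u a = q⁻¹ • (br q u a * ↑k⁻¹) := by
    simp only [br, mul_sub, sub_mul, mul_smul_comm, smul_mul_assoc]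
    rw [← mul_assoc, hk', ← mul_assoc, hka', smul_mul_assoc, mul_assoc u, hka', smul_mul_assoc,
      mul_assoc a, hk']
    simp only [mul_smul_comm, mul_assoc]
    match_scalars <;> field_simp
  have h3 : q⁻¹ • (br q u a * (↑k⁻¹ * f)) = ↑k⁻¹ * (br q u a * f) := by
    rw [← mul_assoc, ← smul_mul_assoc, ← h2, mul_assoc]
  unfold br at h3 h1 ⊢
  rw [mul_neg, smul_neg, h3, h1, mul_add, ← mul_assoc _ (k : A), Units.inv_mul, one_mul]
  simp only [neg_mul, mul_assoc]
  abel

end Abstract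

theorem v_inv_mul : (v - v⁻¹)⁻¹ * (v - v⁻¹) = 1 := inv_mul_cancel₀ v_sub_ne_zero

/-! ### Lusztig's automorphisms on `U_v(𝔤)` -/

/-- Lusztig's map from the free algebra to `U_v(𝔤)`. -/
def freeT (i : Node n) : Free n →ₐ[Kv] Uq n := (proj n).comp (lusztigT i)

theorem freeT_E_self (i : Node n) : freeT i (fE i) = -(↑(kU i)⁻¹ * fU i) := by
  simp [freeT, lusztigT, fE, kU, fU]

theorem freeT_E_adj {i j : Node n} (h : cartan i j = -1) : freeT i (fE j) = br v (eU j) (eU i) := by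
  have := ne_of_cartan h (by decide)
  simp [freeT, lusztigT, fE, this, h, br, eU]

theorem freeT_E_far {i j : Node n} (h : cartan i j = 0) : freeT i (fE j) = eU j := by
  have := ne_of_cartan h (by decide)
  simp [freeT, lusztigT, fE, this, h, eU]

theorem freeT_F_self (i : Node n) : freeT i (fF i) = -(eU i * ↑(kU i)) := by
  simp [freeT, lusztigT, fF, kU, eU]

theorem freeT_F_adj {i j : Node n} (h : cartan i j = -1) :
    freeT i (fF j) = (-v) • br v (fU j) (fU i) := by
  have := ne_of_cartan h (by decide)
  simp [freeT, lusztigT, fF, this, h, br, fU, smul_sub, smul_smul, v_ne_zero]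
  abel

theorem freeT_F_far {i j : Node n} (h : cartan i j = 0) : freeT i (fF j) = fU j := by
  have := ne_of_cartan h (by decide)
  simp [freeT, lusztigT, fF, this, h, fU]

theorem freeT_K (i j : Node n) : freeT i (fK j) = ↑(kU j * kU i ^ (-cartan i j)) := by
  simp [freeT, lusztigT, fK, proj_fKpow, -zpow_neg]; rfl

theorem freeT_Kinv (i j : Node n) : freeT i (fKinv j) = ↑(kU j * kU i ^ (-cartan i j))⁻¹ := by
  rw [mul_inv_rev, zpow_neg, inv_inv]
  simp [freeT, lusztigT, fKinv, proj_fKpow, -Units.val_zpow_eq_zpow_val]; rfl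

/-- The weight of the image of `E_j`. -/
theorem hasWt_freeT_E (i j : Node n) :
    HasWt (freeT i (fE j)) (fun m => cartan m j - cartan i j * cartan m i) := by
  rcases cartan_cases i j with rfl | ⟨_, h⟩ | ⟨_, h⟩
  · rw [freeT_E_self]
    refine ((hasWt_kU_inv i).mul (hasWt_fU i)).neg.congr fun m => ?_
    simp [cartan_self]; ring
  · rw [freeT_E_adj h]
    refine ((hasWt_eU j).br (hasWt_eU i)).congr fun m => ?_
    simp [h]
  · rw [freeT_E_far h]
    refine (hasWt_eU j).congr fun m => ?_
    simp [h]

theorem hasWt_freeT_F (i j : Node n) :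
    HasWt (freeT i (fF j)) (fun m => -(cartan m j - cartan i j * cartan m i)) := by
  rcases cartan_cases i j with rfl | ⟨_, h⟩ | ⟨_, h⟩
  · rw [freeT_F_self]
    refine ((hasWt_eU i).mul (hasWt_kU i)).neg.congr fun m => ?_
    simp [cartan_self]; ring
  · rw [freeT_F_adj h]
    refine (((hasWt_fU j).br (hasWt_fU i)).smul _).congr fun m => ?_
    simp [h]; ring
  · rw [freeT_F_far h]
    refine (hasWt_fU j).congr fun m => ?_
    simp [h]

theorem HasWt.conj {x : Uq n} {w : Node n → ℤ} (hx : HasWt x w) (i j : Node n) (m : ℤ) :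
    (↑(kU j * kU i ^ m) : Uq n) * x = v ^ (w j + m * w i) • (x * ↑(kU j * kU i ^ m)) := by
  rw [Units.val_mul, mul_assoc, hx.zpow, mul_smul_comm, ← mul_assoc, hx j, smul_mul_assoc,
    smul_smul, mul_assoc, ← zpow_add₀ v_ne_zero, add_comm]

theorem HasWt.commute_kU {x : Uq n} {w : Node n → ℤ} (hx : HasWt x w) {i : Node n} {c : ℤ}
    (h : w i = c) : (↑(kU i) : Uq n) * x = v ^ c • (x * ↑(kU i)) := h ▸ hx i

theorem HasWt.commute_kU_inv {x : Uq n} {w : Node n → ℤ} (hx : HasWt x w) {i : Node n} {c : ℤ}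
    (h : w i = c) : (↑(kU i)⁻¹ : Uq n) * x = v ^ (-c) • (x * ↑(kU i)⁻¹) := h ▸ hx.inv i

/-- If `u` commutes with `F_i` and has weight `-1` with respect to `K_i`, then
`T_i(E_i)` and the `v`-commutator of `u` and `E_i` have the `v`-commutator `u`. -/
theorem br_freeT_br {u : Uq n} {w : Node n → ℤ} {i : Node n} (hu : HasWt u w) (hw : w i = -1)
    (hf : Commute u (fU i)) : br v (-(↑(kU i)⁻¹ * fU i)) (br v u (eU i)) = u := by
  refine br_lowering_br v_ne_zero v_inv_mul (eU_fU_self i) hf ?_ ?_ ?_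
  · simpa using hu.commute_kU hw
  · simpa using hu.commute_kU_inv hw
  · rw [(hasWt_eU i).commute_kU_inv (cartan_self i), zpow_neg, inv_pow]; rfl

theorem commute_kinv_fU {u : Uq n} {w : Node n → ℤ} {i : Node n} (hu : HasWt u w) (hw : w i = 0)
    (hf : Commute u (fU i)) : Commute u (-(↑(kU i)⁻¹ * fU i)) := by
  refine (Commute.mul_right ?_ hf).neg_right
  have := hu.commute_kU_inv hw
  simp only [neg_zero, zpow_zero, one_smul] at this
  exact this.symm

theorem commute_eU_kU {u : Uq n} {w : Node n → ℤ} {i : Node n} (hu : HasWt u w) (hw : w i = 0)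
    (he : Commute u (eU i)) : Commute u (-(eU i * ↑(kU i))) := by
  refine (Commute.mul_right he ?_).neg_right
  have := hu.commute_kU hw
  simp only [zpow_zero, one_smul] at this
  exact this.symm

theorem commute_freeT_E {i j l : Node n} (h : cartan j l = 0) :
    Commute (freeT i (fE j)) (freeT i (fE l)) := by
  -- The claim is symmetric in `j` and `l`, which reduces the nine relative positions of `i` to
  -- these three.
  wlog H : i = j ∨ (cartan i j = -1 ∧ i ≠ l) ∨ (cartan i j = 0 ∧ cartan i l = 0) generalizing j l
  · rcases cartan_cases i j with h1 | ⟨h0, h1⟩ | ⟨h0, h1⟩ <;>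
    rcases cartan_cases i l with h2 | ⟨h0', h2⟩ | ⟨h0', h2⟩ <;>
    exact (this (cartan_comm j l ▸ h) (by tauto)).symm
  rcases H with rfl | ⟨h1, h2⟩ | ⟨h1, h2⟩
  · rw [freeT_E_self, freeT_E_far h]
    exact (commute_kinv_fU (hasWt_eU l) h (commute_eU_fU (ne_of_cartan h (by decide)).symm)).symm
  · rcases cartan_cases i l with h3 | ⟨-, h3⟩ | ⟨-, h3⟩
    · exact absurd h3 h2
    · rw [freeT_E_adj h1, freeT_E_adj h3]
      exact commute_br_br v_ne_zero v_add_ne_zero (commute_eU h) (serre_eU h1) (serre_eU h3)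
    · rw [freeT_E_adj h1, freeT_E_far h3]
      exact (commute_br (commute_eU (cartan_comm j l ▸ h)) (commute_eU (cartan_comm i l ▸ h3))).symm
  · rw [freeT_E_far h1, freeT_E_far h2]
    exact commute_eU h

theorem commute_freeT_F {i j l : Node n} (h : cartan j l = 0) :
    Commute (freeT i (fF j)) (freeT i (fF l)) := by
  wlog H : i = j ∨ (cartan i j = -1 ∧ i ≠ l) ∨ (cartan i j = 0 ∧ cartan i l = 0) generalizing j l
  · rcases cartan_cases i j with h1 | ⟨h0, h1⟩ | ⟨h0, h1⟩ <;>
    rcases cartan_cases i l with h2 | ⟨h0', h2⟩ | ⟨h0', h2⟩ <;>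
    exact (this (cartan_comm j l ▸ h) (by tauto)).symm
  rcases H with rfl | ⟨h1, h2⟩ | ⟨h1, h2⟩
  · rw [freeT_F_self, freeT_F_far h]
    exact (commute_eU_kU (hasWt_fU l) (by simpa using h)
      (commute_eU_fU (ne_of_cartan h (by decide))).symm).symm
  · rcases cartan_cases i l with h3 | ⟨-, h3⟩ | ⟨-, h3⟩
    · exact absurd h3 h2
    · rw [freeT_F_adj h1, freeT_F_adj h3]
      exact ((commute_br_br v_ne_zero v_add_ne_zero (commute_fU h) (serre_fU h1)
        (serre_fU h3)).smul_left _).smul_right _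
    · rw [freeT_F_adj h1, freeT_F_far h3]
      exact ((commute_br (commute_fU (cartan_comm j l ▸ h))
        (commute_fU (cartan_comm i l ▸ h3))).smul_right _).symm
  · rw [freeT_F_far h1, freeT_F_far h2]
    exact commute_fU h

theorem kinv_fU_mul_eU {i j : Node n} (h : cartan i j = -1) :
    (-(↑(kU i)⁻¹ * fU i)) * eU j = v • (eU j * (-(↑(kU i)⁻¹ * fU i))) := by
  have := (hasWt_eU j).commute_kU_inv h
  rw [neg_neg, zpow_one] at this
  rw [neg_mul, mul_assoc, ← (commute_eU_fU (ne_of_cartan h (by decide)).symm).eq, ← mul_assoc, this,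
    smul_mul_assoc, mul_assoc, mul_neg, smul_neg]

theorem serre_freeT_E {i j l : Node n} (h : cartan j l = -1) :
    serre v (freeT i (fE j)) (freeT i (fE l)) = 0 := by
  have h' := cartan_comm j l ▸ h
  have hjl := ne_of_cartan h (by decide)
  rcases cartan_cases i j with rfl | ⟨_, h1⟩ | ⟨_, h1⟩
  · rw [freeT_E_self, freeT_E_adj h]
    exact serre_of_br v_ne_zero (br_freeT_br (hasWt_eU l) h (commute_eU_fU hjl.symm))
      (kinv_fU_mul_eU h)
  · rcases cartan_cases i l with rfl | ⟨_, h2⟩ | ⟨_, h2⟩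
    · rw [freeT_E_self, freeT_E_adj h1]
      exact serre_of_br' v_ne_zero (br_freeT_br (hasWt_eU j) h' (commute_eU_fU hjl))
        (br_mul_left_of_serre v_ne_zero (serre_eU h))
    -- The Dynkin diagram contains no triangle, so `i` cannot be adjacent to both ends of an edge.
    · exfalso
      simp only [cartan] at h h1 h2
      split_ifs at h h1 h2 <;> omega
    · rw [freeT_E_adj h1, freeT_E_far h2]
      exact serre_br_left v_ne_zero v_add_ne_zero (commute_eU h2) (serre_eU h) (serre_eU h1)
  · rcases cartan_cases i l with rfl | ⟨_, h2⟩ | ⟨_, h2⟩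
    · omega
    · rw [freeT_E_far h1, freeT_E_adj h2]
      exact serre_br_right (commute_eU h1) (serre_eU h)
    · rw [freeT_E_far h1, freeT_E_far h2]
      exact serre_eU h

/-- Counterpart of `br_freeT_br` for the `F`'s: the commutator of `T_i(F_i)` with `T_i(F_j)` returns
a multiple of `F_j`, which feeds the criteria `serre_of_br` and `serre_of_br'`. -/
theorem eU_kU_br_fU {i j : Node n} (h : cartan i j = -1) :
    br v (-(eU i * ↑(kU i))) (br v (fU j) (fU i)) = (v⁻¹ ^ 2) • fU j := by
  have hij := ne_of_cartan h (by decide)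
  have h1 := raising_mul_br v_ne_zero v_inv_mul (eU_fU_self i) (commute_eU_fU hij)
    (by simpa using (hasWt_fU j).commute_kU (c := 1) (by simp [h]))
    (by simpa using (hasWt_fU j).commute_kU_inv (c := 1) (by simp [h]))
  have h2 := ((hasWt_fU j).br (hasWt_fU i)).commute_kU (i := i) (c := -1)
    (by simp [h, cartan_self])
  rw [zpow_neg_one] at h2
  have h3 : eU i * ↑(kU i) * br v (fU j) (fU i) =
      v⁻¹ • (br v (fU j) (fU i) * (eU i * ↑(kU i)) - v⁻¹ • fU j) := by
    rw [mul_assoc, h2, mul_smul_comm, ← mul_assoc, h1, sub_mul, smul_mul_assoc,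
      mul_assoc (fU j), Units.inv_mul, mul_one, mul_assoc]
  generalize br v (fU j) (fU i) = x at *
  unfold br
  rw [neg_mul, h3, mul_neg, smul_neg, smul_sub, smul_smul, pow_two]
  abel

theorem eU_kU_mul_fU {i j : Node n} (h : cartan i j = -1) :
    (-(eU i * ↑(kU i))) * fU j = v • (fU j * (-(eU i * ↑(kU i)))) := by
  have := (hasWt_fU j).commute_kU (c := 1) (i := i) (by simp [h])
  rw [zpow_one] at this
  rw [neg_mul, mul_assoc, this, mul_smul_comm, ← mul_assoc,
    (commute_eU_fU (ne_of_cartan h (by decide))).eq, mul_assoc, mul_neg, smul_neg]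

theorem serre_freeT_F {i j l : Node n} (h : cartan j l = -1) :
    serre v (freeT i (fF j)) (freeT i (fF l)) = 0 := by
  have h' := cartan_comm j l ▸ h
  rcases cartan_cases i j with rfl | ⟨_, h1⟩ | ⟨_, h1⟩
  · rw [freeT_F_self, freeT_F_adj h, ← one_smul Kv (-(eU i * _)), serre_smul,
      serre_of_br v_ne_zero (eU_kU_br_fU h)
        (by rw [mul_smul_comm, eU_kU_mul_fU h, smul_comm, smul_mul_assoc]), smul_zero]
  · rcases cartan_cases i l with rfl | ⟨_, h2⟩ | ⟨_, h2⟩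
    · rw [freeT_F_self, freeT_F_adj h1, ← one_smul Kv (-(eU i * _)), serre_smul,
        serre_of_br' v_ne_zero (eU_kU_br_fU h')
          (by rw [smul_mul_assoc, br_mul_left_of_serre v_ne_zero (serre_fU h), smul_comm,
            mul_smul_comm]), smul_zero]
    · exfalso
      simp only [cartan] at h h1 h2
      split_ifs at h h1 h2 <;> omega
    · rw [freeT_F_adj h1, freeT_F_far h2, ← one_smul Kv (fU l), serre_smul,
        serre_br_left v_ne_zero v_add_ne_zero (commute_fU h2) (serre_fU h) (serre_fU h1), smul_zero]
  · rcases cartan_cases i l with rfl | ⟨_, h2⟩ | ⟨_, h2⟩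
    · omega
    · rw [freeT_F_far h1, freeT_F_adj h2, ← one_smul Kv (fU j), serre_smul,
        serre_br_right (commute_fU h1) (serre_fU h), smul_zero]
    · rw [freeT_F_far h1, freeT_F_far h2]
      exact serre_fU h

/-- The commutator of `T_i(E_j)` and `F_i`, for adjacent `i`, `j`. -/
theorem br_eU_mul_fU {i j : Node n} (h : cartan i j = -1) :
    br v (eU j) (eU i) * fU i = fU i * br v (eU j) (eU i) + ↑(kU i) * eU j :=
  br_mul_lowering v_ne_zero v_inv_mul (eU_fU_self i)
    (commute_eU_fU (ne_of_cartan h (by decide)).symm)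
    (by simpa using (hasWt_eU j).commute_kU h) (by simpa using (hasWt_eU j).commute_kU_inv h)

/-- The commutator of `T_i(E_j)` and `F_j`, for adjacent `i`, `j`. -/
theorem br_eU_mul_fU_left {i j : Node n} (h : cartan i j = -1) :
    br v (eU j) (eU i) * fU j = fU j * br v (eU j) (eU i) - eU i * ↑(kU j)⁻¹ :=
  br_mul_lowering_left v_ne_zero v_inv_mul (eU_fU_self j)
    (commute_eU_fU (ne_of_cartan h (by decide)))
    (by simpa using (hasWt_eU i).commute_kU (i := j) (c := -1) (cartan_comm i j ▸ h))
    (by simpa using (hasWt_eU i).commute_kU_inv (i := j) (c := -1) (cartan_comm i j ▸ h))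

/-- Moving `F_j` and `F_i` separately past `T_i(E_j)` produces `K_i E_j` and `E_i K_j⁻¹`; the
remaining products with `F_j` and `F_i` collapse by the `EF` relations for single nodes. The factor
`-v⁻¹` is compensated by the factor `-v` in `T_i(F_j)`. -/
theorem freeT_E_mul_F_adj {i j : Node n} (h : cartan i j = -1) :
    br v (eU j) (eU i) * br v (fU j) (fU i) - br v (fU j) (fU i) * br v (eU j) (eU i) =
      (-v⁻¹) • (v - v⁻¹)⁻¹ • ((↑(kU j) : Uq n) * ↑(kU i) - ↑(kU i)⁻¹ * ↑(kU j)⁻¹) := by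
  have hij := ne_of_cartan h (by decide)
  have h1 := br_eU_mul_fU h
  have h2 := br_eU_mul_fU_left h
  have k1 : fU j * ↑(kU i) = v⁻¹ • (↑(kU i) * fU j) := by
    rw [(hasWt_fU j).commute_kU (i := i) (c := 1) (by simp [h]), smul_smul]
    simp [v_ne_zero]
  have k2 : (↑(kU j)⁻¹ : Uq n) * fU i = v⁻¹ • (fU i * ↑(kU j)⁻¹) := by
    rw [(hasWt_fU i).commute_kU_inv (i := j) (c := 1) (by simp [← cartan_comm i j, h])]
    simp
  have k3 := (hasWt_kU j).commute_kU (i := i) (c := 0) rfl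
  have k4 := (hasWt_kU_inv j).commute_kU (i := i) (c := 0) rfl
  have k5 := (hasWt_kU_inv j).commute_kU_inv (i := i) (c := 0) rfl
  simp only [neg_zero, zpow_zero, one_smul] at k3 k4 k5
  have e1 := eU_fU_self i
  have e2 := eU_fU_self j
  generalize br v (eU j) (eU i) = x at *
  have key : x * br v (fU j) (fU i) - br v (fU j) (fU i) * x =
      fU j * (↑(kU i) * eU j) - (eU i * ↑(kU j)⁻¹) * fU i
      - v⁻¹ • ((↑(kU i) * eU j) * fU j) + v⁻¹ • (fU i * (eU i * ↑(kU j)⁻¹)) := by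
    have t1 : x * (fU j * fU i) = fU j * (fU i * x) + fU j * (↑(kU i) * eU j) -
        (eU i * ↑(kU j)⁻¹) * fU i := by
      rw [← mul_assoc, h2, sub_mul, mul_assoc, h1, mul_add]
    have t2 : x * (fU i * fU j) = fU i * (fU j * x) + (↑(kU i) * eU j) * fU j
        - fU i * (eU i * ↑(kU j)⁻¹) := by
      rw [← mul_assoc, h1, add_mul, mul_assoc, h2, mul_sub]; abel
    unfold br
    rw [mul_sub, sub_mul, mul_smul_comm, smul_mul_assoc, t1, t2, smul_sub, smul_add]
    simp only [mul_assoc]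
    abel
  rw [key, ← mul_assoc (fU j), k1, mul_assoc (eU i), k2, mul_assoc (kU i : Uq n), e2,
    mul_smul_comm, ← mul_assoc (eU i), e1]
  simp only [mul_add, add_mul, smul_mul_assoc, mul_smul_comm, mul_sub, sub_mul, mul_assoc, k3, k4,
    k5, smul_add, smul_sub, neg_smul]
  abel

theorem freeT_EF_self (i j : Node n) :
    freeT i (fE j) * freeT i (fF j) - freeT i (fF j) * freeT i (fE j) =
      (v - v⁻¹)⁻¹ • (freeT i (fK j) - freeT i (fKinv j)) := by
  rw [freeT_K, freeT_Kinv]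
  rcases cartan_cases i j with rfl | ⟨_, h⟩ | ⟨_, h⟩
  · have h1 : (kU i * kU i ^ (-cartan i i)) = (kU i)⁻¹ := by
      rw [cartan_self, ← zpow_one_add]; exact zpow_neg_one _
    have h2 : (↑(kU i)⁻¹ : Uq n) * (fU i * eU i) = (fU i * eU i) * ↑(kU i)⁻¹ := by
      rw [((hasWt_fU i).mul (hasWt_eU i)).commute_kU_inv (c := 0) (by simp)]; simp
    rw [h1, inv_inv, freeT_E_self, freeT_F_self, neg_mul_neg, neg_mul_neg, mul_assoc,
      ← mul_assoc (fU i), ← mul_assoc, h2, mul_assoc, Units.inv_mul, mul_one, mul_assoc (eU i),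
      Units.mul_inv_cancel_left, eU_fU_self, ← neg_sub (kU i : Uq n), smul_neg]
    abel
  · have h1 : (kU j * kU i ^ (-cartan i j)) = kU j * kU i := by rw [h]; simp
    rw [h1, freeT_E_adj h, freeT_F_adj h, mul_smul_comm, smul_mul_assoc, ← smul_sub,
      freeT_E_mul_F_adj h, smul_smul, neg_mul_neg, mul_inv_cancel₀ v_ne_zero, one_smul,
      mul_inv_rev, Units.val_mul, Units.val_mul]
  · have h1 : (kU j * kU i ^ (-cartan i j)) = kU j := by rw [h]; simp
    rw [h1, freeT_E_far h, freeT_F_far h, eU_fU_self]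
    abel

theorem freeT_EF_ne {i j l : Node n} (hjl : j ≠ l) :
    Commute (freeT i (fE j)) (freeT i (fF l)) := by
  rcases cartan_cases i j with rfl | ⟨hij, h1⟩ | ⟨hij, h1⟩
  · rw [freeT_E_self]
    rcases cartan_cases i l with h | ⟨_, h2⟩ | ⟨_, h2⟩
    · exact absurd h hjl
    · rw [freeT_F_adj h2]
      refine Commute.smul_right (Commute.neg_left ?_) _
      have h3 := br_mul_right_of_serre v_ne_zero (serre_fU h2)
      have h4 := ((hasWt_fU l).br (hasWt_fU i)).commute_kU_inv (i := i) (c := -1)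
        (by simp [h2, cartan_self])
      rw [neg_neg, zpow_one] at h4
      change _ * _ = _ * _
      rw [← mul_assoc, mul_assoc, ← inv_smul_smul₀ v_ne_zero (fU i * _), ← h3, mul_smul_comm,
        ← mul_assoc, h4, smul_mul_assoc, inv_smul_smul₀ v_ne_zero]
    · rw [freeT_F_far h2]
      exact (commute_kinv_fU (hasWt_fU l) (by simpa using h2)
        (commute_fU (cartan_comm i l ▸ h2))).symm
  · rw [freeT_E_adj h1]
    rcases cartan_cases i l with rfl | ⟨hil, h2⟩ | ⟨hil, h2⟩
    · rw [freeT_F_self]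
      refine Commute.neg_right ?_
      have h3 := br_mul_right_of_serre v_ne_zero (serre_eU h1)
      have h4 := ((hasWt_eU j).br (hasWt_eU i)).commute_kU (i := i) (c := 1)
        (by simp [h1, cartan_self])
      rw [zpow_one] at h4
      change _ * _ = _ * _
      rw [← mul_assoc, h3, mul_assoc, h4, smul_mul_assoc, mul_smul_comm, mul_assoc]
    · rw [freeT_F_adj h2]
      refine Commute.smul_right ?_ _
      have h3 : Commute (fU l) (br v (eU j) (eU i)) :=
        commute_br (commute_eU_fU hjl).symm (commute_eU_fU hil).symm
      have h4 := br_eU_mul_fU h1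
      have h5 : fU l * ↑(kU i) = v⁻¹ • (↑(kU i) * fU l) := by
        rw [(hasWt_fU l).commute_kU (i := i) (c := 1) (by simp [h2]), smul_smul]
        simp [v_ne_zero]
      -- The only obstruction to commuting is `[x, F_i] = K_i E_j`; it `v`-commutes with `F_l` with
      -- just the power that makes its two contributions to the commutator with `br v (fU l) (fU i)`
      -- cancel.
      have h6 : fU l * (↑(kU i) * eU j) = v⁻¹ • (↑(kU i) * eU j * fU l) := by
        rw [← mul_assoc, h5, smul_mul_assoc, mul_assoc, mul_assoc, (commute_eU_fU hjl).eq]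
      generalize br v (eU j) (eU i) = x at *
      change _ * _ = _ * _
      unfold br
      rw [mul_sub, sub_mul, mul_smul_comm, smul_mul_assoc, ← mul_assoc, ← h3.eq, mul_assoc, h4,
        ← mul_assoc, h4, add_mul, mul_add, h6, mul_assoc, mul_assoc _ x, ← h3.eq, smul_add]
      simp only [mul_assoc]
      abel
    · rw [freeT_F_far h2]
      exact (commute_br (commute_eU_fU hjl).symm (commute_eU_fU hil).symm).symm
  · rw [freeT_E_far h1]
    rcases cartan_cases i l with rfl | ⟨hil, h2⟩ | ⟨hil, h2⟩
    · rw [freeT_F_self]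
      exact commute_eU_kU (hasWt_eU j) h1 (commute_eU (cartan_comm i j ▸ h1))
    · rw [freeT_F_adj h2]
      exact Commute.smul_right (commute_br (commute_eU_fU hjl) (commute_eU_fU hij.symm)) _
    · rw [freeT_F_far h2]
      exact commute_eU_fU hjl

theorem freeT_rel (i : Node n) ⦃a b : Free n⦄ (h : Rel n a b) : freeT i a = freeT i b := by
  cases h with
  | KK j l =>
    rw [map_mul, map_mul, freeT_K, freeT_K]
    exact congrArg Units.val (Commute.mul_left ((kU_comm j l).mul_right (Commute.zpow_right
      (kU_comm j i) _)) (Commute.zpow_left ((kU_comm i l).mul_right (Commute.zpow_right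
      (kU_comm i i) _)) _)).eq
  | K_Kinv j => rw [map_mul, map_one, freeT_K, freeT_Kinv, Units.mul_inv]
  | Kinv_K j => rw [map_mul, map_one, freeT_K, freeT_Kinv, Units.inv_mul]
  | KE j l =>
    rw [map_mul, map_mul, map_smul, freeT_K, freeT_Kinv, Units.mul_inv_eq_iff_eq_mul,
      (hasWt_freeT_E i l).conj, smul_mul_assoc]
    congr 2
    rw [cartan_self, cartan_comm i j]; ring
  | KF j l =>
    rw [map_mul, map_mul, map_smul, freeT_K, freeT_Kinv, Units.mul_inv_eq_iff_eq_mul,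
      (hasWt_freeT_F i l).conj, smul_mul_assoc]
    congr 2
    rw [cartan_self, cartan_comm i j]; ring
  | EF j l =>
    split_ifs with hjl
    · subst hjl
      simpa only [map_mul, map_sub, map_smul] using freeT_EF_self i j
    · rw [map_sub, map_mul, map_mul, map_zero, sub_eq_zero]
      exact freeT_EF_ne hjl
  | serreE j l h =>
    simp only [map_mul, map_sub, map_smul, map_add, map_pow, map_zero]
    exact serre_freeT_E h
  | serreF j l h =>
    simp only [map_mul, map_sub, map_smul, map_add, map_pow, map_zero]
    exact serre_freeT_F h
  | commE j l h => rw [map_mul, map_mul]; exact commute_freeT_E h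
  | commF j l h => rw [map_mul, map_mul]; exact commute_freeT_F h

/-- Lusztig's automorphism `T_i` of `U_v(𝔤)`, as an endomorphism. -/
def T (i : Node n) : Uq n →ₐ[Kv] Uq n := RingQuot.liftAlgHom Kv ⟨freeT i, freeT_rel i⟩

theorem T_proj (i : Node n) (x : Free n) : T i (proj n x) = proj n (lusztigT i x) :=
  RingQuot.liftAlgHom_mkAlgHom_apply _ _ _ _

theorem T_eU_self (i : Node n) : T i (eU i) = -(↑(kU i)⁻¹ * fU i) :=
  (T_proj _ _).trans (freeT_E_self i)

theorem T_eU_adj {i j : Node n} (h : cartan i j = -1) : T i (eU j) = br v (eU j) (eU i) :=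
  (T_proj _ _).trans (freeT_E_adj h)

theorem T_eU_far {i j : Node n} (h : cartan i j = 0) : T i (eU j) = eU j :=
  (T_proj _ _).trans (freeT_E_far h)

theorem T_fU_self (i : Node n) : T i (fU i) = -(eU i * ↑(kU i)) :=
  (T_proj _ _).trans (freeT_F_self i)

theorem T_fU_far {i j : Node n} (h : cartan i j = 0) : T i (fU j) = fU j :=
  (T_proj _ _).trans (freeT_F_far h)

theorem T_kU (i j : Node n) : T i (↑(kU j)) = ↑(kU j * kU i ^ (-cartan i j)) :=
  (T_proj _ _).trans (freeT_K i j)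

theorem T_kU_inv (i j : Node n) : T i (↑(kU j)⁻¹) = ↑(kU j * kU i ^ (-cartan i j))⁻¹ :=
  (T_proj _ _).trans (freeT_Kinv i j)

/-! ### Serre expressions under skew derivations and under commutators with raising elements. -/

section Abstract

variable {F A : Type*} [Field F] [Ring A] [Algebra F A] {q h : F}

/-- Meant for `E_i'` as `d`: being killed by all `E_k'` is what puts the multiples of the Serre
expressions into the radical of the form. -/
theorem skew_derivation_serre_left (hq : q ≠ 0) {d : A →ₗ[F] A} {θ : A →ₐ[F] A}
    (hd : ∀ x y, d (x * y) = d x * y + θ x * d y) {a b : A} (ha : d a = 1) (hb : d b = 0)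
    (ha' : θ a = q ^ 2 • a) (hb' : θ b = q⁻¹ • b) : d (serre q a b) = 0 := by
  simp only [serre, pow_two, map_add, map_sub, map_smul, hd, ha, hb, ha', hb', mul_one,
    one_mul, mul_zero, add_zero, smul_mul_assoc, mul_smul_comm, mul_add, mul_assoc, smul_add,
    zero_add, zero_mul]
  match_scalars <;> field_simp <;> ring

theorem skew_derivation_serre_right (hq : q ≠ 0) {d : A →ₗ[F] A} {θ : A →ₐ[F] A}
    (hd : ∀ x y, d (x * y) = d x * y + θ x * d y) {a b : A} (ha : d a = 0) (hb : d b = 1)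
    (ha' : θ a = q⁻¹ • a) : d (serre q a b) = 0 := by
  simp only [serre, pow_two, map_add, map_sub, map_smul, hd, ha, hb, ha', mul_one,
    one_mul, mul_zero, add_zero, smul_mul_assoc, mul_smul_comm, mul_assoc, zero_add, zero_mul]
  match_scalars <;> field_simp <;> ring

/-- In the action on the free algebra modulo the radical, the Serre relation for the `F`'s is not
computed directly; it follows once its left-hand side commutes with every `E_k`. -/
theorem commute_serre_left (hq : q ≠ 0) {e f g k k' : A} (hef : e * f = f * e + h • (k - k'))
    (heg : e * g = g * e) (hkf : k * f = (q⁻¹ ^ 2) • (f * k)) (hkf' : k' * f = q ^ 2 • (f * k'))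
    (hkg : k * g = q • (g * k)) (hkg' : k' * g = q⁻¹ • (g * k')) : Commute e (serre q f g) := by
  have a1 : ∀ t, e * (f * t) = f * (e * t) + h • (k * t - k' * t) := fun t => by
    rw [← mul_assoc, hef, add_mul, smul_mul_assoc, sub_mul, mul_assoc]
  have a2 : ∀ t, e * (g * t) = g * (e * t) := fun t => by rw [← mul_assoc, heg, mul_assoc]
  have a3 : ∀ t, k * (f * t) = (q⁻¹ ^ 2) • (f * (k * t)) := fun t => by
    rw [← mul_assoc, hkf, smul_mul_assoc, mul_assoc]
  have a4 : ∀ t, k' * (f * t) = (q ^ 2) • (f * (k' * t)) := fun t => by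
    rw [← mul_assoc, hkf', smul_mul_assoc, mul_assoc]
  have a5 : ∀ t, k * (g * t) = q • (g * (k * t)) := fun t => by
    rw [← mul_assoc, hkg, smul_mul_assoc, mul_assoc]
  have a6 : ∀ t, k' * (g * t) = q⁻¹ • (g * (k' * t)) := fun t => by
    rw [← mul_assoc, hkg', smul_mul_assoc, mul_assoc]
  change _ * _ = _ * _
  simp only [serre, pow_two, mul_add, mul_sub, add_mul, sub_mul, mul_assoc, smul_mul_assoc,
    mul_smul_comm, smul_add, smul_sub, a1, a2, a3, a4, a5, a6, hef, heg, hkf, hkf', hkg, hkg']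
  match_scalars <;> field_simp <;> ring

theorem commute_serre_right (hq : q ≠ 0) {e f g k k' : A} (hef : e * f = f * e)
    (heg : e * g = g * e + h • (k - k')) (hkf : k * f = q • (f * k))
    (hkf' : k' * f = q⁻¹ • (f * k')) : Commute e (serre q f g) := by
  have a1 : ∀ t, e * (f * t) = f * (e * t) := fun t => by rw [← mul_assoc, hef, mul_assoc]
  have a2 : ∀ t, e * (g * t) = g * (e * t) + h • (k * t - k' * t) := fun t => by
    rw [← mul_assoc, heg, add_mul, smul_mul_assoc, sub_mul, mul_assoc]
  have a3 : ∀ t, k * (f * t) = q • (f * (k * t)) := fun t => by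
    rw [← mul_assoc, hkf, smul_mul_assoc, mul_assoc]
  have a4 : ∀ t, k' * (f * t) = q⁻¹ • (f * (k' * t)) := fun t => by
    rw [← mul_assoc, hkf', smul_mul_assoc, mul_assoc]
  change _ * _ = _ * _
  simp only [serre, pow_two, mul_add, mul_sub, add_mul, sub_mul, mul_assoc, smul_mul_assoc,
    mul_smul_comm, smul_add, smul_sub, a1, a2, a3, a4, hef, heg, hkf, hkf']
  match_scalars <;> field_simp <;> ring

theorem commute_serre {e f g : A} (hf : Commute e f) (hg : Commute e g) :
    Commute e (serre q f g) :=
  ((((hf.pow_right 2).mul_right hg).sub_right (((hf.mul_right hg).mul_right hf).smul_right _))).add_right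
    (hg.mul_right (hf.pow_right 2))

theorem commute_commutator {e f g k k' : A} (hef : e * f = f * e + h • (k - k'))
    (heg : e * g = g * e) (hkg : k * g = g * k) (hkg' : k' * g = g * k') :
    Commute e (f * g - g * f) := by
  change _ * _ = _ * _
  rw [mul_sub, ← mul_assoc, hef, ← mul_assoc, heg, add_mul, mul_assoc, heg, mul_assoc, hef,
    smul_mul_assoc, sub_mul, hkg, hkg', mul_add, sub_mul, mul_smul_comm, mul_sub]
  simp only [mul_assoc]
  abel

end Abstract

/-! ### Skew derivations on the free algebra -/

abbrev gen (i : Node n) : FreeN n := FreeAlgebra.ι Kv i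

/-- Induction along left multiplication with generators. -/
theorem freeN_induction {p : FreeN n → Prop} (h1 : p 1)
    (hmul : ∀ i x, p x → p (gen i * x)) (hadd : ∀ x y, p x → p y → p (x + y))
    (hsmul : ∀ (c : Kv) x, p x → p (c • x)) (x : FreeN n) : p x := by
  have key : ∀ x : FreeN n, ∀ y, p y → p (x * y) := by
    intro x
    induction x using FreeAlgebra.induction with
    | grade0 r => intro y hy; rw [← Algebra.smul_def]; exact hsmul _ _ hy
    | grade1 i => exact fun y hy => hmul i y hy
    | mul a b ha hb => intro y hy; rw [mul_assoc]; exact ha _ (hb _ hy)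
    | add a b ha hb => intro y hy; rw [add_mul]; exact hadd _ _ (ha _ hy) (hb _ hy)
  simpa using key x _ h1

/-- The automorphism of the free algebra with `E_j ↦ v^{m a_{ij}} E_j`. -/
def theta (i : Node n) (m : ℤ) : FreeN n →ₐ[Kv] FreeN n :=
  FreeAlgebra.lift Kv fun j => v ^ (m * cartan i j) • gen j

theorem theta_gen (i j : Node n) (m : ℤ) : theta i m (gen j) = v ^ (m * cartan i j) • gen j := by
  simp [theta]

theorem theta_theta (i : Node n) {m m' : ℤ} (h : m + m' = 0) (x : FreeN n) :
    theta i m (theta i m' x) = x := by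
  have : (theta i m).comp (theta i m') = AlgHom.id Kv (FreeN n) := by
    ext j
    simp only [AlgHom.comp_apply, Function.comp, AlgHom.coe_id, id]
    rw [theta_gen, map_smul, theta_gen, smul_smul, ← zpow_add₀ v_ne_zero, ← add_mul, add_comm, h]
    simp
  exact DFunLike.congr_fun this x

theorem theta_comm (i j : Node n) (m m' : ℤ) (x : FreeN n) :
    theta i m (theta j m' x) = theta j m' (theta i m x) := by
  have : (theta i m).comp (theta j m') = (theta j m').comp (theta i m) := by
    ext l
    simp only [Function.comp, AlgHom.coe_comp]
    rw [theta_gen, map_smul, theta_gen, map_smul, theta_gen, smul_comm]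
  exact DFunLike.congr_fun this x

theorem star_smul_freeN (c : Kv) (x : FreeN n) : star (c • x) = c • star x := by
  rw [Algebra.smul_def, star_mul, FreeAlgebra.star_algebraMap, ← Algebra.commutes,
    ← Algebra.smul_def]

theorem star_theta (i : Node n) (m : ℤ) (x : FreeN n) : star (theta i m x) = theta i m (star x) := by
  induction x using freeN_induction with
  | h1 => simp
  | hmul j x ih =>
    rw [map_mul, star_mul, ih, star_mul, map_mul, theta_gen, star_smul_freeN, FreeAlgebra.star_ι,
      theta_gen]
  | hadd x y hx hy => simp [hx, hy]
  | hsmul c x ih => simp only [map_smul, star_smul_freeN, ih]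

theorem kashiwaraAux_upper (i : Node n) (x : FreeN n) : kashiwaraAux i x 0 0 = theta i 1 x := by
  induction x using freeN_induction with
  | h1 => simp
  | hmul j x ih =>
    rw [map_mul, Matrix.mul_apply, Fin.sum_univ_two, (kashiwaraAux_lower i x).1, mul_zero, add_zero,
      ih, map_mul, theta_gen, one_mul]
    simp [kashiwaraAux]
  | hadd x y hx hy => simp [hx, hy]
  | hsmul c x ih => simp [ih]

theorem kashiwaraOp_mul' (i : Node n) (x y : FreeN n) :
    kashiwaraOp i (x * y) = kashiwaraOp i x * y + theta i 1 x * kashiwaraOp i y := by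
  rw [kashiwaraOp_mul, kashiwaraAux_upper]

theorem kashiwaraOp_gen_mul (i j : Node n) (x : FreeN n) :
    kashiwaraOp i (gen j * x) =
      (if i = j then x else 0) + v ^ cartan i j • (gen j * kashiwaraOp i x) := by
  rw [kashiwaraOp_mul', kashiwaraOp_ι, theta_gen, ite_mul, one_mul, one_mul, zero_mul,
    smul_mul_assoc]

theorem kashiwaraOp_one (i : Node n) : kashiwaraOp i (1 : FreeN n) = 0 := by
  simp [kashiwaraOp]

/-- The right-handed version of Kashiwara's operator. -/
def rightOp (i : Node n) : Module.End Kv (FreeN n) where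
  toFun x := star (kashiwaraOp i (star x))
  map_add' x y := by simp
  map_smul' c x := by simp [star_smul_freeN]

theorem rightOp_mul (i : Node n) (x y : FreeN n) :
    rightOp i (x * y) = x * rightOp i y + rightOp i x * theta i 1 y := by
  simp only [rightOp, LinearMap.coe_mk, AddHom.coe_mk]
  rw [star_mul, kashiwaraOp_mul', star_add, star_mul, star_mul, star_star, star_theta, star_star]

theorem rightOp_one (i : Node n) : rightOp i (1 : FreeN n) = 0 := by
  simp [rightOp, kashiwaraOp_one]

theorem rightOp_gen (i j : Node n) : rightOp i (gen j) = if i = j then 1 else 0 := by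
  simp only [rightOp, LinearMap.coe_mk, AddHom.coe_mk, FreeAlgebra.star_ι, kashiwaraOp_ι]
  split_ifs <;> simp

theorem rightOp_gen_mul (i j : Node n) (x : FreeN n) :
    rightOp i (gen j * x) = gen j * rightOp i x + (if i = j then theta i 1 x else 0) := by
  rw [rightOp_mul, rightOp_gen, ite_mul, one_mul, zero_mul]

theorem kashiwaraOp_theta (i j : Node n) (m : ℤ) (x : FreeN n) :
    kashiwaraOp j (theta i m x) = v ^ (m * cartan i j) • theta i m (kashiwaraOp j x) := by
  induction x using freeN_induction with
  | h1 => simp [kashiwaraOp_one]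
  | hmul k x ih =>
    rw [map_mul, theta_gen, smul_mul_assoc, map_smul, kashiwaraOp_gen_mul, kashiwaraOp_gen_mul, ih,
      map_add, map_smul, map_mul, theta_gen, smul_add, smul_add]
    congr 1
    · split_ifs with h
      · rw [h]
      · simp
    · simp only [mul_smul_comm, smul_mul_assoc, smul_smul]
      ring_nf
  | hadd x y hx hy => simp only [map_add, hx, hy, smul_add]
  | hsmul c x ih => simp only [map_smul, ih, smul_comm c]

theorem rightOp_theta (i j : Node n) (m : ℤ) (x : FreeN n) :
    rightOp j (theta i m x) = v ^ (m * cartan i j) • theta i m (rightOp j x) := by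
  simp only [rightOp, LinearMap.coe_mk, AddHom.coe_mk]
  rw [star_theta, kashiwaraOp_theta, star_smul_freeN, star_theta]

/-- The two operators remove letters counted from opposite ends; the powers of `v` which they
collect agree because the Cartan matrix is symmetric. -/
theorem kashiwaraOp_rightOp (i j : Node n) (x : FreeN n) :
    kashiwaraOp j (rightOp i x) = rightOp i (kashiwaraOp j x) := by
  induction x using freeN_induction with
  | h1 => simp [rightOp_one, kashiwaraOp_one]
  | hmul k x ih =>
    rw [rightOp_gen_mul, kashiwaraOp_gen_mul, map_add, map_add, map_smul, rightOp_gen_mul,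
      kashiwaraOp_gen_mul, ih, smul_add, add_assoc]
    congr 1
    · split_ifs <;> simp
    · congr 1
      split_ifs with h
      · rw [kashiwaraOp_theta, one_mul, ← h, cartan_comm]
      · simp
  | hadd x y hx hy => simp only [map_add, hx, hy]
  | hsmul c x ih => simp only [map_smul, ih]

/-- The constant term. -/
abbrev constTerm : FreeN n →ₐ[Kv] Kv := FreeAlgebra.algebraMapInv

theorem constTerm_gen (i : Node n) : constTerm (gen i) = 0 := by simp [FreeAlgebra.algebraMapInv]

theorem constTerm_theta (i : Node n) (m : ℤ) (x : FreeN n) :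
    constTerm (theta i m x) = constTerm x := by
  have : constTerm.comp (theta i m) = constTerm := by
    ext j
    simp only [Function.comp, AlgHom.coe_comp]
    rw [theta_gen, map_smul, constTerm_gen, smul_zero]
  exact DFunLike.congr_fun this x

/-- Both sides are the coefficient of the one-letter word `E_i`. This starts the induction for the
adjointness of right multiplication. -/
theorem constTerm_rightOp (i : Node n) (x : FreeN n) :
    constTerm (rightOp i x) = constTerm (kashiwaraOp i x) := by
  induction x using freeN_induction with
  | h1 => simp [rightOp_one, kashiwaraOp_one]
  | hmul k x ih =>
    rw [rightOp_gen_mul, kashiwaraOp_gen_mul, map_add, map_add, map_mul, map_smul, map_mul,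
      constTerm_gen]
    split_ifs <;> simp [constTerm_theta]
  | hadd x y hx hy => simp only [map_add, hx, hy]
  | hsmul c x ih => simp only [map_smul, ih]

/-! ### The form on the free algebra -/

theorem freeForm_add_left (x x' y : FreeN n) :
    freeForm (x + x') y = freeForm x y + freeForm x' y := by simp [freeForm]

theorem freeForm_smul_left (c : Kv) (x y : FreeN n) :
    freeForm (c • x) y = c * freeForm x y := by simp [freeForm]

theorem freeForm_add_right (x y y' : FreeN n) :
    freeForm x (y + y') = freeForm x y + freeForm x y' := by simp [freeForm]

theorem freeForm_smul_right (c : Kv) (x y : FreeN n) :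
    freeForm x (c • y) = c * freeForm x y := by simp [freeForm]

theorem freeForm_zero_right (x : FreeN n) : freeForm x 0 = 0 := by simp [freeForm]

theorem freeForm_sub_right (x y y' : FreeN n) :
    freeForm x (y - y') = freeForm x y - freeForm x y' := by simp [freeForm]

theorem freeForm_sub_left (x x' y : FreeN n) :
    freeForm (x - x') y = freeForm x y - freeForm x' y := by simp [freeForm]

theorem freeForm_one_left (y : FreeN n) : freeForm 1 y = constTerm y := by simp [freeForm]

theorem freeForm_gen_mul (i : Node n) (x y : FreeN n) :
    freeForm (gen i * x) y = freeForm x (kashiwaraOp i y) := freeForm_adjoint i x y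

theorem freeForm_mul_gen (i : Node n) (x y : FreeN n) :
    freeForm (x * gen i) y = freeForm x (rightOp i y) := by
  induction x using freeN_induction generalizing y with
  | h1 =>
    rw [one_mul, freeForm_one_left, constTerm_rightOp, ← mul_one (gen i), freeForm_gen_mul,
      freeForm_one_left]
  | hmul k x ih => rw [mul_assoc, freeForm_gen_mul, freeForm_gen_mul, ih, kashiwaraOp_rightOp]
  | hadd x x' hx hx' => rw [add_mul, freeForm_add_left, freeForm_add_left, hx, hx']
  | hsmul c x ih => rw [smul_mul_assoc, freeForm_smul_left, freeForm_smul_left, ih]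

/-- Adjointness in the second argument, obtained by induction on the first one before symmetry is
available; symmetry of the form is deduced from it. -/
theorem freeForm_gen_mul_right (i : Node n) (x y : FreeN n) :
    freeForm x (gen i * y) = freeForm (kashiwaraOp i x) y := by
  induction x using freeN_induction generalizing y with
  | h1 => rw [freeForm_one_left, map_mul, constTerm_gen, kashiwaraOp_one]; simp [freeForm]
  | hmul k x ih =>
    rw [freeForm_gen_mul, kashiwaraOp_gen_mul, kashiwaraOp_gen_mul, freeForm_add_right,
      freeForm_add_left, freeForm_smul_right, freeForm_smul_left, ih, freeForm_gen_mul,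
      cartan_comm i k]
    congr 1
    by_cases h : k = i
    · simp [h]
    · simp [h, Ne.symm h, freeForm]
  | hadd x x' hx hx' => rw [freeForm_add_left, map_add, freeForm_add_left, hx, hx']
  | hsmul c x ih => rw [freeForm_smul_left, map_smul, freeForm_smul_left, ih]

theorem freeForm_comm (x y : FreeN n) : freeForm x y = freeForm y x := by
  induction x using freeN_induction generalizing y with
  | h1 =>
    induction y using freeN_induction with
    | h1 => rfl
    | hmul k y ih => rw [freeForm_gen_mul_right, freeForm_gen_mul, kashiwaraOp_one]; simp [freeForm]
    | hadd x x' hx hx' => rw [freeForm_add_left, freeForm_add_right, hx, hx']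
    | hsmul c x ih => rw [freeForm_smul_left, freeForm_smul_right, ih]
  | hmul k x ih => rw [freeForm_gen_mul, freeForm_gen_mul_right, ih]
  | hadd x x' hx hx' => rw [freeForm_add_left, freeForm_add_right, hx, hx']
  | hsmul c x ih => rw [freeForm_smul_left, freeForm_smul_right, ih]

/-! ### The radical of the form and the action of `U_v(𝔤)` on the quotient by it -/

/-- The radical of Kashiwara's form on the free algebra. -/
def radical (n : ℕ) : Submodule Kv (FreeN n) where
  carrier := {x | ∀ y, freeForm y x = 0}
  zero_mem' y := freeForm_zero_right y
  add_mem' hx hx' y := by rw [freeForm_add_right, hx, hx', add_zero]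
  smul_mem' c x hx y := by rw [freeForm_smul_right, hx, mul_zero]

theorem gen_mul_mem_radical (i : Node n) {x : FreeN n} (hx : x ∈ radical n) :
    gen i * x ∈ radical n := fun y => by rw [freeForm_gen_mul_right, hx]

theorem kashiwaraOp_mem_radical (i : Node n) {x : FreeN n} (hx : x ∈ radical n) :
    kashiwaraOp i x ∈ radical n := fun y => by rw [← freeForm_gen_mul, hx]

theorem rightOp_mem_radical (i : Node n) {x : FreeN n} (hx : x ∈ radical n) :
    rightOp i x ∈ radical n := fun y => by rw [← freeForm_mul_gen, hx]

/-- A family of elements which is closed under all Kashiwara operators up to scalars, and whose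
members have constant term zero, is contained in the radical. -/
theorem mem_radical_of_family {ι : Type*} (f : ι → FreeN n) (h0 : ∀ t, constTerm (f t) = 0)
    (h1 : ∀ t i, ∃ (c : Kv) (s : ι), kashiwaraOp i (f t) = c • f s) (t : ι) :
    f t ∈ radical n := by
  intro y
  induction y using freeN_induction generalizing t with
  | h1 => rw [freeForm_one_left, h0]
  | hmul k y ih =>
    obtain ⟨c, s, hs⟩ := h1 t k
    rw [freeForm_gen_mul, hs, freeForm_smul_right, ih, mul_zero]
  | hadd y y' hy hy' => rw [freeForm_add_left, hy, hy', add_zero]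
  | hsmul c y ih => rw [freeForm_smul_left, ih, mul_zero]

theorem theta_mem_radical (i : Node n) (m : ℤ) {x : FreeN n} (hx : x ∈ radical n) :
    theta i m x ∈ radical n := by
  refine mem_radical_of_family (fun x : radical n => theta i m x)
    (fun x => ?_) (fun x k => ⟨_, ⟨_, kashiwaraOp_mem_radical k x.2⟩, kashiwaraOp_theta i k m x⟩)
    ⟨x, hx⟩
  rw [constTerm_theta, ← freeForm_one_left]
  exact x.2 1

/-- By the Leibniz rule `E_k'(w x)` is a scalar multiple of `w E_k'(x)`, so the elements `w x` form
a family stable under all `E_k'` and without constant terms. -/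
theorem mul_mem_radical_of_kashiwaraOp_eq_zero {w : FreeN n} (h0 : constTerm w = 0)
    (h1 : ∀ i, kashiwaraOp i w = 0) (h2 : ∀ i, ∃ c : Kv, theta i 1 w = c • w) (x : FreeN n) :
    w * x ∈ radical n := by
  refine mem_radical_of_family (fun x => w * x) (fun x => by rw [map_mul, h0, zero_mul])
    (fun x k => ?_) x
  obtain ⟨c, hc⟩ := h2 k
  exact ⟨c, kashiwaraOp k x, by rw [kashiwaraOp_mul', h1, zero_mul, zero_add, hc, smul_mul_assoc]⟩

theorem serre_gen_mul_mem_radical {i j : Node n} (h : cartan i j = -1) (x : FreeN n) :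
    serre v (gen i) (gen j) * x ∈ radical n := by
  have hij := ne_of_cartan h (by decide)
  refine mul_mem_radical_of_kashiwaraOp_eq_zero ?_ (fun k => ?_) (fun k => ?_) x
  · simp [serre, constTerm_gen]
  · by_cases h1 : k = i
    · subst h1
      refine skew_derivation_serre_left v_ne_zero (kashiwaraOp_mul' k) ?_ ?_ ?_ ?_
      · simp [gen, kashiwaraOp_ι]
      · simp [gen, kashiwaraOp_ι, hij]
      · rw [theta_gen, cartan_self]; rfl
      · rw [theta_gen, h]; simp
    · by_cases h2 : k = j
      · subst h2
        refine skew_derivation_serre_right v_ne_zero (kashiwaraOp_mul' k) ?_ ?_ ?_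
        · simp [gen, kashiwaraOp_ι, hij.symm]
        · simp [gen, kashiwaraOp_ι]
        · rw [theta_gen, cartan_comm, h]; simp
      · simp [serre, pow_two, kashiwaraOp_mul', gen, kashiwaraOp_ι, h1, h2]
  · refine ⟨(v ^ (1 * cartan k i)) ^ 2 * v ^ (1 * cartan k j), ?_⟩
    rw [← serre_smul]
    simp only [serre, map_add, map_sub, map_smul, map_mul, map_pow, theta_gen]

theorem commutator_gen_mul_mem_radical {i j : Node n} (h : cartan i j = 0) (x : FreeN n) :
    (gen i * gen j - gen j * gen i) * x ∈ radical n := by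
  have hij := ne_of_cartan h (by decide)
  refine mul_mem_radical_of_kashiwaraOp_eq_zero ?_ (fun k => ?_) (fun k => ?_) x
  · simp [constTerm_gen]
  · have h' := cartan_comm i j ▸ h
    by_cases h1 : k = i
    · subst h1
      simp [kashiwaraOp_gen_mul, gen, kashiwaraOp_ι, hij, h]
    · by_cases h2 : k = j
      · subst h2
        simp [kashiwaraOp_gen_mul, gen, kashiwaraOp_ι, hij.symm, h']
      · simp [kashiwaraOp_mul', gen, kashiwaraOp_ι, h1, h2]
  · refine ⟨v ^ (1 * cartan k i) * v ^ (1 * cartan k j), ?_⟩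
    rw [map_sub, map_mul, map_mul, theta_gen, theta_gen, smul_mul_smul_comm, smul_mul_smul_comm,
      smul_sub, mul_comm (v ^ (1 * cartan k j))]

/-- The quotient of the free algebra by the radical, as a vector space. -/
abbrev RadQuot (n : ℕ) : Type := FreeN n ⧸ radical n

/-- The class of an element of the free algebra. -/
abbrev mk : FreeN n →ₗ[Kv] RadQuot n := (radical n).mkQ

def actE (i : Node n) : Module.End Kv (RadQuot n) :=
  (radical n).mapQ (radical n) (LinearMap.mulLeft Kv (gen i)) fun _ hx => gen_mul_mem_radical i hx

/-- The action of `F_i` on the free algebra, where `U_v(𝔫)` is regarded as a lowest weight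
module. -/
def lowering (i : Node n) : Module.End Kv (FreeN n) :=
  (v - v⁻¹)⁻¹ • ((theta i (-1)).toLinearMap ∘ₗ kashiwaraOp i - rightOp i)

def actF (i : Node n) : Module.End Kv (RadQuot n) :=
  (radical n).mapQ (radical n) (lowering i) fun _ hx =>
    (radical n).smul_mem _ (Submodule.sub_mem _
      (theta_mem_radical i _ (kashiwaraOp_mem_radical i hx)) (rightOp_mem_radical i hx))

def actK (i : Node n) (m : ℤ) : Module.End Kv (RadQuot n) :=
  (radical n).mapQ (radical n) (theta i m).toLinearMap fun _ hx => theta_mem_radical i m hx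

theorem actE_mk (i : Node n) (x : FreeN n) : actE i (mk x) = mk (gen i * x) := rfl
theorem actF_mk (i : Node n) (x : FreeN n) : actF i (mk x) = mk (lowering i x) := rfl
theorem actK_mk (i : Node n) (m : ℤ) (x : FreeN n) : actK i m (mk x) = mk (theta i m x) := rfl

theorem lowering_apply (i : Node n) (x : FreeN n) :
    lowering i x = (v - v⁻¹)⁻¹ • (theta i (-1) (kashiwaraOp i x) - rightOp i x) := rfl

/-- This is the `EF` relation for the action. The twist by `theta i (-1)` in `lowering` cancels the
factor `v^{a_{ij}}` of the Leibniz rule, leaving `θ⁻¹` from the left derivation and `θ` from the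
right one. -/
theorem lowering_gen_mul (i j : Node n) (x : FreeN n) :
    gen j * lowering i x = lowering i (gen j * x) +
      (if j = i then (v - v⁻¹)⁻¹ • (theta i 1 x - theta i (-1) x) else 0) := by
  rw [lowering_apply, lowering_apply, kashiwaraOp_gen_mul, rightOp_gen_mul, map_add, map_smul,
    map_mul, theta_gen, smul_mul_assoc, smul_smul, ← zpow_add₀ v_ne_zero, mul_smul_comm]
  rw [show cartan i j + -1 * cartan i j = 0 by ring, zpow_zero, one_smul, mul_sub]
  by_cases h : i = j
  · simp only [h, if_true, ← smul_add]
    congr 1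
    abel
  · simp [h, Ne.symm h]

theorem lowering_theta (i j : Node n) (m : ℤ) (x : FreeN n) :
    lowering j (theta i m x) = v ^ (m * cartan i j) • theta i m (lowering j x) := by
  simp only [lowering_apply, kashiwaraOp_theta, rightOp_theta, map_smul, map_sub, smul_sub,
    theta_comm j i]
  simp only [smul_comm (v ^ (m * cartan i j))]

theorem end_ext {P Q : Module.End Kv (RadQuot n)} (h : ∀ x, P (mk x) = Q (mk x)) : P = Q :=
  LinearMap.ext fun y => by obtain ⟨x, rfl⟩ := (radical n).mkQ_surjective y; exact h x

theorem actK_mul_actK (i : Node n) {m m' : ℤ} (h : m + m' = 0) : actK i m * actK i m' = 1 :=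
  end_ext fun x => by
    rw [Module.End.mul_apply, actK_mk, actK_mk, theta_theta i h]; rfl

theorem actE_actF (i j : Node n) : actE i * actF j = actF j * actE i +
    (if i = j then (v - v⁻¹)⁻¹ • (actK i 1 - actK i (-1)) else 0) :=
  end_ext fun x => by
    rw [Module.End.mul_apply, LinearMap.add_apply, Module.End.mul_apply, actF_mk, actE_mk, actE_mk,
      actF_mk, lowering_gen_mul, map_add]
    congr 1
    split_ifs with h
    · subst h; rfl
    · rfl

theorem actK_actE (i j : Node n) (m : ℤ) :
    actK i m * actE j = v ^ (m * cartan i j) • (actE j * actK i m) :=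
  end_ext fun x => by
    rw [LinearMap.smul_apply, Module.End.mul_apply, Module.End.mul_apply, actE_mk, actK_mk, actK_mk,
      actE_mk, map_mul, theta_gen, smul_mul_assoc, map_smul]

theorem actK_actF (i j : Node n) (m : ℤ) :
    actK i m * actF j = v ^ (-(m * cartan i j)) • (actF j * actK i m) :=
  end_ext fun x => by
    rw [LinearMap.smul_apply, Module.End.mul_apply, Module.End.mul_apply, actF_mk, actK_mk, actK_mk,
      actF_mk, lowering_theta, map_smul, smul_smul, ← zpow_add₀ v_ne_zero, neg_add_cancel, zpow_zero,
      one_smul]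

/-- An operator which commutes with all `E_i` and kills the lowest weight vector is zero. -/
theorem end_eq_zero {P : Module.End Kv (RadQuot n)} (h : ∀ i, Commute (actE i) P)
    (h1 : P (mk 1) = 0) : P = 0 := by
  refine end_ext fun x => ?_
  rw [LinearMap.zero_apply]
  induction x using freeN_induction with
  | h1 => exact h1
  | hmul k x ih =>
    rw [← actE_mk, ← Module.End.mul_apply, ← (h k).eq, Module.End.mul_apply, ih, map_zero]
  | hadd x y hx hy => rw [map_add, map_add, hx, hy, add_zero]
  | hsmul c x ih => rw [map_smul, map_smul, ih, smul_zero]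

theorem actF_one (i : Node n) : actF i (mk 1) = 0 := by
  rw [actF_mk, lowering_apply, kashiwaraOp_one, rightOp_one]
  simp

theorem actF_one' (i : Node n) : actF i (Submodule.Quotient.mk 1) = 0 := actF_one i

theorem commute_actE_actF {i j : Node n} (h : i ≠ j) : Commute (actE i) (actF j) := by
  have := actE_actF i j
  rw [if_neg h, add_zero] at this
  exact this

theorem actE_actF_self (i : Node n) : actE i * actF i = actF i * actE i +
    (v - v⁻¹)⁻¹ • (actK i 1 - actK i (-1)) := by
  simpa using actE_actF i i

/-- The Serre expression in the `F`'s commutes with all `E_k` and kills the lowest weight vector,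
which generates the module under the `E_k`; hence it acts as zero. -/
theorem serre_actF {i j : Node n} (h : cartan i j = -1) : serre v (actF i) (actF j) = 0 := by
  have hij := ne_of_cartan h (by decide)
  refine end_eq_zero (fun k => ?_) ?_
  · by_cases h1 : k = i
    · subst h1
      refine commute_serre_left v_ne_zero (actE_actF_self k) (commute_actE_actF hij) ?_ ?_ ?_ ?_
      · rw [actK_actF, cartan_self, one_mul, zpow_neg, inv_pow]; rfl
      · rw [actK_actF, cartan_self]; rfl
      · rw [actK_actF, h]; simp
      · rw [actK_actF, h]; simp
    · by_cases h2 : k = j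
      · subst h2
        refine commute_serre_right v_ne_zero (commute_actE_actF h1) (actE_actF_self k) ?_ ?_
        · rw [actK_actF, cartan_comm, h]; simp
        · rw [actK_actF, cartan_comm, h]; simp
      · exact commute_serre (commute_actE_actF h1) (commute_actE_actF h2)
  · simp [serre, pow_two, Module.End.mul_apply, actF_one']

theorem commute_actF {i j : Node n} (h : cartan i j = 0) : actF i * actF j = actF j * actF i := by
  have hij := ne_of_cartan h (by decide)
  rw [← sub_eq_zero]
  refine end_eq_zero (fun k => ?_) ?_
  · by_cases h1 : k = i
    · subst h1
      refine commute_commutator (actE_actF_self k) (commute_actE_actF hij) ?_ ?_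
      · rw [actK_actF, h]; simp
      · rw [actK_actF, h]; simp
    · by_cases h2 : k = j
      · subst h2
        rw [← neg_sub]
        refine (commute_commutator (actE_actF_self k) (commute_actE_actF h1) ?_ ?_).neg_right
        · rw [actK_actF, cartan_comm, h]; simp
        · rw [actK_actF, cartan_comm, h]; simp
      · exact ((commute_actE_actF h1).mul_right (commute_actE_actF h2)).sub_right
          ((commute_actE_actF h2).mul_right (commute_actE_actF h1))
  · simp [Module.End.mul_apply, actF_one']

/-- The action of the free algebra. -/
def freeAct (n : ℕ) : Free n →ₐ[Kv] Module.End Kv (RadQuot n) :=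
  FreeAlgebra.lift Kv fun g => match g with
    | Gen.E i => actE i
    | Gen.F i => actF i
    | Gen.K i => actK i 1
    | Gen.Kinv i => actK i (-1)

theorem freeAct_E (i : Node n) : freeAct n (fE i) = actE i := by simp [freeAct, fE]
theorem freeAct_F (i : Node n) : freeAct n (fF i) = actF i := by simp [freeAct, fF]
theorem freeAct_K (i : Node n) : freeAct n (fK i) = actK i 1 := by simp [freeAct, fK]
theorem freeAct_Kinv (i : Node n) : freeAct n (fKinv i) = actK i (-1) := by simp [freeAct, fKinv]

theorem freeAct_rel ⦃a b : Free n⦄ (h : Rel n a b) : freeAct n a = freeAct n b := by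
  cases h with
  | KK i j =>
    rw [map_mul, map_mul, freeAct_K, freeAct_K]
    exact end_ext fun x => by
      rw [Module.End.mul_apply, Module.End.mul_apply, actK_mk, actK_mk, actK_mk, actK_mk,
        theta_comm]
  | K_Kinv i => rw [map_mul, map_one, freeAct_K, freeAct_Kinv, actK_mul_actK i (by norm_num)]
  | Kinv_K i => rw [map_mul, map_one, freeAct_K, freeAct_Kinv, actK_mul_actK i (by norm_num)]
  | KE i j =>
    rw [map_mul, map_mul, map_smul, freeAct_K, freeAct_Kinv, freeAct_E, actK_actE, smul_mul_assoc,
      mul_assoc, actK_mul_actK i (by norm_num), mul_one, one_mul]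
  | KF i j =>
    rw [map_mul, map_mul, map_smul, freeAct_K, freeAct_Kinv, freeAct_F, actK_actF, smul_mul_assoc,
      mul_assoc, actK_mul_actK i (by norm_num), mul_one, one_mul]
  | EF i j =>
    rw [map_sub, map_mul, map_mul, freeAct_E, freeAct_F, actE_actF, add_sub_cancel_left]
    split_ifs
    · rw [map_smul, map_sub, freeAct_K, freeAct_Kinv]
    · rw [map_zero]
  | serreE i j h =>
    simp only [map_mul, map_sub, map_smul, map_add, map_pow, map_zero, freeAct_E]
    refine end_ext fun x => ?_
    have := (Submodule.Quotient.mk_eq_zero _).2 (serre_gen_mul_mem_radical h x)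
    refine Eq.trans ?_ this
    change _ = mk _
    simp only [serre, pow_two, add_mul, sub_mul, smul_mul_assoc, mul_assoc, map_add, map_sub,
      map_smul, ← actE_mk]
    rfl
  | serreF i j h =>
    simp only [map_mul, map_sub, map_smul, map_add, map_pow, map_zero, freeAct_F]
    exact serre_actF h
  | commE i j h =>
    rw [map_mul, map_mul, freeAct_E, freeAct_E, ← sub_eq_zero]
    refine end_ext fun x => ?_
    have := (Submodule.Quotient.mk_eq_zero _).2 (commutator_gen_mul_mem_radical h x)
    refine Eq.trans ?_ this
    change _ = mk _
    simp only [sub_mul, mul_assoc, map_sub, ← actE_mk]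
    rfl
  | commF i j h => rw [map_mul, map_mul, freeAct_F, freeAct_F, commute_actF h]

/-- The action of `U_v(𝔤)` on the quotient of the free algebra by the radical of the form. -/
def act (n : ℕ) : Uq n →ₐ[Kv] Module.End Kv (RadQuot n) :=
  RingQuot.liftAlgHom Kv ⟨freeAct n, freeAct_rel⟩

theorem act_eU (i : Node n) : act n (eU i) = actE i :=
  (RingQuot.liftAlgHom_mkAlgHom_apply _ _ _ _).trans (freeAct_E i)

theorem projN_gen (i : Node n) : projN n (gen i) = eU i := by simp [projN, eU]

/-- Applying an element of `U_v(𝔫)` to the lowest weight vector recovers any preimage modulo the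
radical. Hence the kernel of `projN` lies in the radical, and the form does not depend on the choice
of preimages. -/
theorem act_projN_mk_one (x : FreeN n) : act n (projN n x) (mk 1) = mk x := by
  induction x using freeN_induction with
  | h1 => simp
  | hmul k x ih => rw [map_mul, map_mul, Module.End.mul_apply, ih, projN_gen, act_eU, actE_mk]
  | hadd x y hx hy => simp only [map_add, LinearMap.add_apply, hx, hy]
  | hsmul c x ih => simp only [map_smul, LinearMap.smul_apply, ih]

theorem sub_mem_radical_of_projN_eq {x y : FreeN n} (h : projN n x = projN n y) :
    x - y ∈ radical n := by
  rw [← Submodule.Quotient.eq]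
  have := act_projN_mk_one x
  rw [h, act_projN_mk_one] at this
  exact this.symm

/-- Kashiwara's form on `U_v(𝔫)` is induced by the form on the free algebra. -/
theorem kashiwaraForm_projN (x y : FreeN n) :
    kashiwaraForm (projN n x) (projN n y) = freeForm x y := by
  have hinv : ∀ z : FreeN n, projN n (Function.invFun (projN n) (projN n z)) = projN n z :=
    fun z => Function.invFun_eq ⟨z, rfl⟩
  have h1 := sub_mem_radical_of_projN_eq (hinv x)
  have h2 := sub_mem_radical_of_projN_eq (hinv y)
  unfold kashiwaraForm
  generalize Function.invFun (projN n) (projN n x) = x' at *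
  generalize Function.invFun (projN n) (projN n y) = y' at *
  have h3 := h2 x'
  have h4 := h1 y
  rw [freeForm_sub_right, sub_eq_zero] at h3 h4
  rw [h3, freeForm_comm, h4, freeForm_comm]

section Abstract

variable {F A : Type*} [Field F] [Ring A] [Algebra F A] {q : F}

theorem sub_inv_smul_smul (x : A) : x - q⁻¹ • q⁻¹ • x = (1 - q⁻¹ ^ 2) • x := by module

end Abstract

/-! ### Norms of multiplicity-free iterated `v`-commutators -/

/-- Iterated `v`-commutators of pairwise distinct generators, where every new generator is
connected with exactly one of the previous ones. The list records the generators involved. -/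
inductive Chain : List (Node n) → FreeN n → Prop
  | base (k : Node n) : Chain [k] (gen k)
  | right {s : List (Node n)} {x : FreeN n} (i : Node n) (h : Chain s x) (hi : i ∉ s)
      (hc : (s.map (cartan i)).sum = -1) : Chain (i :: s) (br v x (gen i))
  | left {s : List (Node n)} {x : FreeN n} (i : Node n) (h : Chain s x) (hi : i ∉ s)
      (hc : (s.map (cartan i)).sum = -1) : Chain (i :: s) (br v (gen i) x)

theorem Chain.theta {s : List (Node n)} {x : FreeN n} (h : Chain s x) (i : Node n) :
    theta i 1 x = v ^ (s.map (cartan i)).sum • x := by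
  induction h with
  | base k => simp [theta_gen]
  | @right s x j h hi hc ih =>
    rw [map_br, ih, theta_gen, br_smul, ← zpow_add₀ v_ne_zero, one_mul, List.map_cons,
      List.sum_cons, add_comm]
  | @left s x j h hi hc ih =>
    rw [map_br, ih, theta_gen, br_smul, ← zpow_add₀ v_ne_zero, one_mul, List.map_cons,
      List.sum_cons]

theorem Chain.kashiwaraOp {s : List (Node n)} {x : FreeN n} (h : Chain s x) {i : Node n}
    (hs : i ∉ s) : kashiwaraOp i x = 0 := by
  induction h with
  | base k => simp only [List.mem_singleton] at hs; simp [gen, kashiwaraOp_ι, hs]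
  | @right s x j h hi hc ih =>
    simp only [List.mem_cons, not_or] at hs
    simp [br, kashiwaraOp_mul', gen, kashiwaraOp_ι, hs.1, ih hs.2]
  | @left s x j h hi hc ih =>
    simp only [List.mem_cons, not_or] at hs
    simp [br, kashiwaraOp_mul', gen, kashiwaraOp_ι, hs.1, ih hs.2]

theorem Chain.rightOp {s : List (Node n)} {x : FreeN n} (h : Chain s x) {i : Node n}
    (hs : i ∉ s) : rightOp i x = 0 := by
  induction h with
  | base k => simp only [List.mem_singleton] at hs; simp [rightOp_gen, hs]
  | @right s x j h hi hc ih =>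
    simp only [List.mem_cons, not_or] at hs
    simp [br, rightOp_mul, rightOp_gen, hs.1, ih hs.2]
  | @left s x j h hi hc ih =>
    simp only [List.mem_cons, not_or] at hs
    simp [br, rightOp_mul, rightOp_gen, hs.1, ih hs.2]

/-- Attaching a generator `E_j` multiplies the norm by `1 - v⁻²`: among the derivations at `j` from
the left and from the right, one annihilates the new commutator and the other returns `(1 - v⁻²) x`,
because `x` does not involve `E_j` and has weight `-1` at `j`. -/
theorem Chain.freeForm {s : List (Node n)} {x : FreeN n} (h : Chain s x) :
    freeForm x x = (1 - v⁻¹ ^ 2) ^ (s.length - 1) := by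
  -- Chains are nonempty, so the truncated subtraction in the exponent behaves.
  have step : ∀ {s : List (Node n)} {x : FreeN n} (_ : Chain s x) (c : Kv),
      c * c ^ (s.length - 1) = c ^ ((s.length + 1) - 1) := by
    intro s x h c
    rw [← pow_succ']
    congr 1
    cases h <;> simp
  induction h with
  | base k =>
    rw [← mul_one (gen k), freeForm_gen_mul, mul_one, kashiwaraOp_ι, if_pos rfl, freeForm_one]
    simp
  | @right s x j h hi hc ih =>
    have h1 : QuantumTypeA.kashiwaraOp j (br v x (gen j)) = 0 := by
      simp [br, kashiwaraOp_mul', gen, kashiwaraOp_ι, h.kashiwaraOp hi, h.theta, hc]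
    have h2 : QuantumTypeA.rightOp j (br v x (gen j)) = (1 - v⁻¹ ^ 2) • x := by
      rw [← sub_inv_smul_smul]
      simp [br, rightOp_mul, rightOp_gen, h.rightOp hi, h.theta, hc]
    conv_lhs => enter [1]; rw [br]
    rw [freeForm_sub_left, freeForm_smul_left, freeForm_gen_mul, freeForm_mul_gen, h1, h2,
      freeForm_zero_right, mul_zero, sub_zero, freeForm_smul_right, ih, step h, List.length_cons]
  | @left s x j h hi hc ih =>
    have h1 : QuantumTypeA.rightOp j (br v (gen j) x) = 0 := by
      simp [br, rightOp_mul, rightOp_gen, h.rightOp hi, h.theta, hc]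
    have h2 : QuantumTypeA.kashiwaraOp j (br v (gen j) x) = (1 - v⁻¹ ^ 2) • x := by
      rw [← sub_inv_smul_smul]
      simp [br, kashiwaraOp_mul', gen, kashiwaraOp_ι, h.kashiwaraOp hi, h.theta, hc]
    conv_lhs => enter [1]; rw [br]
    rw [freeForm_sub_left, freeForm_smul_left, freeForm_gen_mul, freeForm_mul_gen, h1, h2,
      freeForm_zero_right, mul_zero, sub_zero, freeForm_smul_right, ih, step h, List.length_cons]

/-! ### Products of Lusztig's automorphisms -/

/-- The product of the `T_i` along a word. -/
def TL : List (Node n) → (Uq n →ₐ[Kv] Uq n)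
  | [] => AlgHom.id Kv _
  | i :: l => (T i).comp (TL l)

theorem TL_cons (i : Node n) (l : List (Node n)) (x : Uq n) : TL (i :: l) x = T i (TL l x) := rfl

theorem TL_append (l l' : List (Node n)) (x : Uq n) : TL (l ++ l') x = TL l (TL l' x) := by
  induction l with
  | nil => rfl
  | cons i l ih => rw [List.cons_append, TL_cons, TL_cons, ih]

theorem TL_proj (l : List (Node n)) (x : Free n) :
    TL l (proj n x) = proj n (l.foldr (fun i x => lusztigT i x) x) := by
  induction l with
  | nil => rfl
  | cons i l ih => rw [TL_cons, ih, T_proj, List.foldr_cons]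

theorem rootVector_eq (k : Idx n) : rootVector k = TL (prefixWord k) (eU k.2) :=
  (TL_proj _ _).symm

theorem T_kU_far {i j : Node n} (h : cartan i j = 0) : T i (↑(kU j)) = ↑(kU j) := by
  rw [T_kU, h]; simp

theorem T_kU_inv_far {i j : Node n} (h : cartan i j = 0) : T i (↑(kU j)⁻¹) = ↑(kU j)⁻¹ := by
  rw [T_kU_inv, h]; simp

theorem T_kU_self (i : Node n) : T i (↑(kU i)) = ↑(kU i)⁻¹ := by
  rw [T_kU, cartan_self, ← zpow_one_add]; exact congrArg Units.val (zpow_neg_one _)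

theorem TL_eU_far {l : List (Node n)} {k : Node n} (h : ∀ j ∈ l, cartan j k = 0) :
    TL l (eU k) = eU k := by
  induction l with
  | nil => rfl
  | cons i l ih =>
    simp only [List.forall_mem_cons] at h
    rw [TL_cons, ih h.2, T_eU_far h.1]

theorem TL_fU_far {l : List (Node n)} {k : Node n} (h : ∀ j ∈ l, cartan j k = 0) :
    TL l (fU k) = fU k := by
  induction l with
  | nil => rfl
  | cons i l ih =>
    simp only [List.forall_mem_cons] at h
    rw [TL_cons, ih h.2, T_fU_far h.1]

theorem TL_kU_far {l : List (Node n)} {k : Node n} (h : ∀ j ∈ l, cartan j k = 0) :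
    TL l (↑(kU k)) = ↑(kU k) := by
  induction l with
  | nil => rfl
  | cons i l ih =>
    simp only [List.forall_mem_cons] at h
    rw [TL_cons, ih h.2, T_kU_far h.1]

theorem TL_eU_mem {l : List (Node n)} (hl : l.Pairwise fun i j => cartan i j = 0) {i : Node n}
    (hi : i ∈ l) : TL l (eU i) = -(↑(kU i)⁻¹ * fU i) := by
  induction l with
  | nil => simp at hi
  | cons j l ih =>
    rw [List.pairwise_cons] at hl
    rcases List.mem_cons.1 hi with rfl | hi
    · rw [TL_cons, TL_eU_far fun j hj => cartan_comm i j ▸ hl.1 j hj, T_eU_self]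
    · rw [TL_cons, ih hl.2 hi, map_neg, map_mul, T_kU_inv_far (hl.1 i hi), T_fU_far (hl.1 i hi)]

/-- The preimage of `E_i` under the block containing `i`. It turns a product `E_i T_l(X)` into
`T_l(-F_i K_i X)`, so that commutation of root vectors becomes commutation with `F_i`. -/
theorem TL_fU_mul_kU_mem {l : List (Node n)} (hl : l.Pairwise fun i j => cartan i j = 0)
    {i : Node n} (hi : i ∈ l) : TL l (-(fU i * ↑(kU i))) = eU i := by
  induction l with
  | nil => simp at hi
  | cons j l ih =>
    rw [List.pairwise_cons] at hl
    rcases List.mem_cons.1 hi with rfl | hi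
    · have := fun j hj => cartan_comm i j ▸ hl.1 j hj
      rw [TL_cons, map_neg, map_mul, TL_fU_far this, TL_kU_far this, map_neg, map_mul, T_fU_self,
        T_kU_self, neg_mul, neg_neg, mul_assoc, Units.mul_inv, mul_one]
    · rw [TL_cons, ih hl.2 hi, T_eU_far (hl.1 i hi)]

theorem TL_eU_adj {l : List (Node n)} (hl : l.Pairwise fun i j => cartan i j = 0) {a k : Node n}
    (ha : a ∈ l) (hak : cartan a k = -1) (h : ∀ j ∈ l, j ≠ a → cartan j k = 0) :
    TL l (eU k) = br v (eU k) (eU a) := by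
  induction l with
  | nil => simp at ha
  | cons j l ih =>
    rw [List.pairwise_cons] at hl
    simp only [List.forall_mem_cons] at h
    rcases List.mem_cons.1 ha with rfl | ha
    · rw [TL_cons, TL_eU_far fun j hj => h.2 j hj (ne_of_cartan (hl.1 j hj) (by decide)).symm,
        T_eU_adj hak]
    · have hja := hl.1 a ha
      rw [TL_cons, ih hl.2 ha h.2, map_br, T_eU_far hja,
        T_eU_far (h.1 (ne_of_cartan hja (by decide)))]

theorem TL_eU_adj_adj {l : List (Node n)} (hl : l.Pairwise fun i j => cartan i j = 0)
    {a b k : Node n} (hab : cartan a b = 0) (ha : a ∈ l) (hb : b ∈ l) (hak : cartan a k = -1)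
    (hbk : cartan b k = -1) (h : ∀ j ∈ l, j ≠ a → j ≠ b → cartan j k = 0) :
    TL l (eU k) = br v (br v (eU k) (eU b)) (eU a) := by
  have hne := ne_of_cartan hab (by decide)
  induction l with
  | nil => simp at ha
  | cons j l ih =>
    rw [List.pairwise_cons] at hl
    simp only [List.forall_mem_cons] at h
    rw [TL_cons]
    rcases List.mem_cons.1 ha with rfl | ha'
    · have hb : b ∈ l := (List.mem_cons.1 hb).resolve_left hne.symm
      rw [TL_eU_adj hl.2 hb hbk fun j hj =>
          h.2 j hj (ne_of_cartan (hl.1 j hj) (by decide)).symm, map_br, T_eU_adj hak,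
        T_eU_far hab, br_br_right_comm (commute_eU hab)]
    · rcases List.mem_cons.1 hb with rfl | hb'
      · rw [TL_eU_adj hl.2 ha' hak fun j hj hja =>
            h.2 j hj hja (ne_of_cartan (hl.1 j hj) (by decide)).symm, map_br, T_eU_adj hbk,
          T_eU_far (cartan_comm a b ▸ hab)]
      · have hja := hl.1 a ha'
        have hjb := hl.1 b hb'
        rw [ih hl.2 ha' hb' h.2, map_br, map_br, T_eU_far hja, T_eU_far hjb,
          T_eU_far (h.1 (ne_of_cartan hja (by decide)) (ne_of_cartan hjb (by decide)))]

/-- If `T_l(E_a)` and `T_l(E_b)` are the `v`-commutators of `x` and `y` with `E_i`, where `i`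
belongs to `l`. -/
theorem TL_br {l : List (Node n)} (hl : l.Pairwise fun i j => cartan i j = 0) {i b : Node n}
    (hi : i ∈ l) {y : Uq n} {w : Node n → ℤ} (hb : TL l (eU b) = br v y (eU i)) (hy : HasWt y w)
    (hw : w i = -1) (hf : Commute y (fU i)) : TL l (br v (eU i) (eU b)) = y := by
  rw [map_br, TL_eU_mem hl hi, hb, br_freeT_br hy hw hf]

/-- The inner commutator is stripped to `y` by `TL_br`, since `T_l(E_i)` undoes the bracket with
`E_i`. The outer one then brackets `y` with `br v x (eU i)`, and `x`, `y` may be interchanged. -/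
theorem TL_br_br {l : List (Node n)} (hl : l.Pairwise fun i j => cartan i j = 0) {i a b : Node n}
    (hi : i ∈ l) {x y : Uq n} {w : Node n → ℤ} (hb : TL l (eU b) = br v y (eU i)) (hy : HasWt y w)
    (hw : w i = -1) (hf : Commute y (fU i)) (ha : TL l (eU a) = br v x (eU i))
    (hxy : Commute x y) :
    TL l (br v (br v (eU i) (eU b)) (eU a)) = br v x (br v y (eU i)) := by
  rw [map_br, TL_br hl hi hb hy hw hf, ha, br_br_left_comm hxy]

/-! ### The two parity classes and the letters of the word -/

def odds (n : ℕ) : List (Node n) := (nodes n).filter (fun i => i.1 % 2 = 1)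
def evens (n : ℕ) : List (Node n) := (nodes n).filter (fun i => i.1 % 2 = 0)

theorem mem_nodes (i : Node n) : i ∈ nodes n := by
  have := Finset.mem_Icc.1 i.2
  refine List.mem_map.2 ⟨⟨i.1 - 1, by omega⟩, List.mem_finRange _, Subtype.ext ?_⟩
  change i.1 - 1 + 1 = i.1
  omega

theorem nodup_nodes (n : ℕ) : (nodes n).Nodup := by
  refine (List.nodup_finRange n).map fun a b h => Fin.ext ?_
  have := congrArg Subtype.val h
  simpa using this

theorem mem_odds {i : Node n} : i ∈ odds n ↔ i.1 % 2 = 1 := by simp [odds, mem_nodes]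
theorem mem_evens {i : Node n} : i ∈ evens n ↔ i.1 % 2 = 0 := by simp [evens, mem_nodes]

theorem cartan_eq_zero_of_parity {i j : Node n} (h : i ≠ j) (hp : i.1 % 2 = j.1 % 2) :
    cartan i j = 0 := by
  have : i.1 ≠ j.1 := fun h' => h (Subtype.ext h')
  simp only [cartan]
  split_ifs <;> omega

theorem pairwise_odds (n : ℕ) : (odds n).Pairwise fun i j => cartan i j = 0 :=
  ((nodup_nodes n).filter _).imp_of_mem fun hi hj h =>
    cartan_eq_zero_of_parity h ((mem_odds.1 hi).trans (mem_odds.1 hj).symm)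

theorem pairwise_evens (n : ℕ) : (evens n).Pairwise fun i j => cartan i j = 0 :=
  ((nodup_nodes n).filter _).imp_of_mem fun hi hj h =>
    cartan_eq_zero_of_parity h ((mem_evens.1 hi).trans (mem_evens.1 hj).symm)

theorem takeWhile_append_of_mem {α : Type*} [DecidableEq α] {x : α} (B C : List α) (hx : x ∈ B) :
    ∀ y ∈ (B ++ C).takeWhile (fun l => l ≠ x), y ∈ B ∧ y ≠ x := by
  induction B with
  | nil => simp at hx
  | cons b B ih =>
    intro y hy
    rw [List.cons_append, List.takeWhile_cons] at hy
    split_ifs at hy with h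
    · have h' : b ≠ x := by simpa using h
      rcases List.mem_cons.1 hy with rfl | hy
      · exact ⟨List.mem_cons_self, h'⟩
      · have := ih ((List.mem_cons.1 hx).resolve_left h'.symm) y hy
        exact ⟨List.mem_cons_of_mem _ this.1, this.2⟩
    · simp at hy

theorem takeWhile_append_of_not_mem {α : Type*} [DecidableEq α] {x : α} (B C : List α)
    (hx : x ∉ B) : (B ++ C).takeWhile (fun l => l ≠ x) = B ++ C.takeWhile (fun l => l ≠ x) :=
  List.takeWhile_append_of_pos fun y hy => by
    simpa using fun h : y = x => hx (h ▸ hy)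

theorem order_eq (n : ℕ) : order n = (odds n).map (fun i => (false, i)) ++
    ((evens n).map (fun i => (false, i)) ++ ((odds n).map (fun i => (true, i)) ++
      ((evens n).map (fun i => (true, i)) ++ []))) := by
  simp [order, halfWord, odds, evens]

theorem prefix_of_block {l : List (Node n)} (b : Bool) {i : Node n} (hi : i ∈ l)
    (hl : ∀ j ∈ l, j.1 % 2 = i.1 % 2) (C : List (Idx n)) :
    ∀ j ∈ ((l.map (fun i => (b, i)) ++ C).takeWhile (fun l => l ≠ (b, i))).map Prod.snd,
      cartan j i = 0 := by
  intro j hj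
  obtain ⟨y, hy, rfl⟩ := List.mem_map.1 hj
  obtain ⟨h1, h2⟩ := takeWhile_append_of_mem _ _ (List.mem_map.2 ⟨i, hi, rfl⟩) y hy
  obtain ⟨m, hm, rfl⟩ := List.mem_map.1 h1
  exact cartan_eq_zero_of_parity (fun h => h2 (by rw [← h])) (hl m hm)

/-- Letters of the same block that precede `s_i` are orthogonal to `α_i` and act trivially on `E_i`
and `α_i`. Their exact list `L` is therefore irrelevant; only the complete earlier blocks count,
here none. -/
theorem prefixWord_false_odd {i : Node n} (hi : i.1 % 2 = 1) :
    ∃ L, prefixWord (false, i) = L ∧ ∀ j ∈ L, cartan j i = 0 := by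
  refine ⟨_, rfl, ?_⟩
  rw [prefixWord, order_eq]
  exact prefix_of_block _ (mem_odds.2 hi) (fun j hj => (mem_odds.1 hj).trans hi.symm) _

theorem prefixWord_false_even {i : Node n} (hi : i.1 % 2 = 0) :
    ∃ L, prefixWord (false, i) = odds n ++ L ∧ ∀ j ∈ L, cartan j i = 0 := by
  rw [prefixWord, order_eq, takeWhile_append_of_not_mem, List.map_append, List.map_map]
  · refine ⟨_, congrArg₂ _ (List.map_id _) rfl, ?_⟩
    exact prefix_of_block _ (mem_evens.2 hi) (fun j hj => (mem_evens.1 hj).trans hi.symm) _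
  · simp [mem_odds, hi]

theorem prefixWord_true_odd {i : Node n} (hi : i.1 % 2 = 1) :
    ∃ L, prefixWord (true, i) = odds n ++ (evens n ++ L) ∧ ∀ j ∈ L, cartan j i = 0 := by
  rw [prefixWord, order_eq, takeWhile_append_of_not_mem, takeWhile_append_of_not_mem,
    List.map_append, List.map_append, List.map_map, List.map_map]
  · refine ⟨_, congrArg₂ _ (List.map_id _) (congrArg₂ _ (List.map_id _) rfl), ?_⟩
    exact prefix_of_block _ (mem_odds.2 hi) (fun j hj => (mem_odds.1 hj).trans hi.symm) _
  · simp
  · simp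

theorem prefixWord_true_even {i : Node n} (hi : i.1 % 2 = 0) :
    ∃ L, prefixWord (true, i) = odds n ++ (evens n ++ (odds n ++ L)) ∧
      ∀ j ∈ L, cartan j i = 0 := by
  rw [prefixWord, order_eq, takeWhile_append_of_not_mem, takeWhile_append_of_not_mem,
    takeWhile_append_of_not_mem, List.map_append, List.map_append, List.map_append, List.map_map,
    List.map_map, List.map_map]
  · refine ⟨_, congrArg₂ _ (List.map_id _) (congrArg₂ _ (List.map_id _)
      (congrArg₂ _ (List.map_id _) rfl)), ?_⟩
    exact prefix_of_block _ (mem_evens.2 hi) (fun j hj => (mem_evens.1 hj).trans hi.symm) _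
  · simp [mem_odds, hi]
  · simp
  · simp

/-- The product of the `T_i` for odd `i`. -/
abbrev TO (n : ℕ) : Uq n →ₐ[Kv] Uq n := TL (odds n)

/-- The product of the `T_i` for even `i`. -/
abbrev TE (n : ℕ) : Uq n →ₐ[Kv] Uq n := TL (evens n)

theorem rootVector_false_odd {i : Node n} (hi : i.1 % 2 = 1) : rootVector (false, i) = eU i := by
  obtain ⟨L, hL, h⟩ := prefixWord_false_odd hi
  rw [rootVector_eq, hL, TL_eU_far h]

theorem rootVector_false_even {i : Node n} (hi : i.1 % 2 = 0) :
    rootVector (false, i) = TO n (eU i) := by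
  obtain ⟨L, hL, h⟩ := prefixWord_false_even hi
  rw [rootVector_eq, hL, TL_append, TL_eU_far h]

theorem rootVector_true_odd {i : Node n} (hi : i.1 % 2 = 1) :
    rootVector (true, i) = TO n (TE n (eU i)) := by
  obtain ⟨L, hL, h⟩ := prefixWord_true_odd hi
  rw [rootVector_eq, hL, TL_append, TL_append, TL_eU_far h]

theorem rootVector_true_even {i : Node n} (hi : i.1 % 2 = 0) :
    rootVector (true, i) = TO n (TE n (TO n (eU i))) := by
  obtain ⟨L, hL, h⟩ := prefixWord_true_even hi
  rw [rootVector_eq, hL, TL_append, TL_append, TL_append, TL_eU_far h]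

/-! ### Explicit root vectors -/

/-- `l` consists of all nodes of one parity. -/
structure IsParityClass (l : List (Node n)) (r : ℕ) : Prop where
  pairwise : l.Pairwise fun i j => cartan i j = 0
  mem_iff : ∀ i : Node n, i ∈ l ↔ i.1 % 2 = r

theorem isParityClass_odds : IsParityClass (odds n) 1 := ⟨pairwise_odds n, fun _ => mem_odds⟩
theorem isParityClass_evens : IsParityClass (evens n) 0 := ⟨pairwise_evens n, fun _ => mem_evens⟩

theorem cartan_of_eq_add {a b : Node n} {s : ℤ} (hs : s = 1 ∨ s = -1) (h : (b.1 : ℤ) = a.1 + s) :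
    cartan a b = -1 := by
  simp only [cartan]
  split_ifs <;> omega

theorem cartan_of_ne {a b : Node n} (h0 : a.1 ≠ b.1) (h1 : a.1 + 1 ≠ b.1) (h2 : b.1 + 1 ≠ a.1) :
    cartan a b = 0 := by
  simp only [cartan]
  split_ifs <;> omega

theorem node_ne {a b : Node n} (h : a.1 ≠ b.1) : a ≠ b := fun h' => h (congrArg _ h')

theorem val_ne {a b : Node n} (h : a ≠ b) : a.1 ≠ b.1 := fun h' => h (Subtype.ext h')

/-- For a node `a` and a direction `s = ±1`: the `v`-commutator of `E_a` and `E_{a+s}`, or `E_a` if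
there is no node `a+s`. -/
def ext (s : ℤ) (a : Node n) : Uq n :=
  if h : (a.1 + s).toNat ∈ Finset.Icc 1 n then br v (eU a) (eU ⟨_, h⟩) else eU a

theorem ext_of_next {s : ℤ} {a c : Node n} (h : (c.1 : ℤ) = a.1 + s) :
    ext s a = br v (eU a) (eU c) := by
  have h1 : (a.1 + s).toNat = c.1 := by omega
  have h2 : (a.1 + s).toNat ∈ Finset.Icc 1 n := h1 ▸ c.2
  rw [ext, dif_pos h2]
  congr 2
  exact Subtype.ext h1

theorem ext_of_end {s : ℤ} {a : Node n}
    (h : ∀ c : Node n, (c.1 : ℤ) ≠ a.1 + s) : ext s a = eU a := by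
  rw [ext, dif_neg]
  intro h2
  have ha := Finset.mem_Icc.1 a.2
  have h3 := Finset.mem_Icc.1 h2
  refine h ⟨_, h2⟩ ?_
  change (((a.1 + s).toNat : ℕ) : ℤ) = _
  omega

theorem next_or_end (s : ℤ) (a : Node n) :
    (∃ c : Node n, (c.1 : ℤ) = a.1 + s) ∨ ∀ c : Node n, (c.1 : ℤ) ≠ a.1 + s := by
  by_cases h : ∃ c : Node n, (c.1 : ℤ) = a.1 + s
  · exact Or.inl h
  · push Not at h; exact Or.inr h

theorem exists_next {s : ℤ} (a : Node n) (h1 : 1 ≤ a.1 + s) (h2 : a.1 + s ≤ n) :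
    ∃ c : Node n, (c.1 : ℤ) = a.1 + s :=
  ⟨⟨(a.1 + s).toNat, Finset.mem_Icc.2 (by omega)⟩, by simp; omega⟩

/-- Elements commuting with `E_a` and `E_{a+s}` commute with `ext s a`. -/
theorem commute_ext {s : ℤ} {a : Node n} {x : Uq n}
    (h : ∀ c : Node n, c = a ∨ (c.1 : ℤ) = a.1 + s → Commute x (eU c)) : Commute x (ext s a) := by
  rcases next_or_end s a with ⟨c, hc⟩ | hc
  · rw [ext_of_next hc]
    exact commute_br (h a (Or.inl rfl)) (h c (Or.inr hc))
  · rw [ext_of_end hc]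
    exact h a (Or.inl rfl)

theorem commute_ext_fU {s : ℤ} {a j : Node n} (hs : s = 1 ∨ s = -1) (h0 : j.1 ≠ a.1)
    (h1 : (j.1 : ℤ) ≠ a.1 + s) : Commute (ext s a) (fU j) :=
  (commute_ext fun c hc => (commute_eU_fU (node_ne (by
    rcases hc with rfl | hc
    · exact h0.symm
    · omega))).symm).symm

theorem commute_ext_eU {s : ℤ} {a j : Node n} (hs : s = 1 ∨ s = -1) (h0 : (j.1 : ℤ) ≠ a.1)
    (h1 : (j.1 : ℤ) ≠ a.1 + s) (h2 : (j.1 : ℤ) ≠ a.1 + 2 * s) (h3 : (j.1 : ℤ) ≠ a.1 - s) :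
    Commute (ext s a) (eU j) :=
  (commute_ext fun c hc => (commute_eU (by
    apply cartan_of_ne <;> rcases hc with rfl | hc <;> omega))).symm

theorem hasWt_ext {s : ℤ} (hs : s = 1 ∨ s = -1) {a k : Node n} (hk : (a.1 : ℤ) = k.1 + s) :
    ∃ w, HasWt (ext s a) w ∧ w k = -1 := by
  have hka := cartan_of_eq_add hs hk
  rcases next_or_end s a with ⟨c, hc⟩ | hc
  · rw [ext_of_next hc]
    refine ⟨_, (hasWt_eU a).br (hasWt_eU c), ?_⟩
    simp only [Pi.add_apply, hka]
    rw [cartan_of_ne (a := k) (b := c) (by omega) (by omega) (by omega)]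
    rfl
  · rw [ext_of_end hc]
    exact ⟨_, hasWt_eU a, hka⟩

section Class

variable {l m : List (Node n)} {r r' : ℕ} {s : ℤ}

/-- The direction `s = ±1` is kept as a parameter so that left and right neighbours, and later the
two ends of the diagram, are covered by the same statements. -/
theorem IsParityClass.TL_two (hl : IsParityClass l r) (hs : s = 1 ∨ s = -1) {k a b : Node n}
    (hk : k.1 % 2 ≠ r) (hr : r < 2) (ha : (a.1 : ℤ) = k.1 + s) (hb : (b.1 : ℤ) = k.1 - s) :
    TL l (eU k) = br v (br v (eU k) (eU b)) (eU a) := by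
  have hak := cartan_of_eq_add hs ha
  have hbk := cartan_of_eq_add (s := -s) (by omega) hb
  refine TL_eU_adj_adj hl.pairwise (cartan_of_ne (by omega) (by omega) (by omega))
    ((hl.mem_iff a).2 (by omega)) ((hl.mem_iff b).2 (by omega)) (cartan_comm k a ▸ hak)
    (cartan_comm k b ▸ hbk) fun j hj hja hjb => ?_
  have := (hl.mem_iff j).1 hj
  have := val_ne hja
  have := val_ne hjb
  exact cartan_of_ne (by omega) (by omega) (by omega)

theorem IsParityClass.TL_one (hl : IsParityClass l r) (hs : s = 1 ∨ s = -1) {k b : Node n}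
    (hk : k.1 % 2 ≠ r) (hr : r < 2) (ha : ∀ c : Node n, (c.1 : ℤ) ≠ k.1 + s)
    (hb : (b.1 : ℤ) = k.1 - s) : TL l (eU k) = br v (eU k) (eU b) := by
  have hbk := cartan_of_eq_add (s := -s) (by omega) hb
  refine TL_eU_adj hl.pairwise ((hl.mem_iff b).2 (by omega)) (cartan_comm k b ▸ hbk)
    fun j hj hjb => ?_
  have := (hl.mem_iff j).1 hj
  have := val_ne hjb
  have := ha j
  exact cartan_of_ne (by omega) (by omega) (by omega)

theorem IsParityClass.TL_eq_br_ext (hl : IsParityClass l r) (hs : s = 1 ∨ s = -1) {k a : Node n}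
    (hk : k.1 % 2 = r) (ha : (a.1 : ℤ) = k.1 + s) : TL l (eU a) = br v (ext s a) (eU k) := by
  rcases next_or_end s a with ⟨c, hc⟩ | hc
  · rw [ext_of_next hc, hl.TL_two (s := -s) (by omega) (k := a) (a := k) (b := c) (by omega)
      (by omega) (by omega) (by omega)]
  · rw [ext_of_end hc, hl.TL_one hs (b := k) (by omega) (by omega) hc (by omega)]

theorem IsParityClass.TL_br (hl : IsParityClass l r) (hs : s = 1 ∨ s = -1) {k a : Node n}
    (hk : k.1 % 2 = r) (ha : (a.1 : ℤ) = k.1 + s) : TL l (br v (eU k) (eU a)) = ext s a := by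
  obtain ⟨w, hw, hw'⟩ := hasWt_ext hs ha
  exact QuantumTypeA.TL_br hl.pairwise ((hl.mem_iff k).2 hk) (hl.TL_eq_br_ext hs hk ha) hw hw'
    (commute_ext_fU hs (by omega) (by omega))

theorem commute_ext_ext (hs : s = 1 ∨ s = -1) {k a b : Node n} (ha : (a.1 : ℤ) = k.1 + s)
    (hb : (b.1 : ℤ) = k.1 - s) : Commute (ext s a) (ext (-s) b) :=
  commute_ext fun c hc => commute_ext_eU hs
    (by rcases hc with rfl | hc <;> omega) (by rcases hc with rfl | hc <;> omega)
    (by rcases hc with rfl | hc <;> omega) (by rcases hc with rfl | hc <;> omega)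

/-- The block `m` adds the neighbours `a`, `b` to `E_k`; the block `l` contains `k` and replaces
each neighbour by its outward extension, while `E_k` is used up once and restored once, as in
`TL_br_br`. -/
theorem IsParityClass.TL_TL_two (hl : IsParityClass l r) (hm : IsParityClass m r')
    (hr : r + r' = 1) (hs : s = 1 ∨ s = -1) {k a b : Node n} (hk : k.1 % 2 = r)
    (ha : (a.1 : ℤ) = k.1 + s) (hb : (b.1 : ℤ) = k.1 - s) :
    TL l (TL m (eU k)) = br v (ext s a) (br v (ext (-s) b) (eU k)) := by
  have hs' : -s = 1 ∨ -s = -1 := by omega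
  obtain ⟨w, hw, hw'⟩ := hasWt_ext hs' (a := b) (k := k) hb
  rw [hm.TL_two hs (by omega) (by omega) ha hb]
  exact TL_br_br hl.pairwise ((hl.mem_iff k).2 hk) (hl.TL_eq_br_ext hs' hk hb) hw hw'
    (commute_ext_fU hs' (by omega) (by omega)) (hl.TL_eq_br_ext hs hk ha)
    (commute_ext_ext hs ha hb)

/-- At an end of the diagram there is no second neighbour to restore `E_k`, so the chain gets
shorter. -/
theorem IsParityClass.TL_TL_one (hl : IsParityClass l r) (hm : IsParityClass m r')
    (hr : r + r' = 1) (hs : s = 1 ∨ s = -1) {k b : Node n} (hk : k.1 % 2 = r)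
    (ha : ∀ c : Node n, (c.1 : ℤ) ≠ k.1 + s) (hb : (b.1 : ℤ) = k.1 - s) :
    TL l (TL m (eU k)) = ext (-s) b := by
  rw [hm.TL_one hs (by omega) (by omega) ha hb]
  exact hl.TL_br (by omega) hk (by omega)

/-! ### Norms -/

theorem projN_br (x y : FreeN n) : projN n (br v x y) = br v (projN n x) (projN n y) :=
  map_br _ _ _

/-- A chain in the free algebra representing a given element of `U_v(𝔤)`. -/
def Represents (t : List (Node n)) (x : Uq n) : Prop := ∃ X, Chain t X ∧ projN n X = x

theorem Represents.norm {t : List (Node n)} {x : Uq n} (h : Represents t x) :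
    kashiwaraForm x x = (1 - v⁻¹ ^ 2) ^ (t.length - 1) := by
  obtain ⟨X, hX, rfl⟩ := h
  rw [kashiwaraForm_projN, hX.freeForm]

theorem represents_eU (k : Node n) : Represents [k] (eU k) := ⟨_, Chain.base k, projN_gen k⟩

theorem Represents.right {t : List (Node n)} {x : Uq n} (h : Represents t x) (i : Node n)
    (hi : i ∉ t) (hc : (t.map (cartan i)).sum = -1) : Represents (i :: t) (br v x (eU i)) := by
  obtain ⟨X, hX, rfl⟩ := h
  exact ⟨_, hX.right i hi hc, by rw [projN_br, projN_gen]⟩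

theorem Represents.left {t : List (Node n)} {x : Uq n} (h : Represents t x) (i : Node n)
    (hi : i ∉ t) (hc : (t.map (cartan i)).sum = -1) : Represents (i :: t) (br v (eU i) x) := by
  obtain ⟨X, hX, rfl⟩ := h
  exact ⟨_, hX.left i hi hc, by rw [projN_br, projN_gen]⟩

theorem Represents.commute {t : List (Node n)} {x y : Uq n} (h : Represents t x)
    (hy : ∀ i ∈ t, Commute y (eU i)) : Commute y x := by
  obtain ⟨X, hX, rfl⟩ := h
  induction hX with
  | base k => rw [projN_gen]; exact hy k (by simp)
  | @right t X i h hi hc ih =>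
    simp only [List.forall_mem_cons] at hy
    rw [projN_br, projN_gen]
    exact commute_br (ih hy.2) hy.1
  | @left t X i h hi hc ih =>
    simp only [List.forall_mem_cons] at hy
    rw [projN_br, projN_gen]
    exact commute_br hy.1 (ih hy.2)

/-- Extending a chain whose nodes are far from `c`, and of which exactly one is connected with
`a`, in the direction `s`. -/
theorem Represents.ext_left {t : List (Node n)} {x : Uq n} (h : Represents t x) {a c : Node n}
    (hs : s = 1 ∨ s = -1) (hc : (c.1 : ℤ) = a.1 + s) (hat : a ∉ t)
    (ha : (t.map (cartan a)).sum = -1) (hct : ∀ i ∈ t, cartan c i = 0) :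
    Represents (c :: a :: t) (br v (ext s a) x) := by
  have hca : cartan c a = -1 := cartan_comm a c ▸ cartan_of_eq_add hs hc
  rw [ext_of_next hc, br_br_right_comm (h.commute fun i hi => commute_eU (hct i hi))]
  refine (h.left a hat ha).right c ?_ ?_
  · simp only [List.mem_cons, not_or]
    exact ⟨ne_of_cartan hca (by decide), fun hi => absurd (hct c hi) (by simp [cartan_self])⟩
  · have : (t.map (cartan c)).sum = 0 := List.sum_eq_zero fun z hz => by
      obtain ⟨i, hi, rfl⟩ := List.mem_map.1 hz
      exact hct i hi
    simp [hca, this]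

end Class

section Class

variable {l m : List (Node n)} {r r' : ℕ} {s : ℤ}

theorem commute_eU_of_ne {a b : Node n} (h1 : a.1 + 1 ≠ b.1) (h2 : b.1 + 1 ≠ a.1) :
    Commute (eU a) (eU b) := by
  by_cases h : a = b
  · rw [h]
  · exact commute_eU (cartan_of_ne (val_ne h) h1 h2)

theorem represents_two (hs : s = 1 ∨ s = -1) {k a b : Node n} (ha : (a.1 : ℤ) = k.1 + s)
    (hb : (b.1 : ℤ) = k.1 - s) :
    Represents [a, b, k] (br v (br v (eU k) (eU b)) (eU a)) := by
  have h1 := cartan_of_eq_add hs ha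
  have h2 := cartan_of_eq_add (s := -s) (by omega) hb
  have h3 : cartan a b = 0 := cartan_of_ne (by omega) (by omega) (by omega)
  rw [cartan_comm] at h1 h2
  refine ((represents_eU k).right b ?_ (by simp [h2])).right a ?_ (by simp [h1, h3])
  · simpa using ne_of_cartan h2 (by decide)
  · simpa using ⟨ne_of_cartan h3 (by decide), ne_of_cartan h1 (by decide)⟩

theorem represents_ext (hs : s = 1 ∨ s = -1) {a c : Node n} (hc : (c.1 : ℤ) = a.1 + s) :
    Represents [c, a] (ext s a) := by
  have h1 := cartan_of_eq_add hs hc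
  rw [cartan_comm] at h1
  rw [ext_of_next hc]
  exact (represents_eU a).right c (by simpa using ne_of_cartan h1 (by decide)) (by simp [h1])

theorem represents_ext_ext (hs : s = 1 ∨ s = -1) {k a b c d : Node n} (ha : (a.1 : ℤ) = k.1 + s)
    (hb : (b.1 : ℤ) = k.1 - s) (hc : (c.1 : ℤ) = a.1 + s) (hd : (d.1 : ℤ) = b.1 - s) :
    Represents [c, a, d, b, k] (br v (ext s a) (br v (ext (-s) b) (eU k))) := by
  have h1 := cartan_of_eq_add hs ha
  have h2 := cartan_of_eq_add (s := -s) (by omega) hb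
  rw [cartan_comm] at h1 h2
  have h3 : cartan a b = 0 := cartan_of_ne (by omega) (by omega) (by omega)
  have h4 : cartan a d = 0 := cartan_of_ne (by omega) (by omega) (by omega)
  refine ((represents_eU k).ext_left (a := b) (by omega) hd ?_ (by simp [h2]) ?_).ext_left hs hc ?_
    (by simp [h1, h3, h4]) ?_
  · simpa using ne_of_cartan h2 (by decide)
  · simp only [List.mem_singleton, forall_eq]
    exact cartan_of_ne (by omega) (by omega) (by omega)
  · simpa using ⟨ne_of_cartan h4 (by decide), ne_of_cartan h3 (by decide),
      ne_of_cartan h1 (by decide)⟩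
  · simp only [List.forall_mem_cons, List.not_mem_nil, false_imp_iff, implies_true, and_true]
    exact ⟨cartan_of_ne (by omega) (by omega) (by omega),
      cartan_of_ne (by omega) (by omega) (by omega), cartan_of_ne (by omega) (by omega) (by omega)⟩

/-- Both further neighbours exist. -/
theorem IsParityClass.represents_TL_two_two (hl : IsParityClass l r) (hr : r < 2)
    (hs : s = 1 ∨ s = -1) {k a b c d c' d' : Node n} (hk : k.1 % 2 ≠ r)
    (ha : (a.1 : ℤ) = k.1 + s) (hb : (b.1 : ℤ) = k.1 - s) (hc : (c.1 : ℤ) = a.1 + s)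
    (hd : (d.1 : ℤ) = b.1 - s) (hc' : (c'.1 : ℤ) = c.1 + s) (hd' : (d'.1 : ℤ) = d.1 - s) :
    Represents [c', c, d', d, a, b, k]
      (TL l (br v (ext s a) (br v (ext (-s) b) (eU k)))) := by
  have hs' : -s = 1 ∨ -s = -1 := by omega
  rw [map_br, map_br, ext_of_next hc, ext_of_next (s := -s) hd, hl.TL_br hs (by omega) hc,
    hl.TL_br hs' (by omega) hd, hl.TL_two hs hk hr ha hb]
  have h1 : cartan d b = -1 := by
    rw [cartan_comm]; exact cartan_of_eq_add hs' hd
  have h2 : cartan c a = -1 := by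
    rw [cartan_comm]; exact cartan_of_eq_add hs hc
  have z : ∀ {x y : Node n}, 2 ≤ |(x.1 : ℤ) - y.1| → cartan x y = 0 := fun {x y} h =>
    cartan_of_ne (by intro h'; rw [h'] at h; simp at h) (by intro h'; rw [← h'] at h; simp at h)
      (by intro h'; rw [← h'] at h; simp at h)
  have e1 : cartan d a = 0 := cartan_of_ne (by omega) (by omega) (by omega)
  have e2 : cartan d k = 0 := cartan_of_ne (by omega) (by omega) (by omega)
  have e3 : cartan c d' = 0 := cartan_of_ne (by omega) (by omega) (by omega)
  have e4 : cartan c d = 0 := cartan_of_ne (by omega) (by omega) (by omega)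
  have e5 : cartan c b = 0 := cartan_of_ne (by omega) (by omega) (by omega)
  have e6 : cartan c k = 0 := cartan_of_ne (by omega) (by omega) (by omega)
  refine ((represents_two hs ha hb).ext_left (a := d) hs' hd' ?_ (by simp [h1, e1, e2])
    ?_).ext_left (a := c) hs hc' ?_ (by simp [h2, e3, e4, e5, e6]) ?_
  · simpa using ⟨ne_of_cartan e1 (by decide), ne_of_cartan h1 (by decide),
      ne_of_cartan e2 (by decide)⟩
  · simp only [List.forall_mem_cons, List.not_mem_nil, false_imp_iff, implies_true, and_true]
    exact ⟨cartan_of_ne (by omega) (by omega) (by omega),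
      cartan_of_ne (by omega) (by omega) (by omega), cartan_of_ne (by omega) (by omega) (by omega)⟩
  · simpa using ⟨ne_of_cartan e3 (by decide), ne_of_cartan e4 (by decide),
      ne_of_cartan h2 (by decide), ne_of_cartan e5 (by decide), ne_of_cartan e6 (by decide)⟩
  · simp only [List.forall_mem_cons, List.not_mem_nil, false_imp_iff, implies_true, and_true]
    exact ⟨cartan_of_ne (by omega) (by omega) (by omega),
      cartan_of_ne (by omega) (by omega) (by omega), cartan_of_ne (by omega) (by omega) (by omega),
      cartan_of_ne (by omega) (by omega) (by omega), cartan_of_ne (by omega) (by omega) (by omega)⟩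

/-- The image of `E_k` is a bracket with `E_b` outermost, and the image of `E_b`, essentially `F_b`,
removes exactly this factor. -/
theorem IsParityClass.TL_br_end (hl : IsParityClass l r) (hr : r < 2) (hs : s = 1 ∨ s = -1)
    {k a b : Node n} (hk : k.1 % 2 ≠ r) (ha : (a.1 : ℤ) = k.1 + s) (hb : (b.1 : ℤ) = k.1 - s) :
    TL l (br v (eU b) (eU k)) = br v (eU k) (eU a) := by
  have hb' : b ∈ l := (hl.mem_iff b).2 (by omega)
  have h2 := cartan_of_eq_add (s := -s) (by omega) hb
  rw [cartan_comm] at h2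
  have h3 : cartan b a = 0 := cartan_of_ne (by omega) (by omega) (by omega)
  refine QuantumTypeA.TL_br hl.pairwise hb' ?_ ((hasWt_eU k).br (hasWt_eU a)) (by simp [h2, h3]) ?_
  · rw [hl.TL_two (s := -s) (by omega) hk hr (a := b) (b := a) hb (by omega)]
  · exact (commute_br (commute_eU_fU (node_ne (by omega))).symm
      (commute_eU_fU (node_ne (by omega))).symm).symm

/-- One of the further neighbours exists. -/
theorem IsParityClass.represents_TL_two_one (hl : IsParityClass l r) (hr : r < 2)
    (hs : s = 1 ∨ s = -1) {k a b c c' : Node n} (hk : k.1 % 2 ≠ r)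
    (ha : (a.1 : ℤ) = k.1 + s) (hb : (b.1 : ℤ) = k.1 - s) (hc : (c.1 : ℤ) = a.1 + s)
    (hd : ∀ d : Node n, (d.1 : ℤ) ≠ b.1 - s) (hc' : (c'.1 : ℤ) = c.1 + s) :
    Represents [c', c, a, k] (TL l (br v (ext s a) (br v (ext (-s) b) (eU k)))) := by
  rw [map_br, ext_of_next hc, ext_of_end (s := -s) hd, hl.TL_br_end hr hs hk ha hb,
    hl.TL_br hs (by omega) hc]
  have h1 := cartan_of_eq_add hs ha
  have h2 := cartan_of_eq_add hs hc
  rw [cartan_comm] at h1 h2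
  have e1 : cartan c k = 0 := cartan_of_ne (by omega) (by omega) (by omega)
  refine ((represents_eU k).right a ?_ (by simp [h1])).ext_left hs hc' ?_ (by simp [h2, e1]) ?_
  · simpa using ne_of_cartan h1 (by decide)
  · simpa using ⟨ne_of_cartan h2 (by decide), ne_of_cartan e1 (by decide)⟩
  · simp only [List.forall_mem_cons, List.not_mem_nil, false_imp_iff, implies_true, and_true]
    exact ⟨cartan_of_ne (by omega) (by omega) (by omega),
      cartan_of_ne (by omega) (by omega) (by omega)⟩

/-- None of the further neighbours exists. -/
theorem IsParityClass.represents_TL_two_zero (hl : IsParityClass l r) (hr : r < 2)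
    (hs : s = 1 ∨ s = -1) {k a b : Node n} (hk : k.1 % 2 ≠ r)
    (ha : (a.1 : ℤ) = k.1 + s) (hb : (b.1 : ℤ) = k.1 - s)
    (hc : ∀ c : Node n, (c.1 : ℤ) ≠ a.1 + s) (hd : ∀ d : Node n, (d.1 : ℤ) ≠ b.1 - s) :
    Represents [k] (TL l (br v (ext s a) (br v (ext (-s) b) (eU k)))) := by
  have h1 := cartan_of_eq_add hs ha
  rw [cartan_comm] at h1
  rw [map_br, ext_of_end hc, ext_of_end (s := -s) hd, hl.TL_br_end hr hs hk ha hb,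
    TL_eU_mem hl.pairwise ((hl.mem_iff a).2 (by omega)),
    br_freeT_br (hasWt_eU k) h1 (commute_eU_fU (node_ne (by omega)))]
  exact represents_eU k

/-! ### Commutation with `F_j` -/

theorem fU_kU_mul_eq {j : Node n} {X : Uq n} {w : Node n → ℤ} (hX : HasWt X w)
    (hf : Commute X (fU j)) : -(fU j * ↑(kU j)) * X = v ^ w j • (X * -(fU j * ↑(kU j))) := by
  rw [neg_mul, mul_assoc, hX j, mul_smul_comm, ← mul_assoc, ← hf.eq, mul_assoc, mul_neg, smul_neg]

/-- After applying the block containing `i`, this becomes the relation between the two root vectors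
of an end node; the term `v E_b` is the source of the correction `z_b`. -/
theorem fU_kU_mul_br {i b : Node n} (hb : cartan i b = -1) :
    -(fU i * ↑(kU i)) * br v (eU i) (eU b) =
      v • (br v (eU i) (eU b) * -(fU i * ↑(kU i))) - v • eU b := by
  have h1 := br_eU_mul_fU_left (cartan_comm i b ▸ hb)
  have h2 := ((hasWt_eU i).br (hasWt_eU b)).commute_kU (i := i) (c := 1) (by simp [hb, cartan_self])
  rw [zpow_one] at h2
  generalize br v (eU i) (eU b) = X at *
  have h3 : fU i * X = X * fU i + eU b * ↑(kU i)⁻¹ := by rw [h1]; abel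
  rw [neg_mul, mul_assoc, h2, mul_smul_comm, ← mul_assoc, h3, add_mul, mul_assoc (eU b),
    Units.inv_mul, mul_one, mul_neg, smul_add, smul_neg, mul_assoc]
  abel

section Abstract

variable {F A : Type*} [Field F] [Ring A] [Algebra F A] {q : F}

theorem br_mul_of_lowering {y a z f k' : A} (hy : y * f = f * y - z * k')
    (ha : Commute a f) (hk' : k' * a = q • (a * k')) (hz : Commute a z) :
    br q y a * f = f * br q y a - (q - q⁻¹) • (z * a * k') := by
  have ha' : a * f = f * a := ha
  have hz' : a * z = z * a := hz
  have e : br q y a * f = y * (a * f) - q⁻¹ • (a * (y * f)) := by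
    simp only [br, sub_mul, smul_mul_assoc, mul_assoc]
  rw [e, ha', ← mul_assoc y f a, hy, mul_sub, ← mul_assoc a f y, ha', ← mul_assoc a z k', hz']
  simp only [br, mul_sub, sub_mul, mul_smul_comm, smul_sub, mul_assoc, hk']
  match_scalars <;> ring

end Abstract

/-- Source of the relation between the two root vectors of an interior node: `F_i` detaches `E_i`
from the three-term bracket and leaves the product `E_a E_b`, which becomes the product of the two
neighbouring `z`'s. -/
theorem fU_kU_mul_br_br {i a b : Node n} (ha : cartan i a = -1) (hb : cartan i b = -1)
    (hab : cartan b a = 0) :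
    -(fU i * ↑(kU i)) * br v (br v (eU i) (eU b)) (eU a) =
      br v (br v (eU i) (eU b)) (eU a) * -(fU i * ↑(kU i)) - (v - v⁻¹) • (eU a * eU b) := by
  have h1 := br_mul_of_lowering (br_eU_mul_fU_left (cartan_comm i b ▸ hb))
    (commute_eU_fU (ne_of_cartan ha (by decide)).symm)
    (by simpa using (hasWt_eU a).commute_kU_inv ha) (commute_eU hab).symm
  have h2 := (((hasWt_eU i).br (hasWt_eU b)).br (hasWt_eU a)).commute_kU (i := i) (c := 0)
    (by simp [hb, ha, cartan_self])
  rw [zpow_zero, one_smul] at h2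
  generalize br v (br v (eU i) (eU b)) (eU a) = X at *
  have h3 : fU i * X = X * fU i + (v - v⁻¹) • (eU b * eU a * ↑(kU i)⁻¹) := by rw [h1]; abel
  rw [neg_mul, mul_assoc, h2, ← mul_assoc, h3, add_mul, smul_mul_assoc, mul_assoc (eU b * eU a),
    Units.inv_mul, mul_one, mul_neg, mul_assoc, (commute_eU hab).eq]
  abel

/-- The commutator of `F_a` and the `v`-commutator of `E_a` and `R`. -/
theorem br_eU_mul_fU_of_commute {a : Node n} {R : Uq n} {w : Node n → ℤ} (hR : HasWt R w)
    (hw : w a = -1) (hf : Commute R (fU a)) :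
    br v (eU a) R * fU a = fU a * br v (eU a) R - R * ↑(kU a)⁻¹ :=
  br_mul_lowering_left v_ne_zero v_inv_mul (eU_fU_self a) hf
    (by simpa using hR.commute_kU hw) (by simpa using hR.commute_kU_inv hw)

theorem fU_kU_mul_br_left {a : Node n} {R : Uq n} {w : Node n → ℤ} (hR : HasWt R w)
    (hw : w a = -1) (hf : Commute R (fU a)) :
    -(fU a * ↑(kU a)) * br v (eU a) R = v • (br v (eU a) R * -(fU a * ↑(kU a))) - v • R := by
  have h1 := br_eU_mul_fU_of_commute hR hw hf
  have h2 := ((hasWt_eU a).br hR).commute_kU (i := a) (c := 1) (by simp [hw, cartan_self])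
  rw [zpow_one] at h2
  generalize br v (eU a) R = X at *
  have h3 : fU a * X = X * fU a + R * ↑(kU a)⁻¹ := by rw [h1]; abel
  rw [neg_mul, mul_assoc, h2, mul_smul_comm, ← mul_assoc, h3, add_mul, mul_assoc R,
    Units.inv_mul, mul_one, mul_neg, smul_add, smul_neg, mul_assoc]
  abel

/-- Source of the relation between `y_a` and `y_k` for neighbours: `R` and `E_c` map to the `z`'s on
the far sides of `k` and of `a`. The preceding lemma is the version in which `a` is an end node. -/
theorem fU_kU_mul_br_br_left {a c : Node n} {R : Uq n} {w : Node n → ℤ} (hR : HasWt R w)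
    (hw : w a = -1) (hf : Commute R (fU a)) (hac : cartan a c = -1) (hc : Commute R (eU c)) :
    -(fU a * ↑(kU a)) * br v (br v (eU a) (eU c)) R =
      br v (br v (eU a) (eU c)) R * -(fU a * ↑(kU a)) - (v - v⁻¹) • (R * eU c) := by
  rw [br_br_right_comm hc.symm]
  have h1 := br_mul_of_lowering (br_eU_mul_fU_of_commute hR hw hf)
    (commute_eU_fU (ne_of_cartan hac (by decide)).symm)
    (by simpa using (hasWt_eU c).commute_kU_inv hac) hc.symm
  have h2 := (((hasWt_eU a).br hR).br (hasWt_eU c)).commute_kU (i := a) (c := 0)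
    (by simp [hac, hw, cartan_self])
  rw [zpow_zero, one_smul] at h2
  generalize br v (br v (eU a) R) (eU c) = X at *
  have h3 : fU a * X = X * fU a + (v - v⁻¹) • (R * eU c * ↑(kU a)⁻¹) := by rw [h1]; abel
  rw [neg_mul, mul_assoc, h2, ← mul_assoc, h3, add_mul, smul_mul_assoc, mul_assoc (R * eU c),
    Units.inv_mul, mul_one, mul_neg, mul_assoc]
  abel

end Class

/-! ### The form on the root lattice and products of simple reflections -/

theorem rootForm_comm (x y : RootLattice n) : rootForm x y = rootForm y x := by
  rw [rootForm, rootForm, Finset.sum_comm]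
  refine Finset.sum_congr rfl fun i _ => Finset.sum_congr rfl fun j _ => ?_
  rw [cartan_comm]
  ring

theorem rootForm_add_left (x x' y : RootLattice n) :
    rootForm (x + x') y = rootForm x y + rootForm x' y := by
  simp only [rootForm, Pi.add_apply, add_mul, Finset.sum_add_distrib]

theorem rootForm_smul_left (c : ℤ) (x y : RootLattice n) :
    rootForm (c • x) y = c * rootForm x y := by
  simp only [rootForm, Pi.smul_apply, smul_eq_mul, mul_assoc, Finset.mul_sum]

theorem rootForm_neg_left (x y : RootLattice n) : rootForm (-x) y = -rootForm x y := by
  rw [← neg_one_smul ℤ, rootForm_smul_left, neg_one_mul]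

theorem rootForm_sub_left (x x' y : RootLattice n) :
    rootForm (x - x') y = rootForm x y - rootForm x' y := by
  rw [sub_eq_add_neg, rootForm_add_left, rootForm_neg_left, sub_eq_add_neg]

theorem rootForm_add_right (x y y' : RootLattice n) :
    rootForm x (y + y') = rootForm x y + rootForm x y' := by
  rw [rootForm_comm, rootForm_add_left, rootForm_comm y, rootForm_comm y']

theorem rootForm_smul_right (c : ℤ) (x y : RootLattice n) :
    rootForm x (c • y) = c * rootForm x y := by
  rw [rootForm_comm, rootForm_smul_left, rootForm_comm y]

theorem rootForm_neg_right (x y : RootLattice n) : rootForm x (-y) = -rootForm x y := by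
  rw [rootForm_comm, rootForm_neg_left, rootForm_comm y]

theorem rootForm_sub_right (x y y' : RootLattice n) :
    rootForm x (y - y') = rootForm x y - rootForm x y' := by
  rw [rootForm_comm, rootForm_sub_left, rootForm_comm y, rootForm_comm y']

theorem rootForm_zero_right (x : RootLattice n) : rootForm x 0 = 0 := by simp [rootForm]

theorem rootForm_sum_right {ι : Type*} (s : Finset ι) (x : RootLattice n)
    (f : ι → RootLattice n) : rootForm x (∑ i ∈ s, f i) = ∑ i ∈ s, rootForm x (f i) :=
  map_sum (AddMonoidHom.mk' (rootForm x) (rootForm_add_right x)) f s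

theorem rootForm_simpleRoot (i j : Node n) :
    rootForm (simpleRoot i) (simpleRoot j) = cartan i j := by
  rw [rootForm, Finset.sum_eq_single i, Finset.sum_eq_single j]
  · simp [simpleRoot]
  · intro b _ hb; simp [simpleRoot, hb]
  · simp
  · intro b _ hb; simp [simpleRoot, hb]
  · simp

theorem simpleReflection_add (i : Node n) (x y : RootLattice n) :
    simpleReflection i (x + y) = simpleReflection i x + simpleReflection i y := by
  simp only [simpleReflection, rootForm_add_right, add_smul]
  abel

theorem rootForm_simpleReflection (i : Node n) (x y : RootLattice n) :
    rootForm (simpleReflection i x) (simpleReflection i y) = rootForm x y := by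
  simp only [simpleReflection, rootForm_sub_left, rootForm_sub_right, rootForm_smul_left,
    rootForm_smul_right, rootForm_simpleRoot, cartan_self]
  rw [rootForm_comm x (simpleRoot i)]
  ring

/-- The product of the simple reflections along a word. -/
def SL (l : List (Node n)) (x : RootLattice n) : RootLattice n := l.foldr simpleReflection x

theorem SL_cons (i : Node n) (l : List (Node n)) (x : RootLattice n) :
    SL (i :: l) x = simpleReflection i (SL l x) := rfl

theorem SL_append (l l' : List (Node n)) (x : RootLattice n) :
    SL (l ++ l') x = SL l (SL l' x) := List.foldr_append

theorem SL_add (l : List (Node n)) (x y : RootLattice n) : SL l (x + y) = SL l x + SL l y := by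
  induction l with
  | nil => rfl
  | cons i l ih => rw [SL_cons, ih, simpleReflection_add]; rfl

theorem SL_zero (l : List (Node n)) : SL l 0 = 0 := by
  have := SL_add l 0 0
  simpa using this

theorem SL_neg (l : List (Node n)) (x : RootLattice n) : SL l (-x) = -SL l x := by
  rw [eq_neg_iff_add_eq_zero, ← SL_add, neg_add_cancel, SL_zero]

theorem SL_sum {ι : Type*} (l : List (Node n)) (s : Finset ι) (f : ι → RootLattice n) :
    SL l (∑ i ∈ s, f i) = ∑ i ∈ s, SL l (f i) :=
  map_sum (AddMonoidHom.mk' (SL l) (SL_add l)) f s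

theorem rootForm_SL (l : List (Node n)) (x y : RootLattice n) :
    rootForm (SL l x) (SL l y) = rootForm x y := by
  induction l with
  | nil => rfl
  | cons i l ih => rw [SL_cons, SL_cons, rootForm_simpleReflection, ih]

theorem SL_far {l : List (Node n)} {k : Node n} (h : ∀ j ∈ l, cartan j k = 0) :
    SL l (simpleRoot k) = simpleRoot k := by
  induction l with
  | nil => rfl
  | cons i l ih =>
    simp only [List.forall_mem_cons] at h
    rw [SL_cons, ih h.2, simpleReflection, rootForm_simpleRoot, h.1, zero_smul, sub_zero]

/-- The product of pairwise orthogonal simple reflections. -/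
theorem SL_eq_sub_sum {l : List (Node n)} (hl : l.Pairwise fun i j => cartan i j = 0)
    (x : RootLattice n) :
    SL l x = x - (l.map fun i => rootForm (simpleRoot i) x • simpleRoot i).sum := by
  induction l with
  | nil => simp [SL]
  | cons i l ih =>
    rw [List.pairwise_cons] at hl
    have h0 : ∀ l' : List (Node n), (∀ j ∈ l', cartan i j = 0) → rootForm (simpleRoot i)
        (l'.map fun j => rootForm (simpleRoot j) x • simpleRoot j).sum = 0 := by
      intro l' hl'
      induction l' with
      | nil => simp [rootForm_zero_right]
      | cons j l' ih' =>
        simp only [List.forall_mem_cons] at hl'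
        rw [List.map_cons, List.sum_cons, rootForm_add_right, ih' hl'.2, rootForm_smul_right,
          rootForm_simpleRoot, hl'.1, mul_zero, add_zero]
    rw [SL_cons, ih hl.2, simpleReflection, rootForm_sub_right, h0 l hl.1, List.map_cons,
      List.sum_cons, sub_zero]
    abel

theorem SL_mem {l : List (Node n)} (hl : l.Pairwise fun i j => cartan i j = 0) {i : Node n}
    (hi : i ∈ l) : SL l (simpleRoot i) = -simpleRoot i := by
  have hself : simpleReflection i (simpleRoot i) = -simpleRoot i := by
    rw [simpleReflection, rootForm_simpleRoot, cartan_self, two_smul]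
    abel
  induction l with
  | nil => simp at hi
  | cons j l ih =>
    rw [List.pairwise_cons] at hl
    rcases List.mem_cons.1 hi with rfl | hi
    · rw [SL_cons, SL_far fun j hj => cartan_comm i j ▸ hl.1 j hj, hself]
    · rw [SL_cons, ih hl.2 hi, simpleReflection, rootForm_neg_right, rootForm_simpleRoot,
        hl.1 i hi]
      simp

/-- Products of pairwise orthogonal simple reflections are self-adjoint. -/
theorem rootForm_SL_comm {l : List (Node n)} (hl : l.Pairwise fun i j => cartan i j = 0)
    (x y : RootLattice n) : rootForm x (SL l y) = rootForm y (SL l x) := by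
  have h : ∀ x y : RootLattice n,
      rootForm x (l.map fun i => rootForm (simpleRoot i) y • simpleRoot i).sum =
        (l.map fun i => rootForm (simpleRoot i) y * rootForm (simpleRoot i) x).sum := by
    intro x y
    clear hl
    induction l with
    | nil => simp [rootForm_zero_right]
    | cons i l ih =>
      rw [List.map_cons, List.sum_cons, rootForm_add_right, ih, rootForm_smul_right, List.map_cons,
        List.sum_cons, rootForm_comm x]
  rw [SL_eq_sub_sum hl, SL_eq_sub_sum hl, rootForm_sub_right, rootForm_sub_right, h, h,
    rootForm_comm x y]
  simp only [mul_comm]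

/-- Two nodes are connected in the Dynkin diagram. -/
def Adj (a k : Node n) : Prop := a.1 + 1 = k.1 ∨ a.1 = k.1 + 1

instance (a k : Node n) : Decidable (Adj a k) := inferInstanceAs (Decidable (_ ∨ _))

theorem IsParityClass.SL_not_mem {l : List (Node n)} {r : ℕ} (hl : IsParityClass l r) (hr : r < 2)
    {k : Node n} (hk : k.1 % 2 ≠ r) :
    SL l (simpleRoot k) = simpleRoot k + ∑ a, if Adj a k then simpleRoot a else 0 := by
  have hnd : l.Nodup := hl.pairwise.imp fun h => ne_of_cartan h (by decide)
  rw [SL_eq_sub_sum hl.pairwise, ← List.sum_toFinset _ hnd, sub_eq_add_neg,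
    ← Finset.sum_neg_distrib, ← Finset.sum_subset (Finset.subset_univ l.toFinset)]
  · congr 1
    refine Finset.sum_congr rfl fun a ha => ?_
    have := (hl.mem_iff a).1 (List.mem_toFinset.1 ha)
    rw [rootForm_simpleRoot]
    split_ifs with h
    · rw [show cartan a k = -1 by simp only [cartan, Adj] at h ⊢; split_ifs <;> omega]
      simp
    · rw [show cartan a k = 0 by simp only [cartan, Adj] at h ⊢; split_ifs <;> omega]
      simp
  · intro a _ ha
    rw [List.mem_toFinset, hl.mem_iff] at ha
    rw [if_neg]
    simp only [Adj]
    omega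

/-! ### Roots and degrees -/

theorem beta_eq_SL (k : Idx n) : beta k = SL (prefixWord k) (simpleRoot k.2) := rfl

theorem beta_false_odd {i : Node n} (hi : i.1 % 2 = 1) : beta (false, i) = simpleRoot i := by
  obtain ⟨L, hL, h⟩ := prefixWord_false_odd hi
  rw [beta_eq_SL, hL, SL_far h]

theorem beta_false_even {i : Node n} (hi : i.1 % 2 = 0) :
    beta (false, i) = SL (odds n) (simpleRoot i) := by
  obtain ⟨L, hL, h⟩ := prefixWord_false_even hi
  rw [beta_eq_SL, hL, SL_append, SL_far h]

theorem beta_true_odd {i : Node n} (hi : i.1 % 2 = 1) :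
    beta (true, i) = SL (odds n) (SL (evens n) (simpleRoot i)) := by
  obtain ⟨L, hL, h⟩ := prefixWord_true_odd hi
  rw [beta_eq_SL, hL, SL_append, SL_append, SL_far h]

theorem beta_true_even {i : Node n} (hi : i.1 % 2 = 0) :
    beta (true, i) = SL (odds n) (SL (evens n) (SL (odds n) (simpleRoot i))) := by
  obtain ⟨L, hL, h⟩ := prefixWord_true_even hi
  rw [beta_eq_SL, hL, SL_append, SL_append, SL_append, SL_far h]

/-- The element `X` has degree `γ`, as far as the action of the `K_i` can tell. -/
def HasDeg (X : Uq n) (γ : RootLattice n) : Prop := HasWt X fun i => rootForm (simpleRoot i) γ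

theorem hasDeg_eU (k : Node n) : HasDeg (eU k) (simpleRoot k) :=
  (hasWt_eU k).congr fun i => (rootForm_simpleRoot i k).symm

theorem HasDeg.T {X : Uq n} {γ : RootLattice n} (h : HasDeg X γ) (i : Node n) :
    HasDeg (QuantumTypeA.T i X) (simpleReflection i γ) := fun j => by
  -- `K_j K_i^{-a_{ij}}` is the preimage of `K_j` under `T_i`, so the weight of `T_i(X)` at `j` is
  -- that of `X` at this product, namely the pairing of `α_j` with `s_i(γ)`.
  have h1 : QuantumTypeA.T i (↑(kU j * kU i ^ (-cartan i j)) : Uq n) = ↑(kU j) := by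
    have h2 : ∀ m : ℤ, QuantumTypeA.T i (↑(kU i ^ m) : Uq n) = ↑(kU i ^ (-m)) := by
      intro m
      let φ : (Uq n)ˣ →* (Uq n)ˣ := Units.map (QuantumTypeA.T i : Uq n →* Uq n)
      have h3 : φ (kU i) = (kU i)⁻¹ := Units.ext (T_kU_self i)
      have := congrArg Units.val (map_zpow φ (kU i) m)
      rw [h3, inv_zpow', zpow_neg] at this
      rw [zpow_neg]
      exact this
    rw [Units.val_mul, map_mul, h2, T_kU, ← Units.val_mul, mul_assoc, ← zpow_add, neg_neg,
      neg_add_cancel, zpow_zero, mul_one]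
  have h2 : (↑(kU j * kU i ^ (-cartan i j)) : Uq n) * X =
      v ^ (rootForm (simpleRoot j) (simpleReflection i γ)) •
        (X * ↑(kU j * kU i ^ (-cartan i j))) := by
    rw [Units.val_mul, mul_assoc, h.zpow, mul_smul_comm, ← mul_assoc, h j, smul_mul_assoc,
      smul_smul, mul_assoc, ← zpow_add₀ v_ne_zero]
    congr 2
    rw [simpleReflection, rootForm_sub_right, rootForm_smul_right, rootForm_simpleRoot,
      cartan_comm]
    ring
  have := congrArg (QuantumTypeA.T i) h2
  rwa [map_mul, map_smul, map_mul, h1] at this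

theorem HasDeg.TL {X : Uq n} {γ : RootLattice n} (h : HasDeg X γ) (l : List (Node n)) :
    HasDeg (QuantumTypeA.TL l X) (SL l γ) := by
  induction l with
  | nil => exact h
  | cons i l ih => exact ih.T i

/-! ### Relations between the roots -/

/-- The sum of the `|z_a|` over the neighbours `a` of `k`. -/
def nbrDeg (k : Node n) : RootLattice n := ∑ a, if Adj a k then beta (zIdx a) else 0

theorem zIdx_odd {a : Node n} (h : a.1 % 2 = 1) : zIdx a = (true, a) := by
  simp [zIdx, Nat.odd_iff, h]
theorem zIdx_even {a : Node n} (h : a.1 % 2 = 0) : zIdx a = (false, a) := by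
  simp [zIdx, Nat.odd_iff, h]
theorem yIdx_odd {a : Node n} (h : a.1 % 2 = 1) : yIdx a = (false, a) := by
  simp [yIdx, Nat.even_iff, h]
theorem yIdx_even {a : Node n} (h : a.1 % 2 = 0) : yIdx a = (true, a) := by
  simp [yIdx, Nat.even_iff, h]

/-- The mesh relations. -/
theorem beta_add_beta (k : Node n) : beta (false, k) + beta (true, k) = nbrDeg k := by
  rcases Nat.mod_two_eq_zero_or_one k.1 with hk | hk
  · rw [beta_false_even hk, beta_true_even hk, isParityClass_odds.SL_not_mem (by omega) (by omega),
      SL_add, SL_mem (pairwise_evens n) (mem_evens.2 hk), SL_add, SL_neg, SL_sum, SL_sum,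
      isParityClass_odds.SL_not_mem (by omega) (by omega)]
    rw [show ∀ a b c : RootLattice n, a + b + (-(a + b) + c) = c from fun a b c => by abel, nbrDeg]
    refine Finset.sum_congr rfl fun a _ => ?_
    split_ifs with h
    · simp only [Adj] at h
      rw [zIdx_odd (by omega), beta_true_odd (by omega)]
    · rw [SL_zero, SL_zero]
  · rw [beta_false_odd hk, beta_true_odd hk, isParityClass_evens.SL_not_mem (by omega) (by omega),
      SL_add, SL_mem (pairwise_odds n) (mem_odds.2 hk), SL_sum, add_neg_cancel_left, nbrDeg]
    refine Finset.sum_congr rfl fun a _ => ?_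
    split_ifs with h
    · simp only [Adj] at h
      rw [zIdx_even (by omega), beta_false_even (by omega)]
    · rw [SL_zero]

theorem mod_two_cases (i : Node n) : i.1 % 2 = 0 ∨ i.1 % 2 = 1 := Nat.mod_two_eq_zero_or_one i.1

/-- Roots of the same block. -/
theorem rootForm_beta_same (b : Bool) {i k : Node n} (h : i.1 % 2 = k.1 % 2) :
    rootForm (beta (b, i)) (beta (b, k)) = cartan i k := by
  rcases mod_two_cases k with hk | hk <;> rw [hk] at h <;> cases b
  · rw [beta_false_even h, beta_false_even hk, rootForm_SL, rootForm_simpleRoot]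
  · rw [beta_true_even h, beta_true_even hk, rootForm_SL, rootForm_SL, rootForm_SL,
      rootForm_simpleRoot]
  · rw [beta_false_odd h, beta_false_odd hk, rootForm_simpleRoot]
  · rw [beta_true_odd h, beta_true_odd hk, rootForm_SL, rootForm_SL, rootForm_simpleRoot]

theorem rootForm_SL_mem {l : List (Node n)} (hl : l.Pairwise fun i j => cartan i j = 0)
    {i : Node n} (hi : i ∈ l) (x : RootLattice n) :
    rootForm (simpleRoot i) (SL l x) = -rootForm (simpleRoot i) x := by
  rw [← rootForm_SL l (simpleRoot i) x, SL_mem hl hi, rootForm_neg_left, neg_neg]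

/-- Roots of neighbouring blocks. -/
theorem rootForm_beta_first (b : Bool) {i k : Node n} (hi : i.1 % 2 = 1) (hk : k.1 % 2 = 0) :
    rootForm (beta (b, i)) (beta (b, k)) = -cartan i k := by
  cases b
  · rw [beta_false_odd hi, beta_false_even hk, rootForm_SL_mem (pairwise_odds n) (mem_odds.2 hi),
      rootForm_simpleRoot]
  · rw [beta_true_odd hi, beta_true_even hk, rootForm_SL, rootForm_SL,
      rootForm_SL_mem (pairwise_odds n) (mem_odds.2 hi), rootForm_simpleRoot]

theorem rootForm_beta_second {i k : Node n} (hi : i.1 % 2 = 0) (hk : k.1 % 2 = 1) :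
    rootForm (beta (false, i)) (beta (true, k)) = -cartan i k := by
  rw [beta_false_even hi, beta_true_odd hk, rootForm_SL,
    rootForm_SL_mem (pairwise_evens n) (mem_evens.2 hi), rootForm_simpleRoot]

/-- The form between the two roots of a node and of another node of the same parity. -/
theorem rootForm_beta_symm {i k : Node n} (h : i.1 % 2 = k.1 % 2) :
    rootForm (beta (false, i)) (beta (true, k)) = rootForm (beta (false, k)) (beta (true, i)) := by
  rcases mod_two_cases k with hk | hk <;> rw [hk] at h
  · rw [beta_false_even h, beta_true_even hk, beta_false_even hk, beta_true_even h, rootForm_SL,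
      rootForm_SL, rootForm_SL_mem (pairwise_evens n) (mem_evens.2 h),
      rootForm_SL_mem (pairwise_evens n) (mem_evens.2 hk), rootForm_SL_comm (pairwise_odds n)]
  · rw [beta_false_odd h, beta_true_odd hk, beta_false_odd hk, beta_true_odd h,
      rootForm_SL_mem (pairwise_odds n) (mem_odds.2 h),
      rootForm_SL_mem (pairwise_odds n) (mem_odds.2 hk), rootForm_SL_comm (pairwise_evens n)]

/-! ### `v`-commuting elements -/

section Abstract

variable {F A : Type*} [Field F] [Ring A] [Algebra F A] {q : F}

/-- The elements `x` and `y` `q`-commute with exponent `e`. -/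
def VComm (q : F) (e : ℤ) (x y : A) : Prop := x * y = q ^ e • (y * x)

theorem VComm.of_commute {x y : A} (h : Commute x y) : VComm q 0 x y := by
  rw [VComm, zpow_zero, one_smul, h.eq]

theorem VComm.symm (hq : q ≠ 0) {e : ℤ} {x y : A} (h : VComm q e x y) : VComm q (-e) y x := by
  rw [VComm, h, smul_smul, ← zpow_add₀ hq, neg_add_cancel, zpow_zero, one_smul]

theorem VComm.smul_left {e : ℤ} {x y : A} (h : VComm q e x y) (c : F) : VComm q e (c • x) y := by
  rw [VComm, smul_mul_assoc, h, mul_smul_comm, smul_comm]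

theorem VComm.smul_right {e : ℤ} {x y : A} (h : VComm q e x y) (c : F) :
    VComm q e x (c • y) := by
  rw [VComm, mul_smul_comm, h, smul_mul_assoc, smul_comm]

theorem VComm.map {B : Type*} [Ring B] [Algebra F B] {e : ℤ} {x y : A} (h : VComm q e x y)
    (φ : A →ₐ[F] B) : VComm q e (φ x) (φ y) := by
  rw [VComm, ← map_mul, h, map_smul, map_mul]

theorem VComm.mul_right (hq : q ≠ 0) {e e' : ℤ} {x y z : A} (h : VComm q e x y)
    (h' : VComm q e' x z) : VComm q (e + e') x (y * z) := by
  rw [VComm, ← mul_assoc, h, smul_mul_assoc, mul_assoc, h', mul_smul_comm, smul_smul, mul_assoc,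
    zpow_add₀ hq]

theorem VComm.mul_left (hq : q ≠ 0) {e e' : ℤ} {x y z : A} (h : VComm q e x z)
    (h' : VComm q e' y z) : VComm q (e + e') (x * y) z := by
  rw [VComm, mul_assoc, h', mul_smul_comm, ← mul_assoc, h, smul_mul_assoc, smul_smul, mul_assoc,
    zpow_add₀ hq, mul_comm]

theorem VComm.sub_right {e : ℤ} {x y z : A} (h : VComm q e x y) (h' : VComm q e x z) :
    VComm q e x (y - z) := by
  rw [VComm, mul_sub, h, h', sub_mul, smul_sub]

theorem VComm.add_left {e : ℤ} {x y z : A} (h : VComm q e x z) (h' : VComm q e y z) :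
    VComm q e (x + y) z := by
  rw [VComm, add_mul, h, h', mul_add, smul_add]

theorem VComm.one_left (x : A) : VComm q 0 1 x := VComm.of_commute (Commute.one_left x)

theorem VComm.one_right (x : A) : VComm q 0 x 1 := VComm.of_commute (Commute.one_right x)

theorem VComm.pow_left (hq : q ≠ 0) {e : ℤ} {x y : A} (h : VComm q e x y) (m : ℕ) :
    VComm q (m * e) (x ^ m) y := by
  induction m with
  | zero => simpa using VComm.one_left y
  | succ m ih =>
    rw [pow_succ, Nat.cast_succ, add_mul, one_mul]
    exact ih.mul_left hq h

/-- The relation gives `p = a b - q⁻¹ m` a second form `q^{-e} b a - q m`. Multiplying the second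
form by `a` from the left and moving `a` past `m` produces the first form times `a`. -/
theorem vcomm_self_first (hq : q ≠ 0) {e : ℤ} {a b m : A}
    (h : a * b = q ^ (-e) • (b * a) - (q - q⁻¹) • m) (ha : VComm q (-2 - e) a m) :
    VComm q (-e) a (a * b - q⁻¹ • m) := by
  have h1 : a * b - q⁻¹ • m = q ^ (-e) • (b * a) - q • m := by rw [h]; module
  have h2 : q * q ^ (-2 - e) = q ^ (-e) * q⁻¹ := by
    rw [← zpow_neg_one, ← zpow_one_add₀ hq, ← zpow_add₀ hq]
    congr 1
    ring
  rw [VComm]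
  conv_lhs => rw [h1]
  rw [mul_sub, mul_smul_comm, mul_smul_comm, ha, sub_mul, smul_sub, smul_smul, h2, mul_assoc,
    smul_mul_assoc, smul_smul]

theorem vcomm_self_second (hq : q ≠ 0) {e : ℤ} {a b m : A}
    (h : a * b = q ^ (-e) • (b * a) - (q - q⁻¹) • m) (hb : VComm q (2 + e) b m) :
    VComm q e b (a * b - q⁻¹ • m) := by
  have h1 : b * a = q ^ e • (a * b - q⁻¹ • m) + (q ^ e * q) • m := by
    rw [h]
    have : q ^ e * q ^ (-e) = 1 := by rw [← zpow_add₀ hq, add_neg_cancel, zpow_zero]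
    simp only [smul_sub, smul_smul, this, sub_smul, one_smul]
    abel
  have h2 : q⁻¹ * q ^ (2 + e) = q ^ e * q := by
    rw [← zpow_neg_one, ← zpow_add₀ hq, ← zpow_add_one₀ hq]
    congr 1
    ring
  rw [VComm]
  conv_lhs => rw [mul_sub, ← mul_assoc, h1, mul_smul_comm, hb]
  rw [add_mul, smul_mul_assoc, smul_mul_assoc, smul_smul, h2, add_sub_cancel_right]

/-- Moving `y` past `Y Z` leaves a correction from `Y`, and past `c w` one from `w`. Both are
multiples of `c Z d`, and the coefficient `q⁻¹` in `Y Z - q⁻¹ c w` makes them cancel; `h6` says that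
the main terms carry the same power of `q`. -/
theorem vcomm_neighbour_odd (hq : q ≠ 0) {a b g : ℤ} {Y Z y w c d : A}
    (h1 : Y * y = q ^ a • (y * Y) - (q - q⁻¹) • (c * d))
    (h2 : w * y = q ^ b • (y * w) - (q - q⁻¹) • (Z * d)) (h3 : VComm q (-1) Z y)
    (h4 : VComm q g c y) (h5 : Commute d Z) (h6 : b + g = a - 1) :
    VComm q (a - 1) (Y * Z - q⁻¹ • (c * w)) y := by
  have e1 : Y * Z * y = q ^ (a - 1) • (y * (Y * Z)) - (q⁻¹ * (q - q⁻¹)) • (c * (Z * d)) := by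
    rw [mul_assoc, h3, mul_smul_comm, ← mul_assoc, h1, sub_mul, smul_mul_assoc, smul_mul_assoc,
      smul_sub, smul_smul, smul_smul, mul_assoc c, h5.eq, zpow_neg_one, mul_assoc,
      zpow_sub_one₀ hq, mul_comm q⁻¹]
  have e2 : c * w * y = q ^ (a - 1) • (y * (c * w)) - (q - q⁻¹) • (c * (Z * d)) := by
    rw [mul_assoc, h2, mul_sub, mul_smul_comm, ← mul_assoc, h4, smul_mul_assoc, smul_smul,
      ← zpow_add₀ hq, h6, mul_smul_comm, mul_assoc]
  rw [VComm, sub_mul, e1, smul_mul_assoc, e2, mul_sub y, mul_smul_comm]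
  simp only [smul_sub, smul_smul, mul_comm q⁻¹]
  abel

theorem vcomm_neighbour_even (hq : q ≠ 0) {a b g : ℤ} {Y Z y w c d : A}
    (h1 : y * Y = q ^ a • (Y * y) - (q - q⁻¹) • (d * c))
    (h2 : y * w = q ^ b • (w * y) - (q - q⁻¹) • (Z * d)) (h3 : VComm q (-1) y Z)
    (h4 : VComm q g y c) (h6 : b + g = a - 1) :
    VComm q (a - 1) y (Z * Y - q⁻¹ • (w * c)) := by
  have e1 : y * (Z * Y) = q ^ (a - 1) • (Z * Y * y) - (q⁻¹ * (q - q⁻¹)) • (Z * d * c) := by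
    rw [← mul_assoc, h3, smul_mul_assoc, mul_assoc, h1, mul_sub, mul_smul_comm, mul_smul_comm,
      smul_sub, smul_smul, smul_smul, zpow_neg_one, ← mul_assoc, ← mul_assoc,
      zpow_sub_one₀ hq, mul_comm q⁻¹]
  have e2 : y * (w * c) = q ^ (a - 1) • (w * c * y) - (q - q⁻¹) • (Z * d * c) := by
    rw [← mul_assoc, h2, sub_mul, smul_mul_assoc, mul_assoc w, h4, mul_smul_comm, smul_smul,
      ← zpow_add₀ hq, h6, smul_mul_assoc, mul_assoc w]
  rw [VComm, mul_sub, e1, mul_smul_comm, e2, sub_mul, smul_mul_assoc]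
  simp only [smul_sub, smul_smul, mul_comm q⁻¹]
  abel

end Abstract

/-! ### Commutation of root vectors -/

/-- Pulled back along the block, `E_i` becomes `-F_i K_i`. Since `F_i` commutes with `X`, only the
weight of `X` at `K_i` contributes, and reflecting in the block reverses its sign. -/
theorem eU_mul_TL {l : List (Node n)} (hl : l.Pairwise fun i j => cartan i j = 0) {i : Node n}
    (hi : i ∈ l) {X : Uq n} {γ : RootLattice n} (hX : HasDeg X γ) (hf : Commute X (fU i)) :
    VComm v (-rootForm (simpleRoot i) (SL l γ)) (eU i) (TL l X) := by
  have : VComm v (rootForm (simpleRoot i) γ) (-(fU i * ↑(kU i))) X := fU_kU_mul_eq hX hf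
  have := this.map (TL l)
  rwa [TL_fU_mul_kU_mem hl hi, ← neg_neg (rootForm _ γ), ← rootForm_SL_mem hl hi] at this

section Class

variable {l m : List (Node n)} {r r' : ℕ} {s : ℤ}

/-- Elements commuting with `E_k` and its neighbours commute with `T_l(E_k)`. -/
theorem IsParityClass.commute_TL (hl : IsParityClass l r) (hr : r < 2) {k : Node n}
    (hk : k.1 % 2 ≠ r) {x : Uq n} (h : ∀ c : Node n, c = k ∨ Adj c k → Commute x (eU c)) :
    Commute x (TL l (eU k)) := by
  have hadj : ∀ {s : ℤ} {c : Node n}, (s = 1 ∨ s = -1) → (c.1 : ℤ) = k.1 + s →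
      Commute x (eU c) := fun hs hc => h _ (Or.inr (by simp only [Adj]; omega))
  have hone : ∀ s : ℤ, (s = 1 ∨ s = -1) → (∀ c : Node n, (c.1 : ℤ) ≠ k.1 + s) →
      Commute x (TL l (eU k)) := fun s hs ha => by
    rcases next_or_end (-s) k with ⟨b, hb⟩ | hb
    · rw [hl.TL_one (b := b) hs hk hr ha (by omega)]
      exact commute_br (h k (Or.inl rfl)) (hadj (by omega) hb)
    · rw [TL_eU_far]
      · exact h k (Or.inl rfl)
      · intro j hj
        have h0 := (hl.mem_iff j).1 hj
        have h1 := ha j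
        have h2 := hb j
        exact cartan_of_ne (by omega) (by omega) (by omega)
  rcases next_or_end 1 k with ⟨a, ha⟩ | ha
  · rcases next_or_end (-1) k with ⟨b, hb⟩ | hb
    · rw [hl.TL_two (b := b) (Or.inl rfl) hk hr ha (by omega)]
      exact commute_br (commute_br (h k (Or.inl rfl)) (hadj (Or.inr rfl) hb))
        (hadj (Or.inl rfl) ha)
    · exact hone (-1) (Or.inr rfl) hb
  · exact hone 1 (Or.inl rfl) ha

end Class

/-- The position of an index in the four blocks of the word. -/
def block (x : Idx n) : ℕ := (if x.1 then 2 else 0) + (if x.2.1 % 2 = 1 then 0 else 1)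

theorem commute_rootVector {x y : Idx n} (h : block x = block y) :
    Commute (rootVector x) (rootVector y) := by
  obtain ⟨b, i⟩ := x
  obtain ⟨c, k⟩ := y
  obtain rfl : b = c := by
    cases b <;> cases c <;> simp only [block] at h <;> first | rfl | (split_ifs at h <;> simp_all)
  have hp : i.1 % 2 = k.1 % 2 := by
    simp only [block] at h
    rcases mod_two_cases i with hi | hi <;> rcases mod_two_cases k with hk | hk <;>
      simp_all
  have : Commute (eU i) (eU k) := commute_eU_of_ne (by omega) (by omega)
  rcases mod_two_cases k with hk | hk <;> rw [hk] at hp <;> cases b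
  · rw [rootVector_false_even hp, rootVector_false_even hk]
    exact this.map _
  · rw [rootVector_true_even hp, rootVector_true_even hk]
    exact ((this.map _).map _).map _
  · rw [rootVector_false_odd hp, rootVector_false_odd hk]
    exact this
  · rw [rootVector_true_odd hp, rootVector_true_odd hk]
    exact (this.map _).map _

theorem vcomm_first (b : Bool) {i k : Node n} (hi : i.1 % 2 = 1) (hk : k.1 % 2 = 0) :
    VComm v (-rootForm (beta (b, i)) (beta (b, k))) (rootVector (b, i)) (rootVector (b, k)) := by
  have := eU_mul_TL (pairwise_odds n) (mem_odds.2 hi) (hasDeg_eU k)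
    (commute_eU_fU (node_ne (by omega : k.1 ≠ i.1)))
  cases b
  · rwa [rootVector_false_odd hi, rootVector_false_even hk, beta_false_odd hi, beta_false_even hk]
  · rw [rootVector_true_odd hi, rootVector_true_even hk, beta_true_odd hi, beta_true_even hk,
      rootForm_SL, rootForm_SL]
    exact (this.map _).map _

theorem vcomm_second {i k : Node n} (hi : i.1 % 2 = 0) (hk : k.1 % 2 = 1) :
    VComm v (-rootForm (beta (false, i)) (beta (true, k))) (rootVector (false, i))
      (rootVector (true, k)) := by
  have := eU_mul_TL (pairwise_evens n) (mem_evens.2 hi) (hasDeg_eU k)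
    (commute_eU_fU (node_ne (by omega : k.1 ≠ i.1)))
  rw [rootVector_false_even hi, rootVector_true_odd hk, beta_false_even hi, beta_true_odd hk,
      rootForm_SL]
  exact this.map _

/-- The common initial blocks are stripped off. What remains on the right involves only `E_k` and
the neighbours of `k`, none of which is `i`, so `F_i` commutes with it. -/
theorem vcomm_same_parity {i k : Node n} (h : i ≠ k) (hp : i.1 % 2 = k.1 % 2) :
    VComm v (-rootForm (beta (false, i)) (beta (true, k))) (rootVector (false, i))
      (rootVector (true, k)) := by
  have hne := val_ne h
  have hc : ∀ c : Node n, c = k ∨ Adj c k → Commute (fU i) (eU c) := fun c hc =>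
    (commute_eU_fU (node_ne (by
      rcases hc with rfl | hc
      · exact hne.symm
      · simp only [Adj] at hc; omega))).symm
  rcases mod_two_cases k with hk | hk <;> rw [hk] at hp
  · have := eU_mul_TL (pairwise_evens n) (mem_evens.2 hp) ((hasDeg_eU k).TL _)
      (isParityClass_odds.commute_TL (by omega) (by omega) hc).symm
    rw [rootVector_false_even hp, rootVector_true_even hk, beta_false_even hp, beta_true_even hk,
      rootForm_SL]
    exact this.map _
  · have := eU_mul_TL (pairwise_odds n) (mem_odds.2 hp) ((hasDeg_eU k).TL _)
      (isParityClass_evens.commute_TL (by omega) (by omega) hc).symm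
    rwa [rootVector_false_odd hp, rootVector_true_odd hk, beta_false_odd hp, beta_true_odd hk]

/-- For odd `n` an even node has two neighbours. -/
theorem exists_next_even (hn : Odd n) {k : Node n} (hk : k.1 % 2 = 0) {s : ℤ}
    (hs : s = 1 ∨ s = -1) : ∃ a : Node n, (a.1 : ℤ) = k.1 + s := by
  have := Finset.mem_Icc.1 k.2
  have := Nat.odd_iff.1 hn
  exact exists_next k (by omega) (by omega)

theorem vcomm_far (hn : Odd n) {i k : Node n} (hi : i.1 % 2 = 1) (hk : k.1 % 2 = 0)
    (h : ¬Adj i k) :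
    VComm v (-rootForm (beta (false, i)) (beta (true, k))) (rootVector (false, i))
      (rootVector (true, k)) := by
  simp only [Adj] at h
  obtain ⟨a, ha⟩ := exists_next_even hn hk (s := 1) (Or.inl rfl)
  obtain ⟨b, hb⟩ := exists_next_even hn hk (s := -1) (Or.inr rfl)
  have hX := isParityClass_evens.TL_TL_two isParityClass_odds rfl (Or.inl rfl) hk ha
    (b := b) (by omega)
  have := eU_mul_TL (pairwise_odds n) (mem_odds.2 hi) (((hasDeg_eU k).TL (odds n)).TL (evens n)) ?_
  · rwa [rootVector_false_odd hi, rootVector_true_even hk, beta_false_odd hi, beta_true_even hk]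
  · rw [hX]
    refine (commute_br ?_ (commute_br ?_ ?_)).symm
    · exact (commute_ext_fU (Or.inl rfl) (by omega) (by omega)).symm
    · exact (commute_ext_fU (Or.inr rfl) (by omega) (by omega)).symm
    · exact (commute_eU_fU (node_ne (by omega))).symm

/-! ### Norms of root vectors -/

section Norms

variable {s : ℤ}

theorem norm_false_odd {k : Node n} (hk : k.1 % 2 = 1) :
    kashiwaraForm (rootVector (false, k)) (rootVector (false, k)) = 1 := by
  rw [rootVector_false_odd hk, (represents_eU k).norm]
  simp

theorem norm_false_even (hn : Odd n) {k : Node n} (hk : k.1 % 2 = 0) :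
    kashiwaraForm (rootVector (false, k)) (rootVector (false, k)) = (1 - v⁻¹ ^ 2) ^ 2 := by
  obtain ⟨a, ha⟩ := exists_next_even hn hk (s := 1) (Or.inl rfl)
  obtain ⟨b, hb⟩ := exists_next_even hn hk (s := -1) (Or.inr rfl)
  rw [rootVector_false_even hk, isParityClass_odds.TL_two (b := b) (Or.inl rfl) (by omega)
    (by omega) ha (by omega), (represents_two (Or.inl rfl) ha (by omega)).norm]
  rfl

theorem norm_true_odd_two (hn : Odd n) (hs : s = 1 ∨ s = -1) {k a b : Node n}
    (hk : k.1 % 2 = 1) (ha : (a.1 : ℤ) = k.1 + s) (hb : (b.1 : ℤ) = k.1 - s) :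
    kashiwaraForm (rootVector (true, k)) (rootVector (true, k)) = (1 - v⁻¹ ^ 2) ^ 4 := by
  obtain ⟨c, hc⟩ := exists_next_even hn (k := a) (by omega) hs
  obtain ⟨d, hd⟩ := exists_next_even hn (k := b) (by omega) (s := -s) (by omega)
  rw [rootVector_true_odd hk, isParityClass_odds.TL_TL_two isParityClass_evens rfl hs hk ha hb,
    (represents_ext_ext hs ha hb hc (by omega : (d.1 : ℤ) = b.1 - s)).norm]
  rfl

theorem norm_true_odd_one (hn : Odd n) (hs : s = 1 ∨ s = -1) {k b : Node n}
    (hk : k.1 % 2 = 1) (ha : ∀ a : Node n, (a.1 : ℤ) ≠ k.1 + s) (hb : (b.1 : ℤ) = k.1 - s) :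
    kashiwaraForm (rootVector (true, k)) (rootVector (true, k)) = (1 - v⁻¹ ^ 2) ^ 1 := by
  obtain ⟨d, hd⟩ := exists_next_even hn (k := b) (by omega) (s := -s) (by omega)
  rw [rootVector_true_odd hk, isParityClass_odds.TL_TL_one isParityClass_evens rfl hs hk ha hb,
    (represents_ext (by omega) hd).norm]
  rfl

/-- The exponent is one less than the number of nodes in the chain `d', d, b, k, a, c, c'`. The
outermost nodes exist because `c` and `d` are even, hence not ends of the diagram for odd `n`. -/
theorem norm_true_even_two (hn : Odd n) (hs : s = 1 ∨ s = -1) {k a b c d : Node n}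
    (hk : k.1 % 2 = 0) (ha : (a.1 : ℤ) = k.1 + s) (hb : (b.1 : ℤ) = k.1 - s)
    (hc : (c.1 : ℤ) = a.1 + s) (hd : (d.1 : ℤ) = b.1 - s) :
    kashiwaraForm (rootVector (true, k)) (rootVector (true, k)) = (1 - v⁻¹ ^ 2) ^ 6 := by
  obtain ⟨c', hc'⟩ := exists_next_even hn (k := c) (by omega) hs
  obtain ⟨d', hd'⟩ := exists_next_even hn (k := d) (by omega) (s := -s) (by omega)
  rw [rootVector_true_even hk, isParityClass_evens.TL_TL_two isParityClass_odds rfl hs hk ha hb,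
    (isParityClass_odds.represents_TL_two_two (by omega) hs (by omega) ha hb hc hd hc'
      (by omega : (d'.1 : ℤ) = d.1 - s)).norm]
  rfl

theorem norm_true_even_one (hn : Odd n) (hs : s = 1 ∨ s = -1) {k a b c : Node n}
    (hk : k.1 % 2 = 0) (ha : (a.1 : ℤ) = k.1 + s) (hb : (b.1 : ℤ) = k.1 - s)
    (hc : (c.1 : ℤ) = a.1 + s) (hd : ∀ d : Node n, (d.1 : ℤ) ≠ b.1 - s) :
    kashiwaraForm (rootVector (true, k)) (rootVector (true, k)) = (1 - v⁻¹ ^ 2) ^ 3 := by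
  obtain ⟨c', hc'⟩ := exists_next_even hn (k := c) (by omega) hs
  rw [rootVector_true_even hk, isParityClass_evens.TL_TL_two isParityClass_odds rfl hs hk ha hb,
    (isParityClass_odds.represents_TL_two_one (by omega) hs (by omega) ha hb hc hd hc').norm]
  rfl

theorem norm_true_even_zero (hs : s = 1 ∨ s = -1) {k a b : Node n}
    (hk : k.1 % 2 = 0) (ha : (a.1 : ℤ) = k.1 + s) (hb : (b.1 : ℤ) = k.1 - s)
    (hc : ∀ c : Node n, (c.1 : ℤ) ≠ a.1 + s) (hd : ∀ d : Node n, (d.1 : ℤ) ≠ b.1 - s) :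
    kashiwaraForm (rootVector (true, k)) (rootVector (true, k)) = 1 := by
  rw [rootVector_true_even hk, isParityClass_evens.TL_TL_two isParityClass_odds rfl hs hk ha hb,
    (isParityClass_odds.represents_TL_two_zero (by omega) hs (by omega) ha hb hc hd).norm]
  simp

theorem v_mul_one_sub : v * (1 - v⁻¹ ^ 2) = v - v⁻¹ := by field_simp [v_ne_zero]

theorem one_sub_ne_zero : (1 - v⁻¹ ^ 2 : Kv) ≠ 0 := by
  intro h
  apply v_sub_ne_zero
  rw [← v_mul_one_sub, h, mul_zero]

end Norms

/-! ### Sums and products over neighbours -/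

theorem sum_adj_two {M : Type*} [AddCommMonoid M] {s : ℤ} (hs : s = 1 ∨ s = -1) {k a b : Node n}
    (ha : (a.1 : ℤ) = k.1 + s) (hb : (b.1 : ℤ) = k.1 - s) (f : Node n → M) :
    (∑ c, if Adj c k then f c else 0) = f a + f b := by
  have hab : a ≠ b := node_ne (by omega)
  rw [← Finset.sum_pair hab, ← Finset.sum_subset (Finset.subset_univ {a, b})]
  · refine Finset.sum_congr rfl fun c hc => if_pos ?_
    simp only [Finset.mem_insert, Finset.mem_singleton] at hc
    rcases hc with rfl | rfl <;> simp only [Adj] <;> omega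
  · intro c _ hc
    simp only [Finset.mem_insert, Finset.mem_singleton, not_or] at hc
    have h1 := val_ne hc.1
    have h2 := val_ne hc.2
    refine if_neg ?_
    simp only [Adj]
    omega

theorem sum_adj_one {M : Type*} [AddCommMonoid M] {s : ℤ} (hs : s = 1 ∨ s = -1) {k b : Node n}
    (ha : ∀ a : Node n, (a.1 : ℤ) ≠ k.1 + s) (hb : (b.1 : ℤ) = k.1 - s) (f : Node n → M) :
    (∑ c, if Adj c k then f c else 0) = f b := by
  rw [Finset.sum_eq_single b]
  · refine if_pos ?_
    simp only [Adj]
    omega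
  · intro c _ hc
    have h1 := val_ne hc
    have h2 := ha c
    refine if_neg ?_
    simp only [Adj]
    omega
  · simp

/-- The element `z_m`, for an integer `m`. -/
def zAt (n : ℕ) (m : ℤ) : Uq n := zElt n m.toNat

/-- The degree `|z_m|`, for an integer `m`. -/
def dAt (n : ℕ) (m : ℤ) : RootLattice n := degZ n m.toNat

theorem zAt_node {a : Node n} {m : ℤ} (h : (a.1 : ℤ) = m) :
    zAt n m = dualRootVector (zIdx a) := by
  subst h
  rw [zAt, Int.toNat_natCast, zElt, dif_pos a.2]

theorem dAt_node {a : Node n} {m : ℤ} (h : (a.1 : ℤ) = m) : dAt n m = beta (zIdx a) := by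
  subst h
  rw [dAt, Int.toNat_natCast, degZ, dif_pos a.2]

theorem zAt_end {m : ℤ} (h : ∀ a : Node n, (a.1 : ℤ) ≠ m) : zAt n m = 1 := by
  rw [zAt, zElt, dif_neg]
  intro hm
  have := Finset.mem_Icc.1 hm
  exact h ⟨_, hm⟩ (by simp only; omega)

theorem dAt_end {m : ℤ} (h : ∀ a : Node n, (a.1 : ℤ) ≠ m) : dAt n m = 0 := by
  rw [dAt, degZ, dif_neg]
  intro hm
  have := Finset.mem_Icc.1 hm
  exact h ⟨_, hm⟩ (by simp only; omega)

theorem node_or_end (n : ℕ) (m : ℤ) :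
    (∃ a : Node n, (a.1 : ℤ) = m) ∨ ∀ a : Node n, (a.1 : ℤ) ≠ m := by
  by_cases h : ∃ a : Node n, (a.1 : ℤ) = m
  · exact Or.inl h
  · exact Or.inr fun a ha => h ⟨a, ha⟩

/-- For `3 ≤ n`, a node without a neighbour on one side has a neighbour on the other side. -/
theorem exists_other (h3 : 3 ≤ n) {s : ℤ} (hs : s = 1 ∨ s = -1) {k : Node n}
    (h : ∀ a : Node n, (a.1 : ℤ) ≠ k.1 + s) : ∃ b : Node n, (b.1 : ℤ) = k.1 - s := by
  have := Finset.mem_Icc.1 k.2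
  by_contra! h'
  have h1 : k.1 + 1 ∉ Finset.Icc 1 n ∧ k.1 - 1 ∉ Finset.Icc 1 n := by
    constructor
    · intro hm
      have := h ⟨_, hm⟩
      have := h' ⟨_, hm⟩
      simp only at *
      omega
    · intro hm
      have := Finset.mem_Icc.1 hm
      have := h ⟨_, hm⟩
      have := h' ⟨_, hm⟩
      simp only at *
      omega
  simp only [Finset.mem_Icc] at h1
  omega

theorem nbrDeg_eq (h3 : 3 ≤ n) {s : ℤ} (hs : s = 1 ∨ s = -1) (k : Node n) :
    nbrDeg k = dAt n (k.1 + s) + dAt n (k.1 - s) := by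
  rcases node_or_end n (k.1 + s) with ⟨a, ha⟩ | ha
  · rcases node_or_end n (k.1 - s) with ⟨b, hb⟩ | hb
    · rw [nbrDeg, sum_adj_two hs ha hb, dAt_node ha, dAt_node hb]
    · rw [nbrDeg, sum_adj_one (s := -s) (by omega) hb (by omega : (a.1 : ℤ) = k.1 - -s),
        dAt_node ha, dAt_end hb, add_zero]
  · obtain ⟨b, hb⟩ := exists_other h3 hs ha
    rw [nbrDeg, sum_adj_one hs ha hb, dAt_end ha, dAt_node hb, zero_add]

/-! ### The commutation relations with correction terms -/

/-- Passage from root vectors to dual root vectors: the condition `hc` on the normalising scalars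
converts whatever coefficient occurs into `v - v⁻¹`. -/
theorem relation_smul {A B C D : Uq n} {e : ℤ} {c α β γ δ : Kv}
    (h : A * B = v ^ e • (B * A) - c • (C * D)) (hc : c * (α * β) = (v - v⁻¹) * (γ * δ)) :
    (α • A) * (β • B) = v ^ e • ((β • B) * (α • A)) - (v - v⁻¹) • ((γ • C) * (δ • D)) := by
  have h1 : v ^ e * (α * β) = β * (α * v ^ e) := by ring
  have h2 : (v - v⁻¹) * (δ * γ) = β * (α * c) := by rw [mul_comm δ, ← hc]; ring
  simp only [smul_mul_assoc, mul_smul_comm, h, smul_sub, smul_smul, h1, h2]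

theorem commute_zAt {k l : ℤ} (h : k % 2 = l % 2) : Commute (zAt n k) (zAt n l) := by
  rcases node_or_end n k with ⟨a, ha⟩ | ha
  · rcases node_or_end n l with ⟨b, hb⟩ | hb
    · rw [zAt_node ha, zAt_node hb]
      refine ((commute_rootVector ?_).smul_left _).smul_right _
      rcases mod_two_cases a with h' | h'
      · have hb' : b.1 % 2 = 0 := by omega
        simp [zIdx_even, block, h', hb']
      · have hb' : b.1 % 2 = 1 := by omega
        simp [zIdx_odd, block, h', hb']
    · rw [zAt_end hb]
      exact Commute.one_right _
  · rw [zAt_end ha]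
    exact Commute.one_left _

/-- The relation between the two root vectors of a node. -/
theorem dualRootVector_mul_same (hn : Odd n) (h3 : 3 ≤ n) {s : ℤ} (hs : s = 1 ∨ s = -1)
    (k : Node n) :
    dualRootVector (false, k) * dualRootVector (true, k) =
      v ^ (-rootForm (beta (false, k)) (beta (true, k))) •
        (dualRootVector (true, k) * dualRootVector (false, k)) -
      (v - v⁻¹) • (zAt n (k.1 + s) * zAt n (k.1 - s)) := by
  have hκ := one_sub_ne_zero
  rcases mod_two_cases k with hk | hk
  · obtain ⟨a, ha⟩ := exists_next_even hn hk hs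
    obtain ⟨b, hb⟩ := exists_next_even hn hk (s := -s) (by omega)
    have hb : (b.1 : ℤ) = k.1 - s := by omega
    have hka : cartan k a = -1 := cartan_of_eq_add hs ha
    have hkb : cartan k b = -1 := cartan_comm b k ▸ cartan_of_eq_add hs (by omega)
    have hba : cartan b a = 0 := cartan_of_ne (by omega) (by omega) (by omega)
    have he : rootForm (beta (false, k)) (beta (true, k)) = 0 := by
      rw [beta_false_even hk, beta_true_even hk, rootForm_SL,
        rootForm_SL_mem (pairwise_evens n) (mem_evens.2 hk),
        isParityClass_odds.SL_not_mem (by omega) (by omega), sum_adj_two hs ha hb]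
      simp [rootForm_add_right, rootForm_simpleRoot, cartan_self, hka, hkb]
    -- The second vector of `k` is the image under the odd block of `T_E T_O(E_k)`, and the first
    -- one is the image of `T_E(-F_k K_k)`; so the identity before both blocks is transported by
    -- them.
    have h := congrArg (TO n) (congrArg (TE n) (fU_kU_mul_br_br hka hkb hba))
    rw [← isParityClass_odds.TL_two hs (by omega) (by omega) ha hb] at h
    simp only [map_mul, map_sub, map_smul, TL_fU_mul_kU_mem (pairwise_evens n) (mem_evens.2 hk)]
      at h
    rw [← rootVector_true_even hk, ← rootVector_false_even hk, ← rootVector_true_odd (i := a) (by omega),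
      ← rootVector_true_odd (i := b) (by omega)] at h
    rw [zAt_node ha, zAt_node hb, zIdx_odd (by omega), zIdx_odd (by omega), dualRootVector,
      dualRootVector, dualRootVector, dualRootVector, he]
    -- The norms must balance: as exponents of `1 - v⁻²` the four cases read `2 + 6 = 4 + 4`, `2 + 3
    -- = 4 + 1` twice, and `2 + 0 = 1 + 1`.
    refine relation_smul (c := v - v⁻¹) (by rw [h]; simp) ?_
    rw [norm_false_even hn hk]
    rcases node_or_end n (a.1 + s) with ⟨c, hc⟩ | hc <;>
      rcases node_or_end n (b.1 - s) with ⟨d, hd⟩ | hd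
    · rw [norm_true_even_two hn hs hk ha hb hc hd,
        norm_true_odd_two (k := a) (b := k) hn hs (by omega) hc (by omega),
        norm_true_odd_two (k := b) (a := k) hn hs (by omega) (by omega) hd]
      field_simp
    · rw [norm_true_even_one hn hs hk ha hb hc hd,
        norm_true_odd_two (k := a) (b := k) hn hs (by omega) hc (by omega),
        norm_true_odd_one (s := -s) (k := b) (b := k) hn (by omega) (by omega) hd (by omega)]
      field_simp
    · rw [norm_true_even_one (s := -s) (a := b) (b := a) (c := d) hn (by omega) hk (by omega)
          (by omega) (by omega) (fun d' => by have := hc d'; omega),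
        norm_true_odd_one (k := a) (b := k) hn hs (by omega) hc (by omega),
        norm_true_odd_two (k := b) (a := k) hn hs (by omega) (by omega) hd]
      field_simp
    · rw [norm_true_even_zero hs hk ha hb hc hd,
        norm_true_odd_one (k := a) (b := k) hn hs (by omega) hc (by omega),
        norm_true_odd_one (s := -s) (k := b) (b := k) hn (by omega) (by omega) hd (by omega)]
      field_simp
  · have hone : ∀ {s : ℤ} {b : Node n}, (s = 1 ∨ s = -1) → (b.1 : ℤ) = k.1 - s →
        (∀ a : Node n, (a.1 : ℤ) ≠ k.1 + s) →
        dualRootVector (false, k) * dualRootVector (true, k) =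
          v ^ (-rootForm (beta (false, k)) (beta (true, k))) •
            (dualRootVector (true, k) * dualRootVector (false, k)) -
          (v - v⁻¹) • (zAt n (k.1 + s) * zAt n (k.1 - s)) := by
      intro s b hs hb ha
      have hkb : cartan k b = -1 := cartan_comm b k ▸ cartan_of_eq_add hs (by omega)
      have he : rootForm (beta (false, k)) (beta (true, k)) = -1 := by
        rw [beta_false_odd hk, beta_true_odd hk,
          rootForm_SL_mem (pairwise_odds n) (mem_odds.2 hk),
          isParityClass_evens.SL_not_mem (by omega) (by omega), sum_adj_one hs ha hb]
        simp [rootForm_add_right, rootForm_simpleRoot, cartan_self, hkb]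
      have h := congrArg (TO n) (fU_kU_mul_br hkb)
      rw [← isParityClass_evens.TL_one hs (by omega) (by omega) ha hb, map_mul,
        TL_fU_mul_kU_mem (pairwise_odds n) (mem_odds.2 hk), map_sub, map_smul, map_mul,
        TL_fU_mul_kU_mem (pairwise_odds n) (mem_odds.2 hk), map_smul,
        ← rootVector_true_odd hk, ← rootVector_false_even (i := b) (by omega)] at h
      rw [zAt_end ha, zAt_node hb, zIdx_even (by omega), dualRootVector,
        dualRootVector, dualRootVector, he, rootVector_false_odd hk, ← one_smul Kv (1 : Uq n)]
      -- At an end the coefficient is `v`, but the norms are off by one factor, and `v (1 - v⁻²) = v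
      -- - v⁻¹`.
      refine relation_smul (c := v) (by rw [h]; simp) ?_
      rw [← rootVector_false_odd hk, norm_false_odd hk, norm_true_odd_one hn hs hk ha hb,
        norm_false_even hn (by omega), ← v_mul_one_sub]
      field_simp
    rcases node_or_end n (k.1 + s) with ⟨a, ha⟩ | ha
    · rcases node_or_end n (k.1 - s) with ⟨b, hb⟩ | hb
      · have hka : cartan k a = -1 := cartan_of_eq_add hs ha
        have hkb : cartan k b = -1 := cartan_comm b k ▸ cartan_of_eq_add hs (by omega)
        have hba : cartan b a = 0 := cartan_of_ne (by omega) (by omega) (by omega)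
        have he : rootForm (beta (false, k)) (beta (true, k)) = 0 := by
          rw [beta_false_odd hk, beta_true_odd hk,
            rootForm_SL_mem (pairwise_odds n) (mem_odds.2 hk),
            isParityClass_evens.SL_not_mem (by omega) (by omega), sum_adj_two hs ha hb]
          simp [rootForm_add_right, rootForm_simpleRoot, cartan_self, hka, hkb]
        have h := congrArg (TO n) (fU_kU_mul_br_br hka hkb hba)
        rw [← isParityClass_evens.TL_two hs (by omega) (by omega) ha hb, map_mul,
          TL_fU_mul_kU_mem (pairwise_odds n) (mem_odds.2 hk), map_sub, map_mul,
          TL_fU_mul_kU_mem (pairwise_odds n) (mem_odds.2 hk), map_smul, map_mul,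
          ← rootVector_true_odd hk, ← rootVector_false_even (i := a) (by omega),
          ← rootVector_false_even (i := b) (by omega)] at h
        rw [zAt_node ha, zAt_node hb, zIdx_even (by omega), zIdx_even (by omega), dualRootVector,
          dualRootVector, dualRootVector, dualRootVector, he, rootVector_false_odd hk]
        refine relation_smul (c := v - v⁻¹) (by rw [h]; simp) ?_
        rw [← rootVector_false_odd hk, norm_false_odd hk, norm_true_odd_two hn hs hk ha hb,
          norm_false_even hn (by omega), norm_false_even hn (by omega)]
        field_simp
      · rw [hone (s := -s) (b := a) (by omega) (by omega) (by simpa [sub_eq_add_neg] using hb), sub_neg_eq_add, ← sub_eq_add_neg,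
          (commute_zAt (by omega)).eq]
    · obtain ⟨b, hb⟩ := exists_other h3 hs ha
      exact hone hs hb ha

/-- The relation between `y_a` and `y_k` for neighbours `a`, `k`, where `a` is odd. -/
theorem dualRootVector_mul_neighbour (hn : Odd n) {s : ℤ} (hs : s = 1 ∨ s = -1) {a k : Node n}
    (hk : k.1 % 2 = 0) (ha : (a.1 : ℤ) = k.1 + s) :
    dualRootVector (false, a) * dualRootVector (true, k) =
      v ^ (-rootForm (beta (false, a)) (beta (true, k))) •
        (dualRootVector (true, k) * dualRootVector (false, a)) -
      (v - v⁻¹) • (zAt n (a.1 + s) * zAt n (k.1 - s)) := by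
  have hκ := one_sub_ne_zero
  have ha' : a.1 % 2 = 1 := by omega
  obtain ⟨b, hb⟩ := exists_next_even hn hk (s := -s) (by omega)
  have hb' : (b.1 : ℤ) = k.1 - s := by omega
  have hak : cartan a k = -1 := cartan_comm k a ▸ cartan_of_eq_add hs ha
  have hka : cartan k a = -1 := cartan_of_eq_add hs ha
  have hbk : cartan b k = -1 := cartan_of_eq_add hs (by omega)
  have hba : cartan b a = 0 := cartan_of_ne (by omega) (by omega) (by omega)
  have hab : cartan a b = 0 := cartan_of_ne (by omega) (by omega) (by omega)
  have hX := isParityClass_evens.TL_TL_two isParityClass_odds rfl hs hk ha hb'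
  have hR := isParityClass_evens.TL_eq_br_ext (s := -s) (by omega) hk hb
  -- Now `T_E T_O(E_k)` is the bracket of `ext s a` with `R = T_E(E_b)`, and `F_a` meets only the
  -- factor `E_a` of the former. It remains to know that `R` commutes with `F_a` and has weight `-1`
  -- there.
  rw [← hR] at hX
  have hRa : ∃ w, HasWt (TE n (eU b)) w ∧ w a = -1 := by
    rw [hR]
    rcases next_or_end (-s) b with ⟨d, hd⟩ | hd
    · rw [ext_of_next hd]
      refine ⟨_, ((hasWt_eU b).br (hasWt_eU d)).br (hasWt_eU k), ?_⟩
      simp only [Pi.add_apply, hab, hak]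
      rw [cartan_of_ne (a := a) (b := d) (by omega) (by omega) (by omega)]
      rfl
    · rw [ext_of_end hd]
      refine ⟨_, (hasWt_eU b).br (hasWt_eU k), ?_⟩
      simp only [Pi.add_apply, hab, hak]
      rfl
  obtain ⟨w, hw, hwa⟩ := hRa
  have hRf : Commute (TE n (eU b)) (fU a) :=
    (isParityClass_evens.commute_TL (by omega) (by omega) fun c hc =>
      (commute_eU_fU (node_ne (by
        rcases hc with rfl | hc
        · omega
        · simp only [Adj] at hc; omega))).symm).symm
  have he : rootForm (beta (false, a)) (beta (true, k)) =
      -rootForm (simpleRoot k + (simpleRoot a + simpleRoot b))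
        (SL (evens n) (simpleRoot a)) := by
    rw [beta_false_odd ha', beta_true_even hk, rootForm_SL_mem (pairwise_odds n) (mem_odds.2 ha'),
      rootForm_SL_comm (pairwise_evens n), isParityClass_odds.SL_not_mem (by omega) (by omega),
      sum_adj_two hs ha hb']
  -- The product `y_a y_k` is pulled back through the odd block, where `E_a` becomes `-F_a K_a`.
  have hrv : eU a * rootVector (true, k) = TO n (-(fU a * ↑(kU a)) * TE n (TO n (eU k))) := by
    rw [map_mul, TL_fU_mul_kU_mem (pairwise_odds n) (mem_odds.2 ha'), rootVector_true_even hk]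
  have hrv' : TO n (TE n (TO n (eU k)) * -(fU a * ↑(kU a))) = rootVector (true, k) * eU a := by
    rw [map_mul, TL_fU_mul_kU_mem (pairwise_odds n) (mem_odds.2 ha'), rootVector_true_even hk]
  rcases next_or_end s a with ⟨c, hc⟩ | hc
  · have hac : cartan a c = -1 := cartan_of_eq_add hs hc
    have hRc : Commute (TE n (eU b)) (eU c) :=
      (isParityClass_evens.commute_TL (by omega) (by omega) fun c' hc' =>
        commute_eU_of_ne
          (by rcases hc' with rfl | hc'
              · omega
              · simp only [Adj] at hc'; omega)
          (by rcases hc' with rfl | hc'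
              · omega
              · simp only [Adj] at hc'; omega)).symm
    have he0 : rootForm (beta (false, a)) (beta (true, k)) = 0 := by
      rw [he, isParityClass_evens.SL_not_mem (by omega) (by omega),
        sum_adj_two (a := c) (b := k) hs hc (by omega)]
      have h1 : cartan k c = 0 := cartan_of_ne (by omega) (by omega) (by omega)
      have h2 : cartan b c = 0 := cartan_of_ne (by omega) (by omega) (by omega)
      simp [rootForm_add_right, rootForm_add_left, rootForm_simpleRoot, cartan_self, hak, hka,
        hbk, hba, hac, h1, h2]
    rw [hX, ext_of_next hc, fU_kU_mul_br_br_left hw hwa hRf hac hRc, map_sub, ← ext_of_next hc,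
      ← hX, hrv', map_smul, hRc.eq, map_mul, ← rootVector_true_odd (i := b) (by omega),
      ← rootVector_false_even (i := c) (by omega)] at hrv
    rw [zAt_node hc, zAt_node hb', zIdx_even (by omega), zIdx_odd (by omega), dualRootVector,
      dualRootVector, dualRootVector, dualRootVector, he0, rootVector_false_odd ha']
    refine relation_smul (c := v - v⁻¹) (by rw [hrv]; simp) ?_
    rw [← rootVector_false_odd ha', norm_false_odd ha', norm_false_even hn (by omega)]
    rcases node_or_end n (b.1 - s) with ⟨d, hd⟩ | hd
    · rw [norm_true_even_two hn hs hk ha hb' hc hd,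
        norm_true_odd_two (k := b) (a := k) hn hs (by omega) (by omega) hd]
      field_simp
    · rw [norm_true_even_one hn hs hk ha hb' hc hd,
        norm_true_odd_one (s := -s) (k := b) (b := k) hn (by omega) (by omega) hd (by omega)]
      field_simp
  · have he0 : rootForm (beta (false, a)) (beta (true, k)) = -1 := by
      rw [he, isParityClass_evens.SL_not_mem (by omega) (by omega),
        sum_adj_one (b := k) hs hc (by omega)]
      simp [rootForm_add_right, rootForm_add_left, rootForm_simpleRoot, cartan_self, hak, hka,
        hbk, hba]
    rw [ext_of_end hc] at hX
    rw [hX, fU_kU_mul_br_left hw hwa hRf, map_sub, ← hX, map_smul, hrv', map_smul, ← rootVector_true_odd (i := b) (by omega)] at hrv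
    rw [zAt_end hc, zAt_node hb', zIdx_odd (by omega), dualRootVector,
      dualRootVector, dualRootVector, he0, rootVector_false_odd ha', ← one_smul Kv (1 : Uq n)]
    refine relation_smul (c := v) (by rw [hrv]; simp) ?_
    rw [← rootVector_false_odd ha', norm_false_odd ha', ← v_mul_one_sub]
    rcases node_or_end n (b.1 - s) with ⟨d, hd⟩ | hd
    · rw [norm_true_even_one (s := -s) (a := b) (b := a) (c := d) hn (by omega) hk (by omega)
          (by omega) (by omega) (fun d' => by have := hc d'; omega),
        norm_true_odd_two (k := b) (a := k) hn hs (by omega) (by omega) hd]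
      field_simp
    · rw [norm_true_even_zero hs hk ha hb' hc hd,
        norm_true_odd_one (s := -s) (k := b) (b := k) hn (by omega) (by omega) hd (by omega)]
      rw [pow_one, one_mul, inv_one, mul_one, mul_one, mul_inv_cancel_right₀ hκ]

/-! ### The elements `p_k` commute with all root vectors up to powers of `v` -/

theorem node_parity_cases (x : Idx n) : (∃ i : Node n, x = (false, i) ∧ i.1 % 2 = 1) ∨
    (∃ i : Node n, x = (false, i) ∧ i.1 % 2 = 0) ∨ (∃ i : Node n, x = (true, i) ∧ i.1 % 2 = 1) ∨
    (∃ i : Node n, x = (true, i) ∧ i.1 % 2 = 0) := by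
  obtain ⟨b, i⟩ := x
  rcases mod_two_cases i with hi | hi <;> cases b <;> simp [hi]

theorem block_false_odd {i : Node n} (hi : i.1 % 2 = 1) : block (false, i) = 0 := by
  simp [block, hi]
theorem block_false_even {i : Node n} (hi : i.1 % 2 = 0) : block (false, i) = 1 := by
  simp [block, hi]
theorem block_true_odd {i : Node n} (hi : i.1 % 2 = 1) : block (true, i) = 2 := by
  simp [block, hi]
theorem block_true_even {i : Node n} (hi : i.1 % 2 = 0) : block (true, i) = 3 := by
  simp [block, hi]

/-- The hypotheses exclude exactly the pairs with correction terms. Each of the six ordered pairs of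
blocks is covered by one of the four preceding commutation lemmas. -/
theorem vcomm_of_block_lt (hn : Odd n) {x y : Idx n} (h : block x < block y) (h1 : x.2 ≠ y.2)
    (h2 : Adj x.2 y.2 → ¬(x = yIdx x.2 ∧ y = yIdx y.2)) :
    VComm v (-rootForm (beta x) (beta y)) (rootVector x) (rootVector y) := by
  rcases node_parity_cases x with ⟨i, rfl, hi⟩ | ⟨i, rfl, hi⟩ | ⟨i, rfl, hi⟩ | ⟨i, rfl, hi⟩ <;>
  rcases node_parity_cases y with ⟨k, rfl, hk⟩ | ⟨k, rfl, hk⟩ | ⟨k, rfl, hk⟩ | ⟨k, rfl, hk⟩ <;>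
  simp only [block_false_odd, block_false_even, block_true_odd, block_true_even, hi, hk, lt_irrefl,
    Nat.not_lt_zero, Nat.reduceLT] at h
  · exact vcomm_first _ hi hk
  · exact vcomm_same_parity h1 (by omega)
  · exact vcomm_far hn hi hk fun h => h2 h (by simp [yIdx_odd hi, yIdx_even hk])
  · exact vcomm_second hi hk
  · exact vcomm_same_parity h1 (by omega)
  · exact vcomm_first _ hi hk

/-- The exponent with which root vectors `v`-commute in general. -/
def ex (x y : Idx n) : ℤ :=
  if block x < block y then -rootForm (beta x) (beta y)
  else if block y < block x then rootForm (beta x) (beta y) else 0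

theorem vcomm_dual (hn : Odd n) {x y : Idx n} (h1 : x.2 = y.2 → x = y)
    (h2 : Adj x.2 y.2 → ¬(x = yIdx x.2 ∧ y = yIdx y.2)) :
    VComm v (ex x y) (dualRootVector x) (dualRootVector y) := by
  refine VComm.smul_left (VComm.smul_right ?_ _) _
  have hne : block x ≠ block y → x.2 ≠ y.2 := fun h h' => h (by rw [h1 h'])
  rw [ex]
  split_ifs with h h'
  · exact vcomm_of_block_lt hn h (hne h.ne) h2
  · have := (vcomm_of_block_lt hn h' (hne h'.ne').symm fun h ⟨ha, hb⟩ =>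
      h2 (by simp only [Adj] at h ⊢; omega) ⟨hb, ha⟩).symm v_ne_zero
    rwa [neg_neg, rootForm_comm] at this
  · exact VComm.of_commute (commute_rootVector (by omega))

/-- The position of the block of `x` relative to the block of `z_m`. -/
def sgn (x : Idx n) (m : ℤ) : ℤ := Int.sign (block x - (1 + m % 2))

theorem block_zIdx (a : Node n) : block (zIdx a) = 1 + a.1 % 2 := by
  rcases mod_two_cases a with h | h
  · rw [zIdx_even h, block_false_even h, h]
  · rw [zIdx_odd h, block_true_odd h, h]

theorem vcomm_zAt (hn : Odd n) {x : Idx n} {m : ℤ} (h : ∀ a : Node n, (a.1 : ℤ) = m → x ≠ yIdx a)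
    : VComm v (sgn x m * rootForm (beta x) (dAt n m)) (dualRootVector x) (zAt n m) := by
  rcases node_or_end n m with ⟨a, ha⟩ | ha
  · rw [zAt_node ha, dAt_node ha]
    have hyz : zIdx a ≠ yIdx a := by
      rcases mod_two_cases a with h | h
      · simp [zIdx_even h, yIdx_even h]
      · simp [zIdx_odd h, yIdx_odd h]
    have hor : x.2 = a → x = yIdx a ∨ x = zIdx a := by
      obtain ⟨b, i⟩ := x
      rintro rfl
      rcases mod_two_cases i with hp | hp <;> cases b <;>
        simp [zIdx_even, yIdx_even, zIdx_odd, yIdx_odd, hp]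
    have := vcomm_dual (x := x) (y := zIdx a) hn
      (fun h' => (hor h').resolve_left (h a ha)) fun _ hh => hyz hh.2
    convert this using 1
    rw [ex, block_zIdx, sgn, ← ha]
    rcases lt_trichotomy (block x) (1 + a.1 % 2) with h | h | h
    · rw [if_pos h, Int.sign_eq_neg_one_of_neg (by omega), neg_one_mul]
    · rw [if_neg (by omega), if_neg (by omega), Int.sign_eq_zero_iff_zero.2 (by omega), zero_mul]
    · rw [if_neg (by omega), if_pos h, Int.sign_eq_one_of_pos (by omega), one_mul]
  · rw [zAt_end ha, dAt_end ha, rootForm_zero_right, mul_zero]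
    exact VComm.one_right _

/-- The exponent with which a root vector `v`-commutes with `p_k`. -/
def lam (k : Node n) (x : Idx n) : ℤ := ex x (false, k) + ex x (true, k)

/-- For both parities the product in `p_k` is taken in the order of the word, because `y_k` comes
first for odd `k` and `z_k` for even `k`. The neighbouring `z`'s commute, so the direction `s` is
free. -/
theorem pElt_eq {s : ℤ} (hs : s = 1 ∨ s = -1) (k : Node n) :
    pElt n k.1 = dualRootVector (false, k) * dualRootVector (true, k) -
      v⁻¹ • (zAt n (k.1 + s) * zAt n (k.1 - s)) := by
  have hk0 := Finset.mem_Icc.1 k.2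
  have h1 : zElt n (k.1 - 1) * zElt n (k.1 + 1) = zAt n (k.1 + s) * zAt n (k.1 - s) := by
    rcases hs with rfl | rfl
    · rw [(commute_zAt (by omega)).eq, zAt, zAt]
      congr 2
      omega
    · rw [zAt, zAt]
      congr 2 <;> omega
  rw [pElt, h1, yElt, zElt, dif_pos k.2, dif_pos k.2]
  rcases mod_two_cases k with hk | hk
  · rw [if_neg (by rw [Nat.odd_iff]; omega), yIdx_even hk, zIdx_even hk]
  · rw [if_pos (by rw [Nat.odd_iff]; omega), yIdx_odd hk, zIdx_odd hk]

/-- Both neighbouring `z`'s lie in one block, so they contribute with the same sign; their degrees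
add up to those of the two vectors of `k` by the mesh relation. -/
theorem vcomm_mul_zAt (hn : Odd n) (h3 : 3 ≤ n) {x : Idx n} {k : Node n}
    (h : ∀ a : Node n, Adj a k → x ≠ yIdx a) :
    VComm v (sgn x (k.1 + 1) * (rootForm (beta x) (beta (false, k)) +
      rootForm (beta x) (beta (true, k)))) (dualRootVector x)
      (zAt n (k.1 + 1) * zAt n (k.1 - 1)) := by
  have hs : sgn x (k.1 - 1 : ℤ) = sgn x (k.1 + 1 : ℤ) := by
    rw [sgn, sgn]
    congr 3
    omega
  rw [← rootForm_add_right, beta_add_beta, nbrDeg_eq h3 (Or.inl rfl), rootForm_add_right, mul_add]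
  nth_rw 2 [← hs]
  exact (vcomm_zAt hn fun a ha => h a (by simp only [Adj]; omega)).mul_right v_ne_zero
    (vcomm_zAt hn fun a ha => h a (by simp only [Adj]; omega))

theorem rootForm_beta_ne (b : Bool) {i k : Node n} (h : i ≠ k) (hp : i.1 % 2 = k.1 % 2) :
    rootForm (beta (b, i)) (beta (b, k)) = 0 := by
  rw [rootForm_beta_same b hp, cartan_eq_zero_of_parity h hp]

/-- Compares the exponents of the two terms of `p_k`. The block of the neighbouring `z`'s lies
between the two blocks of `k`. For `x` in that middle block the sign is zero and the two pairings
cancel in `lam`; for `x` in a block of `k` one pairing vanishes by orthogonality; otherwise all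
signs agree. -/
theorem sgn_mul_eq_lam {x : Idx n} {k : Node n} (h : x.2 ≠ k) :
    sgn x (k.1 + 1) * (rootForm (beta x) (beta (false, k)) + rootForm (beta x) (beta (true, k))) =
      lam k x := by
  have h2 : Int.sign 2 = 1 := rfl
  rcases mod_two_cases k with hk | hk
  · have hm : (k.1 + 1 : ℤ) % 2 = 1 := by omega
    rcases node_parity_cases x with ⟨i, rfl, hi⟩ | ⟨i, rfl, hi⟩ | ⟨i, rfl, hi⟩ | ⟨i, rfl, hi⟩ <;>
      simp [sgn, hm, h2, lam, ex, block_false_odd, block_false_even, block_true_odd, block_true_even,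
        hi, hk]
    · ring
    · rw [rootForm_beta_ne _ (show i ≠ k from h) (by omega)]
    · rw [rootForm_beta_first _ hi hk, rootForm_comm, rootForm_beta_second hk hi, cartan_comm]
      ring
    · rw [rootForm_beta_ne _ (show i ≠ k from h) (by omega)]
  · have hm : (k.1 + 1 : ℤ) % 2 = 0 := by omega
    rcases node_parity_cases x with ⟨i, rfl, hi⟩ | ⟨i, rfl, hi⟩ | ⟨i, rfl, hi⟩ | ⟨i, rfl, hi⟩ <;>
      simp [sgn, hm, h2, lam, ex, block_false_odd, block_false_even, block_true_odd, block_true_even,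
        hi, hk]
    · rw [rootForm_beta_ne _ (show i ≠ k from h) (by omega)]
    · rw [rootForm_beta_second hi hk, rootForm_comm, rootForm_beta_first _ hk hi, cartan_comm]
      ring
    · rw [rootForm_beta_ne _ (show i ≠ k from h) (by omega)]

theorem vcomm_pElt_of_ne (hn : Odd n) (h3 : 3 ≤ n) {x : Idx n} {k : Node n} (hk : x.2 ≠ k)
    (h : ∀ a : Node n, Adj a k → x ≠ yIdx a) :
    VComm v (lam k x) (dualRootVector x) (pElt n k.1) := by
  rw [pElt_eq (Or.inl rfl) k]
  refine VComm.sub_right ?_ (VComm.smul_right ?_ _)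
  · exact (vcomm_dual hn (fun h' => absurd h' hk) fun ha hh => h _ ha hh.1).mul_right v_ne_zero
      (vcomm_dual hn (fun h' => absurd h' hk) fun ha hh => h _ ha hh.1)
  · rw [← sgn_mul_eq_lam hk]
    exact vcomm_mul_zAt hn h3 h

theorem vcomm_pElt_same (hn : Odd n) (h3 : 3 ≤ n) (b : Bool) (k : Node n) :
    VComm v (lam k (b, k)) (dualRootVector (b, k)) (pElt n k.1) := by
  have h := dualRootVector_mul_same hn h3 (Or.inl rfl) k
  have h2 : ∀ b, rootForm (beta (b, k)) (beta (b, k)) = 2 := fun b => by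
    rw [rootForm_beta_same b rfl, cartan_self]
  have hz := vcomm_mul_zAt hn h3 (x := (b, k)) (k := k) fun a ha hk => by
    have := congrArg (fun x : Idx n => x.2.1) hk
    simp only [Adj, yIdx] at ha this
    omega
  rw [pElt_eq (Or.inl rfl) k]
  cases b
  · have hl : lam k (false, k) = -rootForm (beta (false, k)) (beta (true, k)) := by
      rcases mod_two_cases k with hk | hk <;>
        simp [lam, ex, block_false_odd, block_false_even, block_true_odd, block_true_even, hk]
    rw [hl]
    refine vcomm_self_first v_ne_zero h ?_
    convert hz using 1
    have hs : sgn (false, k) (k.1 + 1 : ℤ) = -1 := by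
      rcases mod_two_cases k with hk | hk
      · rw [sgn, block_false_even hk, show (k.1 + 1 : ℤ) % 2 = 1 by omega]; rfl
      · rw [sgn, block_false_odd hk, show (k.1 + 1 : ℤ) % 2 = 0 by omega]; rfl
    rw [hs, h2]
    ring
  · have hl : lam k (true, k) = rootForm (beta (false, k)) (beta (true, k)) := by
      rw [rootForm_comm]
      rcases mod_two_cases k with hk | hk <;>
        simp [lam, ex, block_false_odd, block_false_even, block_true_odd, block_true_even, hk]
    rw [hl]
    refine vcomm_self_second v_ne_zero h ?_
    convert hz using 1
    have hs : sgn (true, k) (k.1 + 1 : ℤ) = 1 := by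
      rcases mod_two_cases k with hk | hk
      · rw [sgn, block_true_even hk, show (k.1 + 1 : ℤ) % 2 = 1 by omega]; rfl
      · rw [sgn, block_true_odd hk, show (k.1 + 1 : ℤ) % 2 = 0 by omega]; rfl
    rw [hs, h2, rootForm_comm (beta (true, k))]
    ring

theorem vcomm_pElt_neighbour (hn : Odd n) (h3 : 3 ≤ n) {s : ℤ} (hs : s = 1 ∨ s = -1)
    {l k : Node n} (hl : (l.1 : ℤ) = k.1 + s) :
    VComm v (lam k (yIdx l)) (dualRootVector (yIdx l)) (pElt n k.1) := by
  have hs' : -s = 1 ∨ -s = -1 := by omega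
  have hkl : cartan k l = -1 := cartan_of_eq_add hs hl
  have hlk : cartan l k = -1 := cartan_comm k l ▸ hkl
  -- The mesh relation at `k`, with the summand `|z_l|` singled out, yields the compatibility `b + g
  -- = a - 1` of exponents required for the cancellation.
  have hmesh : ∀ x : Idx n, rootForm (beta x) (beta (false, k)) +
      rootForm (beta x) (beta (true, k)) =
      rootForm (beta x) (beta (zIdx l)) + rootForm (beta x) (dAt n (k.1 - s)) := fun x => by
    rw [← rootForm_add_right, beta_add_beta, nbrDeg_eq h3 hs, rootForm_add_right, dAt_node hl]
  have hR3 := dualRootVector_mul_same hn h3 hs' l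
  rw [← sub_eq_add_neg, sub_neg_eq_add, zAt_node (by omega : (k.1 : ℤ) = l.1 - s)] at hR3
  have hc := vcomm_zAt hn (x := yIdx l) (m := k.1 - s) fun a ha h => by
    have := congrArg (fun x : Idx n => x.2.1) h
    simp only [yIdx] at this
    omega
  rw [pElt_eq hs k, zAt_node hl]
  rcases mod_two_cases k with hk | hk
  · have hl1 : l.1 % 2 = 1 := by omega
    rw [yIdx_odd hl1, sgn, block_false_odd hl1, show (k.1 - s : ℤ) % 2 = 1 by omega,
      show Int.sign ((0 : ℕ) - (1 + 1)) = -1 from rfl] at hc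
    rw [zIdx_even hk] at hR3
    rw [yIdx_odd hl1, zIdx_odd hl1]
    have hm := hmesh (false, l)
    rw [zIdx_odd hl1, rootForm_beta_first _ hl1 hk, hlk] at hm
    have hlam : lam k (false, l) = -rootForm (beta (false, l)) (beta (true, k)) - 1 := by
      simp [lam, ex, block_false_odd, block_false_even, block_true_even, hk, hl1,
        rootForm_beta_first _ hl1 hk, hlk]
      ring
    rw [hlam]
    refine vcomm_neighbour_even v_ne_zero (dualRootVector_mul_neighbour hn hs hk hl) hR3 ?_ hc
      (by linarith)
    have := vcomm_first false hl1 hk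
    rw [rootForm_beta_first _ hl1 hk, hlk] at this
    exact (this.smul_left _).smul_right _
  · have hl0 : l.1 % 2 = 0 := by omega
    have hcomm : Commute (dualRootVector (false, l)) (zAt n (k.1 - s)) := by
      have := commute_zAt (n := n) (k := l.1) (l := k.1 - s) (by omega)
      rwa [zAt_node rfl, zIdx_even hl0] at this
    rw [yIdx_even hl0, sgn, block_true_even hl0, show (k.1 - s : ℤ) % 2 = 0 by omega,
      show Int.sign ((3 : ℕ) - (1 + 0)) = 1 from rfl, one_mul] at hc
    rw [zIdx_odd hk] at hR3
    rw [yIdx_even hl0, zIdx_even hl0, hcomm.eq]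
    have hm := hmesh (true, l)
    rw [zIdx_even hl0, rootForm_comm _ (beta (true, k)), rootForm_beta_first _ hk hl0, hkl,
      rootForm_comm _ (beta (false, k)), rootForm_comm _ (beta (false, l))] at hm
    have hlam : lam k (true, l) = -(-rootForm (beta (false, k)) (beta (true, l)) - 1) := by
      simp [lam, ex, block_false_odd, block_true_odd, block_true_even, hk, hl0,
        rootForm_comm (beta (true, l)), rootForm_beta_first _ hk hl0, hkl, add_comm]
    rw [hlam]
    refine (vcomm_neighbour_odd v_ne_zero
      (?_ : _ = _ - _ • (zAt n (k.1 - s) * zAt n (l.1 + s))) hR3 ?_ (hc.symm v_ne_zero) ?_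
      (by linarith)).symm v_ne_zero
    · have := dualRootVector_mul_neighbour hn hs' hl0 (by omega : (k.1 : ℤ) = l.1 + -s)
      rwa [← sub_eq_add_neg, sub_neg_eq_add] at this
    · have := vcomm_first true hk hl0
      rw [rootForm_beta_first _ hk hl0, hkl] at this
      exact (this.smul_left _).smul_right _
    · have := commute_zAt (n := n) (k := l.1 + s) (l := l.1 - s) (by omega)
      rwa [zAt_node (by omega : (k.1 : ℤ) = l.1 - s), zIdx_odd hk] at this

theorem vcomm_pElt (hn : Odd n) (h3 : 3 ≤ n) (k : Node n) (x : Idx n) :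
    VComm v (lam k x) (dualRootVector x) (pElt n k.1) := by
  by_cases hk : x.2 = k
  · obtain ⟨b, i⟩ := x
    simp only at hk
    subst hk
    exact vcomm_pElt_same hn h3 b i
  by_cases h : ∀ a : Node n, Adj a k → x ≠ yIdx a
  · exact vcomm_pElt_of_ne hn h3 hk h
  push Not at h
  obtain ⟨a, ha, rfl⟩ := h
  rcases ha with ha | ha
  · exact vcomm_pElt_neighbour hn h3 (Or.inr rfl) (by omega)
  · exact vcomm_pElt_neighbour hn h3 (Or.inl rfl) (by omega)

/-! ### Commutation of `p_k` with the dual Poincaré–Birkhoff–Witt basis -/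

/-- Needed to go back from dual root vectors to root vectors, of which the PBW monomials are made.
-/
theorem norm_ne_zero (hn : Odd n) (h3 : 3 ≤ n) (x : Idx n) :
    kashiwaraForm (rootVector x) (rootVector x) ≠ 0 := by
  have hκ := one_sub_ne_zero
  rcases node_parity_cases x with ⟨k, rfl, hk⟩ | ⟨k, rfl, hk⟩ | ⟨k, rfl, hk⟩ | ⟨k, rfl, hk⟩
  · rw [norm_false_odd hk]
    exact one_ne_zero
  · rw [norm_false_even hn hk]
    exact pow_ne_zero _ hκ
  · have h1 : ∀ {s : ℤ}, (s = 1 ∨ s = -1) → (∀ a : Node n, (a.1 : ℤ) ≠ k.1 + s) →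
        kashiwaraForm (rootVector (true, k)) (rootVector (true, k)) ≠ 0 := fun hs ha => by
      obtain ⟨b, hb⟩ := exists_other h3 hs ha
      rw [norm_true_odd_one hn hs hk ha hb]
      exact pow_ne_zero _ hκ
    rcases node_or_end n (k.1 + 1) with ⟨a, ha⟩ | ha
    · rcases node_or_end n (k.1 + -1) with ⟨b, hb⟩ | hb
      · rw [norm_true_odd_two (b := b) hn (Or.inl rfl) hk ha (by omega)]
        exact pow_ne_zero _ hκ
      · exact h1 (Or.inr rfl) hb
    · exact h1 (Or.inl rfl) ha
  · obtain ⟨a, ha⟩ := exists_next_even hn hk (s := 1) (Or.inl rfl)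
    obtain ⟨b, hb⟩ := exists_next_even hn hk (s := -1) (Or.inr rfl)
    rcases node_or_end n (a.1 + 1) with ⟨c, hc⟩ | hc <;>
      rcases node_or_end n (b.1 - 1) with ⟨d, hd⟩ | hd
    · rw [norm_true_even_two (b := b) hn (Or.inl rfl) hk ha (by omega) hc hd]
      exact pow_ne_zero _ hκ
    · rw [norm_true_even_one (b := b) hn (Or.inl rfl) hk ha (by omega) hc hd]
      exact pow_ne_zero _ hκ
    · rw [norm_true_even_one (s := -1) (a := b) (b := a) (c := d) hn (Or.inr rfl) hk (by omega)
        (by omega) (by omega) (fun d' => by have := hc d'; omega)]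
      exact pow_ne_zero _ hκ
    · rw [norm_true_even_zero (b := b) (Or.inl rfl) hk ha (by omega) hc hd]
      exact one_ne_zero

theorem vcomm_rootVector_pElt (hn : Odd n) (h3 : 3 ≤ n) (k : Node n) (x : Idx n) :
    VComm v (lam k x) (rootVector x) (pElt n k.1) := by
  have := (vcomm_pElt hn h3 k x).smul_left (kashiwaraForm (rootVector x) (rootVector x))
  rwa [dualRootVector, smul_smul, mul_inv_cancel₀ (norm_ne_zero hn h3 x), one_smul] at this

theorem mem_order (x : Idx n) : x ∈ order n := by
  obtain ⟨b, i⟩ := x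
  rw [order_eq]
  rcases mod_two_cases i with h | h <;> cases b <;> simp [mem_odds, mem_evens, h]

theorem nodup_order (n : ℕ) : (order n).Nodup := by
  have h1 : (halfWord n).Nodup := by
    refine List.Nodup.append ((nodup_nodes n).filter _) ((nodup_nodes n).filter _) ?_
    intro i hi hi'
    simp only [List.mem_filter, decide_eq_true_eq] at hi hi'
    omega
  refine List.Nodup.append (h1.map fun a b h => (Prod.ext_iff.1 h).2)
    (h1.map fun a b h => (Prod.ext_iff.1 h).2) ?_
  intro x hx hx'
  obtain ⟨a, _, rfl⟩ := List.mem_map.1 hx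
  obtain ⟨b, _, h⟩ := List.mem_map.1 hx'
  exact absurd (Prod.ext_iff.1 h).1 (by simp)

theorem vcomm_dualPBW (hn : Odd n) (h3 : 3 ≤ n) (k : Node n) (a : Idx n → ℕ) :
    VComm v (∑ x, a x * lam k x) (dualPBW a) (pElt n k.1) := by
  refine VComm.smul_left ?_ _
  have h : ∀ L : List (Idx n), VComm v (L.map fun x => a x * lam k x).sum
      (L.map fun x => (qFactorial (a x))⁻¹ • rootVector x ^ a x).prod (pElt n k.1) := by
    intro L
    induction L with
    | nil => exact VComm.one_left _
    | cons x L ih =>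
      rw [List.map_cons, List.map_cons, List.sum_cons, List.prod_cons]
      exact ((((vcomm_rootVector_pElt hn h3 k x).pow_left v_ne_zero _).smul_left _).mul_left
        v_ne_zero ih)
  have h' := h (order n)
  rwa [← List.sum_toFinset _ (nodup_order n),
    Finset.eq_univ_of_forall fun x => List.mem_toFinset.2 (mem_order x)] at h'

/-! ### The exponents -/

theorem lam_y_odd_odd {i k : Node n} (hi : i.1 % 2 = 1) (hk : k.1 % 2 = 1) :
    lam k (yIdx i) = -rootForm (beta (zIdx k)) (beta (yIdx i)) := by
  rw [rootForm_comm]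
  simp [lam, ex, yIdx_odd, zIdx_odd, block_false_odd, block_true_odd, hi, hk]

theorem lam_y_even_odd {i k : Node n} (hi : i.1 % 2 = 0) (hk : k.1 % 2 = 1) :
    lam k (yIdx i) = rootForm (beta (yIdx k)) (beta (yIdx i)) +
      rootForm (beta (zIdx k)) (beta (yIdx i)) := by
  rw [rootForm_comm, rootForm_comm (beta (zIdx k))]
  simp [lam, ex, yIdx_odd, yIdx_even, zIdx_odd, block_false_odd, block_true_odd, block_true_even,
    hi, hk]

theorem lam_y_odd_even {i k : Node n} (hi : i.1 % 2 = 1) (hk : k.1 % 2 = 0) :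
    lam k (yIdx i) = -rootForm (beta (yIdx k)) (beta (yIdx i)) -
      rootForm (beta (zIdx k)) (beta (yIdx i)) := by
  rw [rootForm_comm, rootForm_comm (beta (zIdx k))]
  simp [lam, ex, yIdx_odd, yIdx_even, zIdx_even, block_false_odd, block_false_even,
    block_true_even, hi, hk]
  ring

theorem lam_y_even_even {i k : Node n} (hi : i.1 % 2 = 0) (hk : k.1 % 2 = 0) :
    lam k (yIdx i) = rootForm (beta (zIdx k)) (beta (yIdx i)) := by
  rw [rootForm_comm]
  simp [lam, ex, yIdx_even, zIdx_even, block_false_even, block_true_even, hi, hk]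

theorem lam_z_same {i k : Node n} (h : i.1 % 2 = k.1 % 2) :
    lam k (zIdx i) = if k.1 % 2 = 1 then rootForm (beta (yIdx k)) (beta (zIdx i))
      else -rootForm (beta (yIdx k)) (beta (zIdx i)) := by
  rw [rootForm_comm]
  rcases mod_two_cases k with hk | hk <;> rw [hk] at h <;>
    simp [lam, ex, yIdx_odd, yIdx_even, zIdx_odd, zIdx_even, block_false_odd, block_true_odd,
      block_false_even, block_true_even, h, hk]

/-- Here `z_i` lies in the block between the two blocks of `k`, so its exponents with them have
opposite signs; the pairings are both `-a_{ik}`, and they cancel. -/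
theorem lam_z_ne {i k : Node n} (h : i.1 % 2 ≠ k.1 % 2) : lam k (zIdx i) = 0 := by
  rcases mod_two_cases k with hk | hk
  · have hi : i.1 % 2 = 1 := by omega
    simp [lam, ex, zIdx_odd, block_true_odd, block_false_even, block_true_even, hi, hk,
      rootForm_beta_first _ hi hk, rootForm_comm (beta (true, i)) (beta (false, k)),
      rootForm_beta_second hk hi, cartan_comm k i]
  · have hi : i.1 % 2 = 0 := by omega
    simp [lam, ex, zIdx_even, block_true_odd, block_false_even, block_false_odd, hi, hk,
      rootForm_comm (beta (false, i)) (beta (false, k)), rootForm_beta_first _ hk hi,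
      rootForm_beta_second hi hk, cartan_comm k i]

theorem rootForm_y_z_symm {i k : Node n} (h : i.1 % 2 = k.1 % 2) :
    rootForm (beta (yIdx i)) (beta (zIdx k)) = rootForm (beta (yIdx k)) (beta (zIdx i)) := by
  rcases mod_two_cases k with hk | hk <;> rw [hk] at h
  · rw [yIdx_even h, yIdx_even hk, zIdx_even h, zIdx_even hk, rootForm_comm,
      rootForm_comm (beta (true, k)), rootForm_beta_symm (by omega)]
  · rw [yIdx_odd h, yIdx_odd hk, zIdx_odd h, zIdx_odd hk, rootForm_beta_symm (by omega)]

theorem rootForm_y_z_ne {i k : Node n} (h : i.1 % 2 ≠ k.1 % 2) :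
    rootForm (beta (yIdx i)) (beta (zIdx k)) = -cartan i k := by
  rcases mod_two_cases k with hk | hk
  · have hi : i.1 % 2 = 1 := by omega
    rw [yIdx_odd hi, zIdx_even hk, rootForm_beta_first _ hi hk]
  · have hi : i.1 % 2 = 0 := by omega
    rw [yIdx_even hi, zIdx_odd hk, rootForm_comm, rootForm_beta_first _ hk hi, cartan_comm]

theorem beta_y_add_beta_z (k : Node n) : beta (yIdx k) + beta (zIdx k) = nbrDeg k := by
  rw [← beta_add_beta]
  rcases mod_two_cases k with hk | hk
  · rw [yIdx_even hk, zIdx_even hk, add_comm]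
  · rw [yIdx_odd hk, zIdx_odd hk]

/-- The exponents are compatible with the mesh relations. -/
theorem lam_mesh (i k : Node n) : lam k (yIdx i) + lam k (zIdx i) =
    ∑ a, if Adj a i then lam k (zIdx a) else 0 := by
  -- If the parities differ, the neighbours of `i` have the parity of `k`, and the sum over them is,
  -- up to sign, the pairing of `|y_k|` with `∑ |z_a| = |y_i| + |z_i|`.
  have hsum : i.1 % 2 ≠ k.1 % 2 → ∑ a, (if Adj a i then lam k (zIdx a) else 0) =
      if k.1 % 2 = 1 then rootForm (beta (yIdx k)) (beta (yIdx i) + beta (zIdx i))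
      else -rootForm (beta (yIdx k)) (beta (yIdx i) + beta (zIdx i)) := by
    intro h
    rw [beta_y_add_beta_z, nbrDeg, rootForm_sum_right]
    split_ifs with hk
    · refine Finset.sum_congr rfl fun a _ => ?_
      split_ifs with ha
      · simp only [Adj] at ha
        rw [lam_z_same (by omega), if_pos hk]
      · rw [rootForm_zero_right]
    · rw [← Finset.sum_neg_distrib]
      refine Finset.sum_congr rfl fun a _ => ?_
      split_ifs with ha
      · simp only [Adj] at ha
        rw [lam_z_same (by omega), if_neg hk]
      · rw [rootForm_zero_right, neg_zero]
  -- If the parities agree, each neighbouring `z_a` commutes with `p_k`, and it remains that the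
  -- exponents of `y_i` and `z_i` are opposite.
  have hsum' : i.1 % 2 = k.1 % 2 → ∑ a, (if Adj a i then lam k (zIdx a) else 0) = 0 := by
    intro h
    refine Finset.sum_eq_zero fun a _ => ?_
    split_ifs with ha
    · simp only [Adj] at ha
      exact lam_z_ne (by omega)
    · rfl
  rcases mod_two_cases k with hk | hk <;> rcases mod_two_cases i with hi | hi
  · rw [hsum' (by omega), lam_y_even_even hi hk, lam_z_same (by omega), if_neg (by omega),
      rootForm_comm, rootForm_y_z_symm (by omega), add_neg_cancel]
  · rw [hsum (by omega), lam_y_odd_even hi hk, lam_z_ne (by omega), if_neg (by omega),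
      rootForm_add_right, rootForm_comm (beta (zIdx k)), rootForm_y_z_ne (by omega),
      rootForm_y_z_ne (by omega), cartan_comm]
    ring
  · rw [hsum (by omega), lam_y_even_odd hi hk, lam_z_ne (by omega), if_pos hk,
      rootForm_add_right, rootForm_comm (beta (zIdx k)), rootForm_y_z_ne (by omega),
      rootForm_y_z_ne (by omega), cartan_comm, add_zero]
  · rw [hsum' (by omega), lam_y_odd_odd hi hk, lam_z_same (by omega), if_pos hk,
      rootForm_comm, rootForm_y_z_symm (by omega), neg_add_cancel]

theorem sum_straighteningVector (i : Node n) (f : Idx n → ℤ) :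
    ∑ x, straighteningVector i x * f x =
      f (yIdx i) + f (zIdx i) - ∑ a, if Adj a i then f (zIdx a) else 0 := by
  simp only [straighteningVector, sub_mul, add_mul, ite_mul, one_mul, zero_mul,
    Finset.sum_sub_distrib, Finset.sum_add_distrib, Finset.sum_ite_eq', Finset.mem_univ, if_true]
  congr 1
  rw [Fintype.sum_prod_type, Finset.sum_comm]
  refine Finset.sum_congr rfl fun a _ => ?_
  simp only [Fintype.sum_bool, zIdx, Prod.mk.injEq, and_true, Adj]
  by_cases h : Odd a.1 <;> simp [h]

/-- The vectors `a` and `b` differ by straightening vectors, and `lam k` is orthogonal to each of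
these by `lam_mesh`. -/
theorem sum_lam_of_below {a b : Idx n → ℕ} (h : Below a b) (k : Node n) :
    ∑ x, (b x : ℤ) * lam k x = ∑ x, (a x : ℤ) * lam k x := by
  obtain ⟨m, hm⟩ := h
  have h0 : ∑ x, (∑ i, (m i : ℤ) * straighteningVector i x) * lam k x = 0 := by
    simp only [Finset.sum_mul, mul_assoc]
    rw [Finset.sum_comm]
    refine Finset.sum_eq_zero fun i _ => ?_
    rw [← Finset.mul_sum, sum_straighteningVector, lam_mesh, sub_self, mul_zero]
  simp only [hm, sub_mul, Finset.sum_sub_distrib, h0, sub_zero]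

/-- Elements which are triangular with leading exponent `a` commute with `p_k` up to a power
of `v`. -/
theorem vcomm_of_isDualCanonical (hn : Odd n) (h3 : 3 ≤ n) {a : Idx n → ℕ} {D : Uq n}
    (hD : IsDualCanonical a D) (k : Node n) :
    VComm v (∑ x, a x * lam k x) D (pElt n k.1) := by
  obtain ⟨c, hc, h⟩ := hD.triangular
  rw [sub_eq_iff_eq_add.1 h]
  refine VComm.add_left ?_ (vcomm_dualPBW hn h3 k a)
  rw [Finsupp.sum, VComm, Finset.sum_mul, Finset.mul_sum, Finset.smul_sum]
  refine Finset.sum_congr rfl fun b hb => ?_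
  -- Each lower term inherits the exponent of the leading term, so the power of `v` can be pulled
  -- out of the sum.
  rw [← sum_lam_of_below (hc b hb).1]
  exact (vcomm_dualPBW hn h3 k b).smul_left _

theorem sum_leadingExponent (i j : ℕ) (f : Idx n → ℤ) :
    ∑ x, (leadingExponent n i j x : ℤ) * f x =
      ∑ a : Node n, if i ≤ a.1 ∧ a.1 ≤ j then f (yIdx a) else 0 := by
  rw [Fintype.sum_prod_type, Finset.sum_comm]
  refine Finset.sum_congr rfl fun a _ => ?_
  simp only [Fintype.sum_bool, leadingExponent, yIdx, Prod.mk.injEq, and_true]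
  by_cases h : Even a.1 <;> simp [h]

theorem degY_node (a : Node n) : degY n a.1 = beta (yIdx a) := dif_pos a.2

theorem degZ_node (a : Node n) : degZ n a.1 = beta (zIdx a) := dif_pos a.2

/-- A sum over the nodes between `i` and `j`, sorted by parity. -/
theorem sum_nodes_between {i j : ℕ} (hi : 1 ≤ i) (hj : j ≤ n) (f : Node n → ℤ) (g h : ℕ → ℤ)
    (hg : ∀ a : Node n, a.1 % 2 = 1 → f a = g a.1) (hh : ∀ a : Node n, a.1 % 2 = 0 → f a = h a.1) :
    ∑ a : Node n, (if i ≤ a.1 ∧ a.1 ≤ j then f a else 0) =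
      ∑ s ∈ (Finset.Icc i j).filter Odd, g s + ∑ s ∈ (Finset.Icc i j).filter Even, h s := by
  have h1 : ∀ a : Node n, (if i ≤ a.1 ∧ a.1 ≤ j then f a else 0) =
      (fun s : ℕ => if i ≤ s ∧ s ≤ j then if Odd s then g s else h s else 0) a.1 := by
    intro a
    simp only
    split_ifs with h0 h1
    · exact hg a (Nat.odd_iff.1 h1)
    · exact hh a (by rw [Nat.odd_iff] at h1; omega)
    · rfl
  rw [Finset.sum_congr rfl fun a _ => h1 a, Finset.sum_coe_sort (Finset.Icc 1 n)
    (fun s : ℕ => if i ≤ s ∧ s ≤ j then if Odd s then g s else h s else 0), ← Finset.sum_filter,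
    Finset.sum_ite]
  have h2 : (Finset.Icc 1 n).filter (fun s => i ≤ s ∧ s ≤ j) = Finset.Icc i j := by
    ext s
    simp only [Finset.mem_filter, Finset.mem_Icc]
    omega
  rw [h2]
  simp only [Nat.not_odd_iff_even]

end QuantumTypeA

end

/-! ### The theorem: evaluation of the exponent for `k = j + 1`. -/

theorem mainTheorem7 (n : ℕ) (hn : Odd n) (i j : ℕ) (hi : 1 ≤ i) (hij : i ≤ j) (hj : j + 1 ≤ n)
    (D : Uq n) (hD : IsDelta n i j D) :
    (Even j → D * pElt n (j + 1) =
      v ^ (rootForm (degY n (j + 1)) (eSum n i j) + rootForm (degZ n (j + 1)) (eSum n i j)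
        - rootForm (degZ n (j + 1)) (oSum n i (j - 1))) • (pElt n (j + 1) * D)) ∧
    (Odd j → D * pElt n (j + 1) =
      v ^ (-rootForm (degY n (j + 1)) (oSum n i j) + rootForm (degZ n (j + 1)) (eSum n i j)
        - rootForm (degZ n (j + 1)) (oSum n i j)) • (pElt n (j + 1) * D)) := by
  -- From `1 ≤ i ≤ j ≤ n - 1` one gets `n ≥ 2`, and `n` is odd.
  have h3 : 3 ≤ n := by
    have := Nat.odd_iff.1 hn
    omega
  obtain ⟨k, hk⟩ : ∃ k : Node n, k.1 = j + 1 := ⟨⟨j + 1, Finset.mem_Icc.2 ⟨by omega, hj⟩⟩, rfl⟩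
  have h := vcomm_of_isDualCanonical hn h3 hD k
  rw [sum_leadingExponent, VComm] at h
  rw [← hk, degY_node, degZ_node]
  refine ⟨fun hpar => ?_, fun hpar => ?_⟩
  · have hk1 : k.1 % 2 = 1 := by
      have := Nat.even_iff.1 hpar
      omega
    -- As `j` is even, the index `j` contributes nothing to the sum over odd indices.
    have ho : oSum n i (j - 1) = oSum n i j := by
      refine Finset.sum_congr (Finset.ext fun s => ?_) fun _ _ => rfl
      have := Nat.even_iff.1 hpar
      simp only [Finset.mem_filter, Finset.mem_Icc, Nat.odd_iff]
      omega
    rw [sum_nodes_between hi (by omega) _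
      (fun s => -rootForm (beta (zIdx k)) (degY n s))
      (fun s => rootForm (beta (yIdx k)) (degY n s) + rootForm (beta (zIdx k)) (degY n s))
      (fun a ha => by rw [lam_y_odd_odd ha hk1, degY_node])
      (fun a ha => by rw [lam_y_even_odd ha hk1, degY_node]), Finset.sum_neg_distrib,
      Finset.sum_add_distrib, ← rootForm_sum_right, ← rootForm_sum_right,
      ← rootForm_sum_right] at h
    rw [h, ho]
    congr 2
    rw [oSum, eSum]
    ring
  · have hk0 : k.1 % 2 = 0 := by
      have := Nat.odd_iff.1 hpar
      omega
    rw [sum_nodes_between hi (by omega) _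
      (fun s => -rootForm (beta (yIdx k)) (degY n s) - rootForm (beta (zIdx k)) (degY n s))
      (fun s => rootForm (beta (zIdx k)) (degY n s))
      (fun a ha => by rw [lam_y_odd_even ha hk0, degY_node])
      (fun a ha => by rw [lam_y_even_even ha hk0, degY_node]), Finset.sum_sub_distrib,
      Finset.sum_neg_distrib, ← rootForm_sum_right, ← rootForm_sum_right,
      ← rootForm_sum_right] at h
    rw [h]
    congr 2
    rw [oSum, eSum]
    ring
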